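/- \textbf{Reachability games.} A two-tokens reachability game (2TRG) of order $|V_0|\times|V_1|$ is given by two finite directed graphs $G_0=(V_0,E_0)$, $G_1=(V_1,E_1)$ and a partition $(\mathcal F^0,\mathcal F^1)$ of its configurations, which are $\langle 0,u,v\rangle$ (Alice, player $0$, holds the turn) and $\langle 1,v,u\rangle$ (Bob, player $1$, holds the turn) for $u\in V_0$, $v\in V_1$. The player $P$ holding the turn may move from $\langle P,x,y\rangle$ to $\langle 1-P,y,x'\rangle$ with $(x,x')\in E_P$, or may stop the play. A play is winning for $P$ if it is finite and stops on a configuration in $\mathcal F^P$, and surviving for $P$ if it is winning for $P$ or infinite. The winning set $\mathcal W^P$ (surviving set $\mathcal S^P$) is the set of configurations from which $P$ has a positional strategy all of whose conforming plays are winning (surviving) for $P$. An instance of the verification of \textsc{2TRG Winning Set} consists of a 2TRG and claimed sets for $\mathcal W^0,\mathcal S^0,\mathcal W^1,\mathcal S^1$; it is a yes-instance if all four claims are correct. \textbf{Matrix product.} For an $n\times m$ matrix $A$ over a totally ordered set and an $m\times m$ boolean matrix $B$, let $(A\star_{\max}B)[i,j]=\max\{A[i,k]\mid B[k,j]=1\}$,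 with $\max\emptyset=-\infty$. An instance of the verification of \textsc{Distinct Max-Semi-Boolean Matrix Multiplication} of size $n\times m\times m$ consists of such $A$, $B$, where the entries in each row of $A$ are pairwise distinct, and an $n\times m$ matrix $C$ with entries in the same ordered set or equal to $-\infty$; it is a yes-instance if $C=A\star_{\max}B$. An invalid triangle is a triple $(i,j,k)$ with $B[k,j]=1$ and $A[i,k]>C[i,j]$. \textbf{Theorem.} The verification of \textsc{Distinct Max-Semi-Boolean Matrix Multiplication} of size $n\times m\times m$ can be reduced to the verification of \textsc{2TRG Winning Set} of order $n\times O(m\log m)$. Precisely, there is a program for a unit-cost word RAM with words of $O(\log(n+m+2))$ bits that accesses the entries of $A$ and $C$ only by pairwise comparisons and that, given any instance $(A,B,C)$ of the first problem (with $n,m\ge 0$), halts after at most $O(nm(\lfloor\log_2 m\rfloor+1)+m^2+1)$ steps and outputs an instance of the second problem, with graphs given as edge lists of at most that total length, such that 1. $|V_0|=n$ and $|V_1|=O(m(\lfloor\log_2 m\rfloor+1))$ (read $\lfloor\log_2 0\rfloor=0$); 2. the output is a yes-instance if and only if $C=A\star_{\max}B$; 3. in the 2TRG of the output, Bob has a surviving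 strategy from some configuration if and only if $(A,B,C)$ has an invalid triangle. The program and the constants do not depend on the totally ordered set. -/

import Mathlib

namespace TwoTokens

/-! ## Reachability games -/

/-- The two players: Alice is player 0, Bob is player 1. -/
inductive Player where
  | alice
  | bob
  deriving DecidableEq

/-- A reachability game on a set `V` of configurations: the moves, the player who controls each
configuration, and the player for whom each configuration is a winning final configuration
(so that both pairs of sets are partitions of `V`). -/
structure ReachGame (V : Type*) where
  Move : V → V → Prop
  owner : V → Player
  final : V → Player

/-- A finite or infinite sequence of configurations. Its entries are `pos i` for `i ≤ last`;
it is infinite when `last = ⊤`. Values `pos i` with `i > last` are never looked at. -/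
structure Play (V : Type*) where
  pos : ℕ → V
  last : ℕ∞

namespace ReachGame

variable {V : Type*} (G : ReachGame V)

/-- Consecutive configurations of a play are joined by a move. -/
def IsPlay (π : Play V) : Prop :=
  ∀ i : ℕ, (i : ℕ∞) < π.last → G.Move (π.pos i) (π.pos (i + 1))

/-- A (positional) strategy for `P`: at a configuration controlled by `P` it selects a move
(`some τ`) or says to stop (`none`). Its values at the other configurations are irrelevant. -/
def IsStrategy (P : Player) (s : V → Option V) : Prop :=
  ∀ σ τ : V, G.owner σ = P → s σ = some τ → G.Move σ τ

/-- The play `π` conforms to the strategy `s` of player `P`. -/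
def Conforms (P : Player) (s : V → Option V) (π : Play V) : Prop :=
  ∀ i : ℕ, (i : ℕ∞) ≤ π.last → G.owner (π.pos i) = P →
    ((i : ℕ∞) < π.last ∧ s (π.pos i) = some (π.pos (i + 1))) ∨
    ((i : ℕ∞) = π.last ∧ s (π.pos i) = none)

/-- A play is winning for `P` if it is finite and stops on a winning final configuration
of `P`. -/
def WinningPlay (P : Player) (π : Play V) : Prop :=
  ∃ l : ℕ, π.last = l ∧ G.final (π.pos l) = P

/-- A play is surviving for `P` if it is winning for `P` or infinite. -/
def SurvivingPlay (P : Player) (π : Play V) : Prop :=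
  G.WinningPlay P π ∨ π.last = ⊤

/-- The configurations from which `P` has a winning strategy. -/
def winningSet (P : Player) : Set V :=
  {σ | ∃ s : V → Option V, G.IsStrategy P s ∧
    ∀ π : Play V, G.IsPlay π → π.pos 0 = σ → G.Conforms P s π → G.WinningPlay P π}

/-- The configurations from which `P` has a surviving strategy. -/
def survivingSet (P : Player) : Set V :=
  {σ | ∃ s : V → Option V, G.IsStrategy P s ∧
    ∀ π : Play V, G.IsPlay π → π.pos 0 = σ → G.Conforms P s π → G.SurvivingPlay P π}

end ReachGame

/-! ## Two-tokens reachability games -/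

/-- Configurations of a two-tokens game: `aliceTurn u v` is `⟨0, u, v⟩` and `bobTurn v u` is
`⟨1, v, u⟩`. In both, Alice's token is on `u : V₀` and Bob's token is on `v : V₁`. -/
inductive Config (V₀ V₁ : Type*) where
  | aliceTurn (u : V₀) (v : V₁)
  | bobTurn (v : V₁) (u : V₀)

/-- The player holding the turn moves her token along an edge of her graph. -/
inductive TokenMove {V₀ V₁ : Type*} (G₀ : Digraph V₀) (G₁ : Digraph V₁) :
    Config V₀ V₁ → Config V₀ V₁ → Prop where
  | alice {u u' : V₀} (v : V₁) (h : G₀.Adj u u') :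
      TokenMove G₀ G₁ (.aliceTurn u v) (.bobTurn v u')
  | bob {v v' : V₁} (u : V₀) (h : G₁.Adj v v') :
      TokenMove G₀ G₁ (.bobTurn v u) (.aliceTurn u v')

/-- A two-tokens reachability game over `V₀` and `V₁`: two directed graphs and the partition of
the configurations into winning final configurations of either player. Its order is
`|V₀| × |V₁|`. -/
structure TwoTokensGame (V₀ V₁ : Type*) where
  G₀ : Digraph V₀
  G₁ : Digraph V₁
  final : Config V₀ V₁ → Player

/-- The reachability game of a two-tokens reachability game. -/
def TwoTokensGame.toReachGame {V₀ V₁ : Type*} (T : TwoTokensGame V₀ V₁) :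
    ReachGame (Config V₀ V₁) where
  Move := TokenMove T.G₀ T.G₁
  owner := fun σ => match σ with
    | .aliceTurn _ _ => .alice
    | .bobTurn _ _ => .bob
  final := T.final

/-- An instance of the verification version of 2TRG Winning Set: a two-tokens reachability game
and, for each player, a claimed winning set and a claimed surviving set. -/
structure WinningSetClaim (V₀ V₁ : Type*) where
  game : TwoTokensGame V₀ V₁
  win : Player → Set (Config V₀ V₁)
  survive : Player → Set (Config V₀ V₁)

/-- The yes-instances: the claimed sets are the winning and surviving sets of the game. -/
def WinningSetClaim.IsCorrect {V₀ V₁ : Type*} (I : WinningSetClaim V₀ V₁) : Prop :=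
  ∀ P : Player, I.win P = I.game.toReachGame.winningSet P ∧
    I.survive P = I.game.toReachGame.survivingSet P

/-! ## Max-semi-boolean matrix multiplication -/

/-- The max-semi-boolean product: entry `(i, j)` is the maximum of the `A i k` with
`B k j = 1`, where the maximum of the empty set is `⊥` (that is, `-∞`). -/
def maxSemiBool {n₁ n₂ n₃ : ℕ} {α : Type*} [LinearOrder α] (A : Matrix (Fin n₁) (Fin n₂) α)
    (B : Matrix (Fin n₂) (Fin n₃) Bool) : Matrix (Fin n₁) (Fin n₃) (WithBot α) :=
  fun i j => (Finset.univ.filter fun k => B k j = true).sup fun k => (A i k : WithBot α)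

/-- The condition of the Distinct variant: entries in the same row of `A` are distinct. -/
def RowDistinct {n₁ n₂ : ℕ} {α : Type*} (A : Matrix (Fin n₁) (Fin n₂) α) : Prop :=
  ∀ (i : Fin n₁) (k k' : Fin n₂), k ≠ k' → A i k ≠ A i k'

/-! ## The machine model

A word RAM with finitely many registers and finitely many arrays (a program can only mention
finitely many of them), extended with a read-only store of keys from a linearly ordered set.
Keys can only be compared with each other. A program is a finite object that does not depend on
the input. Arithmetic operations, memory accesses, key comparisons, assignments and tests take
one step each. All numbers that a run computes have to be smaller than the word bound `w`;
otherwise the run does not exist. -/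

/-- The arithmetic operations of a word RAM (truncated subtraction, division rounding down). -/
inductive ArithOp where
  | plus
  | minus
  | times
  | quot

/-- The value of an arithmetic operation. -/
def ArithOp.eval : ArithOp → ℕ → ℕ → ℕ
  | .plus, a, b => a + b
  | .minus, a, b => a - b
  | .times, a, b => a * b
  | .quot, a, b => a / b

/-- Expressions: literals, registers, array cells, arithmetic, and the comparison of two keys,
which are given by their addresses in the key store. -/
inductive Expr where
  | lit (c : ℕ)
  | reg (x : ℕ)
  | cell (a : ℕ) (idx : Expr)
  | arith (o : ArithOp) (e₁ e₂ : Expr)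
  | keyLe (e₁ e₂ : Expr)

/-- Programs. The tests `ite e` and `loop e` ask whether `e ≠ 0`. -/
inductive Prog where
  | skip
  | assign (x : ℕ) (e : Expr)
  | store (a : ℕ) (idx e : Expr)
  | seq (p q : Prog)
  | ite (e : Expr) (p q : Prog)
  | loop (e : Expr) (p : Prog)

/-- Memory: the contents of the registers and of the arrays. -/
structure Memory where
  reg : ℕ → ℕ
  arr : ℕ → ℕ → ℕ

/-- Assign `v` to register `x`. -/
def Memory.setReg (s : Memory) (x v : ℕ) : Memory :=
  { s with reg := Function.update s.reg x v }

/-- Store `v` in cell `i` of array `a`. -/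
def Memory.setCell (s : Memory) (a i v : ℕ) : Memory :=
  { s with arr := Function.update s.arr a (Function.update (s.arr a) i v) }

section Semantics

variable {K : Type*} [LinearOrder K] (w : ℕ) (keys : ℕ → K)

/-- The value of an expression. -/
def Expr.eval (s : Memory) : Expr → ℕ
  | .lit c => c
  | .reg x => s.reg x
  | .cell a idx => s.arr a (idx.eval s)
  | .arith o e₁ e₂ => o.eval (e₁.eval s) (e₂.eval s)
  | .keyLe e₁ e₂ => if keys (e₁.eval s) ≤ keys (e₂.eval s) then 1 else 0

/-- Every value that occurs in the evaluation of an expression is smaller than `w`. -/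
def Expr.Fits (s : Memory) : Expr → Prop
  | .lit c => c < w
  | .reg x => s.reg x < w
  | .cell a idx => idx.Fits s ∧ s.arr a (idx.eval keys s) < w
  | .arith o e₁ e₂ => e₁.Fits s ∧ e₂.Fits s ∧ o.eval (e₁.eval keys s) (e₂.eval keys s) < w
  | .keyLe e₁ e₂ => e₁.Fits s ∧ e₂.Fits s

/-- The number of steps that the evaluation of an expression takes. -/
def Expr.cost : Expr → ℕ
  | .lit _ => 1
  | .reg _ => 1
  | .cell _ idx => idx.cost + 1
  | .arith _ e₁ e₂ => e₁.cost + e₂.cost + 1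
  | .keyLe e₁ e₂ => e₁.cost + e₂.cost + 1

/-- `Exec w keys p s t s'`: with word bound `w` and key store `keys`, the program `p`, started
with memory `s`, halts after exactly `t` steps with memory `s'`. -/
inductive Exec : Prog → Memory → ℕ → Memory → Prop where
  | skip (s : Memory) : Exec .skip s 1 s
  | assign (x : ℕ) (e : Expr) (s : Memory) (he : e.Fits w keys s) :
      Exec (.assign x e) s (e.cost + 1) (s.setReg x (e.eval keys s))
  | store (a : ℕ) (idx e : Expr) (s : Memory) (hi : idx.Fits w keys s)
      (he : e.Fits w keys s) :
      Exec (.store a idx e) s (idx.cost + e.cost + 1)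
        (s.setCell a (idx.eval keys s) (e.eval keys s))
  | seq {p q : Prog} {s s₁ s₂ : Memory} {t₁ t₂ : ℕ} (hp : Exec p s t₁ s₁)
      (hq : Exec q s₁ t₂ s₂) : Exec (.seq p q) s (t₁ + t₂) s₂
  | iteTrue {e : Expr} {p : Prog} (q : Prog) {s s₁ : Memory} {t : ℕ} (he : e.Fits w keys s)
      (hc : e.eval keys s ≠ 0) (hp : Exec p s t s₁) :
      Exec (.ite e p q) s (e.cost + 1 + t) s₁
  | iteFalse {e : Expr} (p : Prog) {q : Prog} {s s₁ : Memory} {t : ℕ} (he : e.Fits w keys s)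
      (hc : e.eval keys s = 0) (hq : Exec q s t s₁) :
      Exec (.ite e p q) s (e.cost + 1 + t) s₁
  | loopDone {e : Expr} (p : Prog) {s : Memory} (he : e.Fits w keys s)
      (hc : e.eval keys s = 0) : Exec (.loop e p) s (e.cost + 1) s
  | loopStep {e : Expr} {p : Prog} {s s₁ s₂ : Memory} {t₁ t₂ : ℕ} (he : e.Fits w keys s)
      (hc : e.eval keys s ≠ 0) (hp : Exec p s t₁ s₁) (hl : Exec (.loop e p) s₁ t₂ s₂) :
      Exec (.loop e p) s (e.cost + 1 + t₁ + t₂) s₂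

end Semantics

/-! ## Input and output conventions -/

/-- The key store: `A` in row-major order at the addresses `0, …, nm - 1`, then `C` in row-major
order at the addresses `nm, …, 2nm - 1`, then `-∞`. (`finProdFinEquiv` sends `(i, k)` to
`k + m * i`.) -/
def keyStore {n m : ℕ} {α : Type*} (A : Matrix (Fin n) (Fin m) α)
    (C : Matrix (Fin n) (Fin m) (WithBot α)) : ℕ → WithBot α := fun a =>
  if h : a < n * m then
    (A (finProdFinEquiv.symm ⟨a, h⟩).1 (finProdFinEquiv.symm ⟨a, h⟩).2 : WithBot α)
  else if h : a - n * m < n * m then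
    C (finProdFinEquiv.symm ⟨a - n * m, h⟩).1 (finProdFinEquiv.symm ⟨a - n * m, h⟩).2
  else ⊥

/-- The initial memory: `n` and `m` in registers 0 and 1, the boolean matrix `B` in row-major
order in array 0, and zeros elsewhere. -/
def inputMemory (n : ℕ) {m : ℕ} (B : Matrix (Fin m) (Fin m) Bool) : Memory where
  reg := fun x => if x = 0 then n else if x = 1 then m else 0
  arr := fun a idx =>
    if a = 0 then
      if h : idx < m * m then
        (B (finProdFinEquiv.symm ⟨idx, h⟩).1 (finProdFinEquiv.symm ⟨idx, h⟩).2).toNat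
      else 0
    else 0

/-- Arrays `src` and `tgt` hold a list of `len` edges, which are the edges of `G`. -/
def EncodesGraph {N : ℕ} (s : Memory) (len src tgt : ℕ) (G : Digraph (Fin N)) : Prop :=
  ∀ u v : ℕ, (∃ e < len, s.arr src e = u ∧ s.arr tgt e = v) ↔
    ∃ (hu : u < N) (hv : v < N), G.Adj ⟨u, hu⟩ ⟨v, hv⟩

/-- Arrays `a` and `b` hold, as tables of zeros and non-zeros in row-major order, the members
`⟨0, u, v⟩` and `⟨1, v, u⟩` of the set `X` of configurations. -/
def EncodesSet {n N : ℕ} (s : Memory) (a b : ℕ) (X : Set (Config (Fin n) (Fin N))) : Prop :=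
  ∀ (u : Fin n) (v : Fin N),
    (s.arr a (v + N * u) ≠ 0 ↔ Config.aliceTurn u v ∈ X) ∧
    (s.arr b (v + N * u) ≠ 0 ↔ Config.bobTurn v u ∈ X)

/-- The memory holds the instance `I` of order `n × N`: the numbers of vertices in registers 0
and 2, the lengths of the two edge lists in registers 3 and 4, the edge lists in arrays 1 to 4,
and the tables of Alice's winning final configurations and of the four claimed sets in arrays
5 to 14. -/
structure EncodesClaim {n N : ℕ} (s : Memory) (I : WinningSetClaim (Fin n) (Fin N)) :
    Prop where
  order₀ : s.reg 0 = n
  order₁ : s.reg 2 = N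
  graph₀ : EncodesGraph s (s.reg 3) 1 2 I.game.G₀
  graph₁ : EncodesGraph s (s.reg 4) 3 4 I.game.G₁
  final : EncodesSet s 5 6 {σ | I.game.final σ = .alice}
  winAlice : EncodesSet s 7 8 (I.win .alice)
  surviveAlice : EncodesSet s 9 10 (I.survive .alice)
  winBob : EncodesSet s 11 12 (I.win .bob)
  surviveBob : EncodesSet s 13 14 (I.survive .bob)

end TwoTokens

/-! ### Plays and strategies in reachability games -/

namespace TwoTokens

/-! Alice gets one vertex per row, carrying only a loop, so she can merely wait or stop.
Configurations with Bob to move are final for Alice, and the one with Alice to move on row `i` and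
Bob on `v` is final for Bob exactly when `v` is live for `i`. A bounded potential that increases
along all edges between live vertices lets Alice win everywhere (`IsWaiting.mem_winningSet`); a set
of live vertices that Bob never has to leave lets him survive (`IsWaiting.mem_survivingSet`).

It remains to encode the comparisons of `A i k` with `C i j` in a graph of `O(m log m)` vertices
that is common to all rows, where only liveness depends on the row. In row `i` the element `k`
stands for `A i k` and `H + j` for `C i j`; with padding there are `2 ^ L` elements, ranked by key
and, on ties, by index. So `k` precedes `H + j` if and only if `A i k ≤ C i j`. Bob's graph contains
a Beneš network with `2 * L` layers of switches, which can route every permutation; the live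
vertices of a row are those on the routes from `e` to `rank e`. A vertex records the position
together with the outgoing direction, so that routes cannot be mixed. Bob follows the route of `H +
j`, crosses to a reversed copy, moves along the line of increasing ranks, leaves it at some `rank k`
on the reversed route to `k`, and returns by an edge of `B` to some `H + j'`. An invalid triangle
closes such a tour (`Routing.exists_trap`). Without one, the rank, refined by the progress on the
route, is a potential (`Routing.exists_potential`).

Routes come from the looping algorithm. Level `l` fixes bit `l` in two mirrored layers. Positions
differing only in this bit, before or after the permutation, must receive different values; these
two pairings form even cycles, hence have a two-colouring, found in linear time
(`ColourState.step`). What remains to be routed then preserves one more low bit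
(`PartialRouting.succ`). Merge sort and routing take `O(m log m)` steps per row.

The game only tests that `C` is an upper bound. That each entry of `C` is `-∞` or attained is tested
by the program: since a row of `A` is distinct, only the last entry of `A` before `C i j` in sorted
order matters (`IsLast.attained_iff`). On failure one configuration is removed from Alice's claimed
surviving set, although everything is claimed to be winning for her. This falsifies the claims
without changing the game, so the third assertion is unaffected.

The programs are verified by rules for `Runs`, a time-bounded total correctness statement. -/

theorem Player.eq_of_ne_of_ne {P Q R : Player} (h : P ≠ Q) (hR : R ≠ P) : R = Q := by
  cases P <;> cases Q <;> cases R <;> simp_all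

namespace ReachGame

variable {V : Type*} (G : ReachGame V)

theorem winningSet_subset_survivingSet (P : Player) : G.winningSet P ⊆ G.survivingSet P := by
  rintro σ ⟨s, hs, h⟩
  exact ⟨s, hs, fun π h₁ h₂ h₃ => Or.inl (h π h₁ h₂ h₃)⟩

/-- Two strategies of opposite players have a common conforming play from every position. -/
theorem exists_play {P Q : Player} (hPQ : P ≠ Q) {s₁ s₂ : V → Option V}
    (h₁ : G.IsStrategy P s₁) (h₂ : G.IsStrategy Q s₂) (σ : V) :
    ∃ π : Play V, G.IsPlay π ∧ π.pos 0 = σ ∧ G.Conforms P s₁ π ∧ G.Conforms Q s₂ π := by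
  classical
  let next : V → Option V := fun τ => if G.owner τ = P then s₁ τ else s₂ τ
  let x : ℕ → V := fun i => Nat.rec σ (fun _ τ => (next τ).getD τ) i
  have hx : ∀ i, x (i + 1) = (next (x i)).getD (x i) := fun i => rfl
  have hmove : ∀ i τ, next (x i) = some τ → G.Move (x i) τ := by
    intro i τ h
    simp only [next] at h
    split_ifs at h with hP
    · exact h₁ _ _ hP h
    · exact h₂ _ _ (Player.eq_of_ne_of_ne hPQ hP) h
  -- The length of the play is the first time at which the player in control says to stop, and `⊤`
  -- if that never happens.
  obtain ⟨l, hl, hl'⟩ : ∃ l : ℕ∞, (∀ i : ℕ, (i : ℕ∞) < l → next (x i) ≠ none) ∧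
      (∀ i : ℕ, (i : ℕ∞) = l → next (x i) = none) := by
    by_cases hex : ∃ i, next (x i) = none
    · refine ⟨(Nat.find hex : ℕ), fun i hi => Nat.find_min hex (by exact_mod_cast hi), ?_⟩
      intro i hi
      have : i = Nat.find hex := by exact_mod_cast hi
      exact this ▸ Nat.find_spec hex
    · push Not at hex
      exact ⟨⊤, fun i _ => hex i, fun i hi => absurd hi (ENat.natCast_ne_top i)⟩
  have hnext : ∀ i : ℕ, (i : ℕ∞) < l → next (x i) = some (x (i + 1)) := by
    intro i hi
    obtain ⟨τ, hτ⟩ := Option.ne_none_iff_exists'.mp (hl i hi)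
    rw [hx, hτ]; rfl
  refine ⟨⟨x, l⟩, fun i hi => hmove i _ (hnext i hi), rfl, ?_, ?_⟩
  · intro i hi hown
    have hown' : G.owner (x i) = P := hown
    have e : next (x i) = s₁ (x i) := if_pos hown'
    rcases hi.lt_or_eq with h | h
    · exact Or.inl ⟨h, e ▸ hnext i h⟩
    · exact Or.inr ⟨h, e ▸ hl' i h⟩
  · intro i hi hown
    have hown' : G.owner (x i) ≠ P := fun h => hPQ (h.symm.trans hown)
    have e : next (x i) = s₂ (x i) := if_neg hown'
    rcases hi.lt_or_eq with h | h
    · exact Or.inl ⟨h, e ▸ hnext i h⟩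
    · exact Or.inr ⟨h, e ▸ hl' i h⟩

/-- Let the two strategies play against each other: the common play is finite and stops on a final
configuration of `P`, so it can neither be infinite nor be won by `Q`. -/
theorem disjoint_winningSet_survivingSet {P Q : Player} (hPQ : P ≠ Q) :
    Disjoint (G.winningSet P) (G.survivingSet Q) := by
  rw [Set.disjoint_left]
  rintro σ ⟨s₁, h₁, w₁⟩ ⟨s₂, h₂, w₂⟩
  obtain ⟨π, hπ, h0, c₁, c₂⟩ := G.exists_play hPQ h₁ h₂ σ
  obtain ⟨l, hl, hf⟩ := w₁ π hπ h0 c₁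
  rcases w₂ π hπ h0 c₂ with ⟨l', hl', hf'⟩ | h
  · have : l = l' := by exact_mod_cast hl.symm.trans hl'
    subst this
    exact hPQ (hf.symm.trans hf')
  · rw [hl] at h
    exact ENat.natCast_ne_top l h

end ReachGame

/-! ### Games in which Alice can only wait -/

namespace TwoTokensGame

variable {V₀ V₁ : Type*} (T : TwoTokensGame V₀ V₁)

/-- Alice can only wait, and she may stop exactly when Bob's token is on a vertex that is not
live for her own vertex; Bob must not stop. -/
structure IsWaiting (live : V₀ → V₁ → Prop) : Prop where
  adj : ∀ u u', T.G₀.Adj u u' ↔ u = u'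
  final_bob : ∀ v u, T.final (.bobTurn v u) = .alice
  final_alice : ∀ u v, T.final (.aliceTurn u v) = .alice ↔ ¬ live u v

variable {T} {live : V₀ → V₁ → Prop}

/-- Alice waits while Bob's token is on a live vertex and stops otherwise. In an infinite play her
token stays on one vertex `u`, and the potential for `u` grows at each move of Bob, beyond its
bound. A finite play ends either at Bob's turn or on a vertex that is not live; both are won by
Alice. -/
theorem IsWaiting.mem_winningSet (hT : T.IsWaiting live)
    (hpot : ∀ u, ∃ (Φ : V₁ → ℕ) (K : ℕ), (∀ v, Φ v ≤ K) ∧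
      ∀ v v', live u v → live u v' → T.G₁.Adj v v' → Φ v < Φ v') (σ : Config V₀ V₁) :
    σ ∈ T.toReachGame.winningSet .alice := by
  classical
  let s : Config V₀ V₁ → Option (Config V₀ V₁) := fun τ => match τ with
    | .aliceTurn u v => if live u v then some (.bobTurn v u) else none
    | .bobTurn _ _ => none
  refine ⟨s, ?_, ?_⟩
  · rintro (⟨u, v⟩ | ⟨v, u⟩) τ ho hs
    · simp only [s] at hs
      split_ifs at hs
      cases hs
      exact TokenMove.alice v ((hT.adj u u).2 rfl)
    · cases ho
  intro π hπ h0 hc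
  by_cases hfin : π.last = ⊤
  · exfalso
    have hstep : ∀ i u v, π.pos i = .aliceTurn u v →
        live u v ∧ ∃ v', π.pos (i + 2) = .aliceTurn u v' ∧ T.G₁.Adj v v' := by
      intro i u v hi
      have hlt : ∀ i : ℕ, (i : ℕ∞) < π.last := fun i => hfin ▸ ENat.natCast_lt_top i
      rcases hc i (hlt i).le (by rw [hi]; rfl) with ⟨-, h⟩ | ⟨h, -⟩
      · rw [hi] at h
        simp only [s] at h
        split_ifs at h with hl
        cases h' : π.pos (i + 1) with
        | aliceTurn a b => rw [h'] at h; cases h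
        | bobTurn a b =>
          rw [h'] at h
          cases h
          refine ⟨hl, ?_⟩
          have hm := hπ (i + 1) (hlt _)
          rw [h'] at hm
          generalize hτ : π.pos (i + 1 + 1) = τ at hm
          cases hm with
          | bob _ hadj => exact ⟨_, rfl, hadj⟩
      · exact absurd h (hlt i).ne
    obtain ⟨i₀, u, v, hi₀⟩ : ∃ i u v, π.pos i = .aliceTurn u v := by
      cases h : π.pos 0 with
      | aliceTurn u v => exact ⟨0, u, v, h⟩
      | bobTurn v u =>
        have hm := hπ 0 (hfin ▸ ENat.natCast_lt_top 0)
        rw [h] at hm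
        generalize hτ : π.pos (0 + 1) = τ at hm
        cases hm with
        | bob _ hadj => exact ⟨_, _, _, hτ⟩
    obtain ⟨Φ, K, hK, hΦ⟩ := hpot u
    have key : ∀ k, ∃ v, π.pos (i₀ + 2 * k) = .aliceTurn u v ∧ k ≤ Φ v := by
      intro k
      induction k with
      | zero => exact ⟨v, hi₀, Nat.zero_le _⟩
      | succ k ih =>
        obtain ⟨v, hv, hk⟩ := ih
        obtain ⟨hl, v', hv', hadj⟩ := hstep _ _ _ hv
        exact ⟨v', hv', lt_of_le_of_lt hk (hΦ _ _ hl (hstep _ _ _ hv').1 hadj)⟩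
    obtain ⟨v, -, h⟩ := key (K + 1)
    have := hK v
    omega
  · obtain ⟨l, hl⟩ := ENat.ne_top_iff_exists.mp hfin
    refine ⟨l, hl.symm, ?_⟩
    cases h : π.pos l with
    | bobTurn v u => exact hT.final_bob v u
    | aliceTurn u v =>
      refine (hT.final_alice u v).2 fun hlive => ?_
      rcases hc l hl.le (by rw [h]; rfl) with ⟨h', -⟩ | ⟨-, h'⟩
      · exact h'.ne hl
      · rw [h] at h'
        simp [s, hlive] at h'

/-- Bob always moves to a successor in `X`. Alice can only wait or stop, and when she stops his
token is on a live vertex. Bob himself never stops. -/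
theorem IsWaiting.mem_survivingSet (hT : T.IsWaiting live) {u : V₀} {X : Set V₁}
    (hX : ∀ v ∈ X, live u v ∧ ∃ v' ∈ X, T.G₁.Adj v v') {v : V₁} (hv : v ∈ X) :
    .bobTurn v u ∈ T.toReachGame.survivingSet .bob := by
  classical
  choose! f hf using fun v hv => (hX v hv).2
  let s : Config V₀ V₁ → Option (Config V₀ V₁) := fun τ => match τ with
    | .aliceTurn _ _ => none
    | .bobTurn v u' => if v ∈ X then some (.aliceTurn u' (f v)) else none
  refine ⟨s, ?_, ?_⟩
  · rintro (⟨u, v⟩ | ⟨v, u⟩) τ ho hs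
    · cases ho
    · simp only [s] at hs
      split_ifs at hs with h
      cases hs
      exact TokenMove.bob u (hf v h).2
  intro π hπ h0 hc
  have key : ∀ i : ℕ, (i : ℕ∞) ≤ π.last →
      ∃ v ∈ X, π.pos i = .bobTurn v u ∨ π.pos i = .aliceTurn u v := by
    intro i
    induction i with
    | zero => exact fun _ => ⟨v, hv, Or.inl h0⟩
    | succ i ih =>
      intro hi
      have hlt : (i : ℕ∞) < π.last :=
        lt_of_lt_of_le (by exact_mod_cast Nat.lt_succ_self i) hi
      obtain ⟨v, hv, h | h⟩ := ih hlt.le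
      · rcases hc i hlt.le (by rw [h]; rfl) with ⟨-, h'⟩ | ⟨h', -⟩
        · rw [h] at h'
          simp only [s, hv, if_true, Option.some.injEq] at h'
          exact ⟨f v, (hf v hv).1, Or.inr h'.symm⟩
        · exact absurd h' hlt.ne
      · have hm := hπ i hlt
        rw [h] at hm
        generalize hτ : π.pos (i + 1) = τ at hm
        cases hm with
        | alice _ hadj => exact ⟨v, hv, Or.inl (by rw [(hT.adj _ _).1 hadj])⟩
  by_cases hfin : π.last = ⊤
  · exact Or.inr hfin
  · obtain ⟨l, hl⟩ := ENat.ne_top_iff_exists.mp hfin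
    refine Or.inl ⟨l, hl.symm, ?_⟩
    obtain ⟨v, hv, h | h⟩ := key l hl.le
    · rcases hc l hl.le (by rw [h]; rfl) with ⟨h', -⟩ | ⟨-, h'⟩
      · exact absurd hl h'.ne
      · rw [h] at h'
        simp [s, hv] at h'
    · rw [h]
      have := mt (hT.final_alice u v).1 (not_not.2 (hX v hv).1)
      exact Player.eq_of_ne_of_ne (P := .alice) (by simp) this

end TwoTokensGame

end TwoTokens

namespace TwoTokens

/-! ## Reasoning about programs -/

instance Expr.instOfNat (n : ℕ) : OfNat Expr n := ⟨.lit n⟩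
instance Expr.instAdd : Add Expr := ⟨.arith .plus⟩
instance Expr.instSub : Sub Expr := ⟨.arith .minus⟩
instance Expr.instMul : Mul Expr := ⟨.arith .times⟩
instance Expr.instDiv : Div Expr := ⟨.arith .quot⟩

infixr:60 " ;; " => Prog.seq

section Eval

variable {K : Type*} [LinearOrder K] (keys : ℕ → K) (s : Memory)

@[simp] theorem Expr.eval_ofNat (n : ℕ) [n.AtLeastTwo] :
    (no_index (OfNat.ofNat n : Expr)).eval keys s = OfNat.ofNat n := rfl
@[simp] theorem Expr.eval_zero : (0 : Expr).eval keys s = 0 := rfl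
@[simp] theorem Expr.eval_one : (1 : Expr).eval keys s = 1 := rfl
@[simp] theorem Expr.eval_reg (x : ℕ) : (Expr.reg x).eval keys s = s.reg x := rfl
@[simp] theorem Expr.eval_cell (a : ℕ) (e : Expr) :
    (Expr.cell a e).eval keys s = s.arr a (e.eval keys s) := rfl
@[simp] theorem Expr.eval_add (e f : Expr) :
    (e + f).eval keys s = e.eval keys s + f.eval keys s := rfl
@[simp] theorem Expr.eval_sub (e f : Expr) :
    (e - f).eval keys s = e.eval keys s - f.eval keys s := rfl
@[simp] theorem Expr.eval_mul (e f : Expr) :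
    (e * f).eval keys s = e.eval keys s * f.eval keys s := rfl
@[simp] theorem Expr.eval_div (e f : Expr) :
    (e / f).eval keys s = e.eval keys s / f.eval keys s := rfl
@[simp] theorem Expr.eval_keyLe (e f : Expr) : (Expr.keyLe e f).eval keys s =
    if keys (e.eval keys s) ≤ keys (f.eval keys s) then 1 else 0 := rfl

end Eval

section Memory

variable (s : Memory) (x y a b i v : ℕ)

@[simp] theorem Memory.setReg_reg :
    (s.setReg x v).reg y = if y = x then v else s.reg y := by
  simp [setReg, Function.update_apply]
@[simp] theorem Memory.setReg_arr : (s.setReg x v).arr = s.arr := rfl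
@[simp] theorem Memory.setCell_reg : (s.setCell a i v).reg = s.reg := rfl
@[simp] theorem Memory.setCell_arr : (s.setCell a i v).arr b =
    if b = a then Function.update (s.arr a) i v else s.arr b := by
  simp [setCell, Function.update_apply]
theorem Memory.setCell_arr_of_ne (h : b ≠ a) : (s.setCell a i v).arr b = s.arr b := by
  simp [setCell, h]

/-- Every number in the memory is smaller than `Z`, and `Z` exceeds all literals of programs. -/
structure Memory.Bdd (Z : ℕ) (s : Memory) : Prop where
  lit : 100 < Z
  reg : ∀ x, s.reg x < Z
  arr : ∀ a i, s.arr a i < Z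

variable {s x y a b i v} {Z : ℕ}

theorem Memory.Bdd.setReg (h : s.Bdd Z) (hv : v < Z) : (s.setReg x v).Bdd Z :=
  ⟨h.lit, fun y => by rw [setReg_reg]; split_ifs; exacts [hv, h.reg y], h.arr⟩

theorem Memory.Bdd.setCell (h : s.Bdd Z) (hv : v < Z) : (s.setCell a i v).Bdd Z :=
  ⟨h.lit, h.reg, fun b j => by
    rw [setCell_arr]
    split_ifs
    · rw [Function.update_apply]
      split_ifs
      exacts [hv, h.arr _ _]
    · exact h.arr _ _⟩

end Memory

/-- The number of leaves of an expression. -/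
def Expr.leaves : Expr → ℕ
  | .lit _ => 1
  | .reg _ => 1
  | .cell _ e => e.leaves
  | .arith _ e f => e.leaves + f.leaves
  | .keyLe e f => e.leaves + f.leaves

/-- All literals of an expression are at most `100`. -/
def Expr.smallLits : Expr → Bool
  | .lit c => c.ble 100
  | .reg _ => true
  | .cell _ e => e.smallLits
  | .arith _ e f => e.smallLits && f.smallLits
  | .keyLe e f => e.smallLits && f.smallLits

/-- The expression has at most `40` leaves, and its literals are at most `100`. -/
def Expr.small (e : Expr) : Bool := e.smallLits && e.leaves.ble 40

/-! ### Word size of intermediate values -/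

section Fits

variable {K : Type*} [LinearOrder K] {keys : ℕ → K} {s : Memory} {Z : ℕ}

theorem Expr.leaves_pos (e : Expr) : 0 < e.leaves := by
  induction e <;> simp_all [leaves]

/-- Multiplication is the worst operation: with both bounds at least `2`, a product of bounds also
dominates a sum. Thus bounds multiply along an expression, and a power indexed by its leaves
suffices. -/
theorem ArithOp.eval_lt_mul {o : ArithOp} {a b A B : ℕ} (ha : a < A) (hb : b < B) (hA : 2 ≤ A)
    (hB : 2 ≤ B) : o.eval a b < A * B := by
  have h1 : A ≤ A * B := Nat.le_mul_of_pos_right _ (by omega)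
  cases o <;> simp only [ArithOp.eval]
  · nlinarith
  · omega
  · exact Nat.mul_lt_mul'' ha hb
  · exact lt_of_le_of_lt (Nat.div_le_self _ _) (by omega)

theorem Expr.eval_lt_pow (hs : s.Bdd Z) (e : Expr) (he : e.smallLits = true) :
    e.eval keys s < Z ^ e.leaves := by
  have hZ := hs.lit
  have hp : ∀ e : Expr, 2 ≤ Z ^ e.leaves := fun e =>
    le_trans (by omega) (Nat.le_self_pow e.leaves_pos.ne' Z)
  induction e with
  | lit c => simp only [smallLits, Nat.ble_eq] at he; simp only [eval, leaves, pow_one]; omega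
  | reg x => simpa [leaves] using hs.reg x
  | cell a e ih =>
    exact lt_of_lt_of_le (hs.arr a _) (Nat.le_self_pow e.leaves_pos.ne' Z)
  | arith o e f ihe ihf =>
    simp only [smallLits, Bool.and_eq_true] at he
    rw [leaves, pow_add]
    exact ArithOp.eval_lt_mul (ihe he.1) (ihf he.2) (hp e) (hp f)
  | keyLe e f =>
    refine lt_of_lt_of_le ?_ (hp (.keyLe e f))
    simp only [eval]
    split_ifs <;> omega

theorem Expr.fits_of_pow_le (hs : s.Bdd Z) (e : Expr) (he : e.smallLits = true) {w : ℕ}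
    (hw : Z ^ e.leaves ≤ w) : e.Fits w keys s := by
  have hZ := hs.lit
  induction e with
  | lit c => exact lt_of_lt_of_le (eval_lt_pow (keys := keys) hs (.lit c) he) hw
  | reg x => exact lt_of_lt_of_le (eval_lt_pow (keys := keys) hs (.reg x) he) hw
  | cell a e ih =>
    exact ⟨ih he hw, lt_of_lt_of_le (eval_lt_pow (keys := keys) hs (.cell a e) he) hw⟩
  | arith o e f ihe ihf =>
    have he' := he
    simp only [smallLits, Bool.and_eq_true] at he
    have h1 : Z ^ e.leaves ≤ w := le_trans (Nat.pow_le_pow_right (by omega) (by simp [leaves])) hw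
    have h2 : Z ^ f.leaves ≤ w := le_trans (Nat.pow_le_pow_right (by omega) (by simp [leaves])) hw
    exact ⟨ihe he.1 h1, ihf he.2 h2,
      lt_of_lt_of_le (eval_lt_pow (keys := keys) hs (.arith o e f) he') hw⟩
  | keyLe e f ihe ihf =>
    simp only [smallLits, Bool.and_eq_true] at he
    have h1 : Z ^ e.leaves ≤ w := le_trans (Nat.pow_le_pow_right (by omega) (by simp [leaves])) hw
    have h2 : Z ^ f.leaves ≤ w := le_trans (Nat.pow_le_pow_right (by omega) (by simp [leaves])) hw
    exact ⟨ihe he.1 h1, ihf he.2 h2⟩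

theorem Expr.fits_of_small (hs : s.Bdd Z) {e : Expr} (he : e.small = true) :
    e.Fits (Z ^ 40) keys s := by
  have hZ := hs.lit
  simp only [small, Bool.and_eq_true, Nat.ble_eq] at he
  exact fits_of_pow_le hs e he.1 (Nat.pow_le_pow_right (by omega) he.2)

end Fits

/-- The program assigns to register `x`. -/
def Prog.setsReg (x : ℕ) : Prog → Bool
  | .skip => false
  | .assign y _ => x == y
  | .store _ _ _ => false
  | .seq p q => p.setsReg x || q.setsReg x
  | .ite _ p q => p.setsReg x || q.setsReg x
  | .loop _ p => p.setsReg x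

/-- The program stores to array `a`. -/
def Prog.setsArr (a : ℕ) : Prog → Bool
  | .skip => false
  | .assign _ _ => false
  | .store b _ _ => a == b
  | .seq p q => p.setsArr a || q.setsArr a
  | .ite _ p q => p.setsArr a || q.setsArr a
  | .loop _ p => p.setsArr a

/-- The memories differ only in registers and arrays to which the program writes. -/
structure Frame (p : Prog) (s s' : Memory) : Prop where
  reg : ∀ x, p.setsReg x = false → s'.reg x = s.reg x
  arr : ∀ a, p.setsArr a = false → s'.arr a = s.arr a

theorem Frame.refl (p : Prog) (s : Memory) : Frame p s s := ⟨fun _ _ => rfl, fun _ _ => rfl⟩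

theorem Frame.trans {p : Prog} {s s' s'' : Memory} (h : Frame p s s') (h' : Frame p s' s'') :
    Frame p s s'' :=
  ⟨fun x hx => (h'.reg x hx).trans (h.reg x hx), fun a ha => (h'.arr a ha).trans (h.arr a ha)⟩

theorem Frame.mono {p q : Prog} {s s' : Memory} (h : Frame p s s')
    (hr : ∀ x, q.setsReg x = false → p.setsReg x = false)
    (ha : ∀ x, q.setsArr x = false → p.setsArr x = false) : Frame q s s' :=
  ⟨fun x hx => h.reg x (hr x hx), fun a h' => h.arr a (ha a h')⟩

/-! ### Time-bounded total correctness -/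

section Runs

variable {K : Type*} [LinearOrder K] {Z : ℕ} {keys : ℕ → K}

/-- Whatever a program does not syntactically write is preserved. Since `setsReg` and `setsArr`
compute, later preservation facts are proved by `rfl`. -/
theorem Exec.frame {w : ℕ} {p : Prog} {s s' : Memory} {t : ℕ} (h : Exec w keys p s t s') :
    Frame p s s' := by
  induction h with
  | skip s => exact Frame.refl _ _
  | assign x e s he =>
    refine ⟨fun y hy => ?_, fun _ _ => rfl⟩
    simp only [Prog.setsReg, beq_eq_false_iff_ne] at hy
    simp [hy]
  | store a i e s hi he =>
    refine ⟨fun _ _ => rfl, fun b hb => ?_⟩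
    simp only [Prog.setsArr, beq_eq_false_iff_ne] at hb
    exact Memory.setCell_arr_of_ne _ _ _ _ _ hb
  | seq hp hq ihp ihq =>
    exact (ihp.mono (by simp +contextual [Prog.setsReg]) (by simp +contextual [Prog.setsArr])).trans
      (ihq.mono (by simp +contextual [Prog.setsReg]) (by simp +contextual [Prog.setsArr]))
  | iteTrue q he hc hp ih =>
    exact ih.mono (by simp +contextual [Prog.setsReg]) (by simp +contextual [Prog.setsArr])
  | iteFalse p he hc hp ih =>
    exact ih.mono (by simp +contextual [Prog.setsReg]) (by simp +contextual [Prog.setsArr])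
  | loopDone p he hc => exact Frame.refl _ _
  | loopStep he hc hp hl ihp ihl =>
    exact (ihp.mono (q := .loop _ _) (fun _ => id) (fun _ => id)).trans (ihl.mono (fun _ => id) (fun _ => id))

variable (Z keys) in
/-- Started with a memory below `Z`, the program halts within `T` steps with a memory below `Z`
that satisfies `Q`. -/
def Runs (p : Prog) (s : Memory) (T : ℕ) (Q : Memory → Prop) : Prop :=
  s.Bdd Z → ∃ t s', Exec (Z ^ 40) keys p s t s' ∧ t ≤ T ∧ s'.Bdd Z ∧ Q s'

namespace Runs

variable {p q r : Prog} {s : Memory} {T T₁ T₂ x a i v : ℕ} {e idx : Expr} {Q Q₁ : Memory → Prop}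

theorem weaken (h : Runs Z keys p s T₁ Q₁) (hT : T₁ ≤ T)
    (hQ : ∀ s', s'.Bdd Z → Frame p s s' → Q₁ s' → Q s') : Runs Z keys p s T Q := by
  intro hs
  obtain ⟨t, s', he, ht, hs', hq⟩ := h hs
  exact ⟨t, s', he, ht.trans hT, hs', hQ s' hs' he.frame hq⟩

theorem skip (hT : 1 ≤ T) (hQ : Q s) : Runs Z keys .skip s T Q :=
  fun hs => ⟨1, s, .skip s, hT, hs, hQ⟩

theorem assign (he : e.small = true) (hv : e.eval keys s = v) (hvZ : v < Z)
    (hT : e.cost + 1 ≤ T) (hQ : Q (s.setReg x v)) : Runs Z keys (.assign x e) s T Q := by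
  intro hs
  subst hv
  exact ⟨_, _, .assign x e s (Expr.fits_of_small hs he), hT, hs.setReg hvZ, hQ⟩

theorem store (hi : idx.small = true) (he : e.small = true) (hiv : idx.eval keys s = i)
    (hv : e.eval keys s = v) (hvZ : v < Z) (hT : idx.cost + e.cost + 1 ≤ T)
    (hQ : Q (s.setCell a i v)) : Runs Z keys (.store a idx e) s T Q := by
  intro hs
  subst hv hiv
  exact ⟨_, _, .store a idx e s (Expr.fits_of_small hs hi) (Expr.fits_of_small hs he), hT,
    hs.setCell hvZ, hQ⟩

theorem seq (T₁ T₂ : ℕ) (hp : Runs Z keys p s T₁ Q₁)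
    (hq : ∀ s₁, s₁.Bdd Z → Frame p s s₁ → Q₁ s₁ → Runs Z keys q s₁ T₂ Q) (hT : T₁ + T₂ ≤ T) :
    Runs Z keys (p ;; q) s T Q := by
  intro hs
  obtain ⟨t₁, s₁, h₁, ht₁, hs₁, hQ₁⟩ := hp hs
  obtain ⟨t₂, s₂, h₂, ht₂, hs₂, hQ₂⟩ := hq s₁ hs₁ h₁.frame hQ₁ hs₁
  exact ⟨_, _, .seq h₁ h₂, by omega, hs₂, hQ₂⟩

/-- Keeps programs right-nested, the shape to which the symbolic execution rules `assign_seq` and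
`store_seq` apply; needed when a branch is itself a sequence. -/
theorem seq_assoc (h : Runs Z keys (p ;; q ;; r) s T Q) : Runs Z keys ((p ;; q) ;; r) s T Q := by
  intro hs
  obtain ⟨t, s', he, ht, hs', hq⟩ := h hs
  cases he with
  | seq h₁ h' => cases h' with
    | seq h₂ h₃ => exact ⟨_, _, .seq (.seq h₁ h₂) h₃, by omega, hs', hq⟩

theorem assign_seq (he : e.small = true) (hv : e.eval keys s = v) (hvZ : v < Z)
    (hT : e.cost + 1 ≤ T) (hq : Runs Z keys q (s.setReg x v) (T - (e.cost + 1)) Q) :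
    Runs Z keys (.assign x e ;; q) s T Q :=
  seq (e.cost + 1) (T - (e.cost + 1)) (Q₁ := fun s' => s' = s.setReg x v)
    (assign he hv hvZ le_rfl rfl) (by rintro s₁ - - rfl; exact hq) (by omega)

theorem store_seq (hi : idx.small = true) (he : e.small = true) (hiv : idx.eval keys s = i)
    (hv : e.eval keys s = v) (hvZ : v < Z) (hT : idx.cost + e.cost + 1 ≤ T)
    (hq : Runs Z keys q (s.setCell a i v) (T - (idx.cost + e.cost + 1)) Q) :
    Runs Z keys (.store a idx e ;; q) s T Q :=
  seq (idx.cost + e.cost + 1) (T - (idx.cost + e.cost + 1)) (Q₁ := fun s' => s' = s.setCell a i v)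
    (store hi he hiv hv hvZ le_rfl rfl) (by rintro s₁ - - rfl; exact hq) (by omega)

theorem skip_seq (hT : 1 ≤ T) (hq : Runs Z keys q s (T - 1) Q) :
    Runs Z keys (.skip ;; q) s T Q :=
  seq 1 (T - 1) (Q₁ := fun s' => s' = s) (skip le_rfl rfl) (by rintro s₁ - - rfl; exact hq)
    (by omega)

theorem ite (he : e.small = true) (hT : e.cost + 1 ≤ T)
    (hp : e.eval keys s ≠ 0 → Runs Z keys p s (T - (e.cost + 1)) Q)
    (hq : e.eval keys s = 0 → Runs Z keys q s (T - (e.cost + 1)) Q) :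
    Runs Z keys (.ite e p q) s T Q := by
  intro hs
  by_cases hc : e.eval keys s = 0
  · obtain ⟨t, s', h, ht, hs', hQ⟩ := hq hc hs
    exact ⟨_, s', .iteFalse p (Expr.fits_of_small hs he) hc h, by omega, hs', hQ⟩
  · obtain ⟨t, s', h, ht, hs', hQ⟩ := hp hc hs
    exact ⟨_, s', .iteTrue q (Expr.fits_of_small hs he) hc h, by omega, hs', hQ⟩

/-- Pushes the continuation into both branches, so that no intermediate assertion has to be stated
for the conditional. -/
theorem ite_seq (he : e.small = true) (hT : e.cost + 1 ≤ T)
    (hp : e.eval keys s ≠ 0 → Runs Z keys (p ;; r) s (T - (e.cost + 1)) Q)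
    (hq : e.eval keys s = 0 → Runs Z keys (q ;; r) s (T - (e.cost + 1)) Q) :
    Runs Z keys (.ite e p q ;; r) s T Q := by
  intro hs
  by_cases hc : e.eval keys s = 0
  · obtain ⟨t, s', h, ht, hs', hQ⟩ := hq hc hs
    cases h with
    | seq h₁ h₂ =>
      exact ⟨_, s', .seq (.iteFalse p (Expr.fits_of_small hs he) hc h₁) h₂, by omega, hs', hQ⟩
  · obtain ⟨t, s', h, ht, hs', hQ⟩ := hp hc hs
    cases h with
    | seq h₁ h₂ =>
      exact ⟨_, s', .seq (.iteTrue q (Expr.fits_of_small hs he) hc h₁) h₂, by omega, hs', hQ⟩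

/-- The rule for loops, with a bound `μ` on the remaining time. -/
theorem loop (he : e.small = true) (Inv : Memory → Prop) (μ : Memory → ℕ) (T₁ : ℕ)
    (h0 : Inv s) (hT : μ s ≤ T)
    (hdone : ∀ s', s'.Bdd Z → Frame p s s' → Inv s' → e.eval keys s' = 0 →
      e.cost + 1 ≤ μ s' ∧ Q s')
    (hstep : ∀ s', s'.Bdd Z → Frame p s s' → Inv s' → e.eval keys s' ≠ 0 →
      Runs Z keys p s' T₁ (fun s'' => Inv s'' ∧ e.cost + 1 + T₁ + μ s'' ≤ μ s')) :
    Runs Z keys (.loop e p) s T Q := by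
  intro hs
  suffices h : ∀ k s', μ s' ≤ k → s'.Bdd Z → Frame p s s' → Inv s' →
      ∃ t s'', Exec (Z ^ 40) keys (.loop e p) s' t s'' ∧ t ≤ μ s' ∧ s''.Bdd Z ∧ Q s'' by
    obtain ⟨t, s', h1, h2, h3⟩ := h _ s le_rfl hs (Frame.refl _ _) h0
    exact ⟨t, s', h1, h2.trans hT, h3⟩
  intro k
  induction k with
  | zero =>
    intro s' hk hs' hf hI
    by_cases hc : e.eval keys s' = 0
    · have := (hdone s' hs' hf hI hc).1
      omega
    -- A further iteration costs at least one step, which a measure of zero cannot pay for.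
    · obtain ⟨t, s'', -, -, -, -, h⟩ := hstep s' hs' hf hI hc hs'
      omega
  | succ k ih =>
    intro s' hk hs' hf hI
    have hfit : e.Fits (Z ^ 40) keys s' := Expr.fits_of_small hs' he
    by_cases hc : e.eval keys s' = 0
    · obtain ⟨h1, h2⟩ := hdone s' hs' hf hI hc
      exact ⟨_, s', .loopDone p hfit hc, h1, hs', h2⟩
    · obtain ⟨t, s'', hx, ht, hs'', hI', hμ⟩ := hstep s' hs' hf hI hc hs'
      obtain ⟨t', s₃, hx', ht', hs₃, hQ⟩ := ih s'' (by omega) hs'' (hf.trans hx.frame) hI'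
      exact ⟨_, s₃, .loopStep hfit hc hx hx', by omega, hs₃, hQ⟩

end Runs

/-- `for x in 0, …, bnd - 1 do body`. -/
def forUp (x : ℕ) (bnd : Expr) (body : Prog) : Prog :=
  .assign x 0 ;; .loop (bnd - .reg x) (body ;; .assign x (.reg x + 1))

/-- The invariant is indexed by the number of completed rounds and is re-established for the memory
in which the counter has already been increased. The bound has to evaluate to `k` in every memory
the loop can reach. Each round pays for the body, the test and the increment, with one step of
slack. -/
theorem Runs.forUp {x : ℕ} {bnd : Expr} {body : Prog} {s : Memory} {T : ℕ} {Q : Memory → Prop}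
    (k Tb : ℕ) (Inv : ℕ → Memory → Prop) (hbnd : (bnd - .reg x).small = true)
    (hx : body.setsReg x = false) (hk : k < Z)
    (hT : k * (Tb + bnd.cost + 8) + bnd.cost + 8 ≤ T)
    (hb : ∀ s', Frame (forUp x bnd body) s s' → bnd.eval keys s' = k)
    (h0 : Inv 0 (s.setReg x 0))
    (hstep : ∀ j s', j < k → s'.Bdd Z → Frame (TwoTokens.forUp x bnd body) s s' → s'.reg x = j →
      Inv j s' → Runs Z keys body s' Tb (fun s'' => Inv (j + 1) (s''.setReg x (j + 1))))
    (hQ : ∀ s', s'.Bdd Z → Frame (TwoTokens.forUp x bnd body) s s' → Inv k s' → Q s') :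
    Runs Z keys (TwoTokens.forUp x bnd body) s T Q := by
  have hsmall : (Expr.reg x + 1).small = true := rfl
  have hc : (bnd - .reg x).cost = bnd.cost + 2 := rfl
  have hcx : (.reg x + 1 : Expr).cost = 3 := rfl
  have hc0 : (0 : Expr).cost = 1 := rfl
  have hfr : ∀ s', Frame (body ;; .assign x (.reg x + 1)) (s.setReg x 0) s' →
      Frame (TwoTokens.forUp x bnd body) s s' := by
    intro s' h
    refine ⟨fun y hy => ?_, fun a ha => ?_⟩
    · simp only [TwoTokens.forUp, Prog.setsReg, Bool.or_eq_false_iff, beq_eq_false_iff_ne] at hy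
      rw [h.reg y (by simp [Prog.setsReg, hy.1, hy.2.1])]
      simp [hy.1]
    · rw [h.arr a (by simpa [TwoTokens.forUp, Prog.setsArr] using ha)]
      rfl
  refine seq 2 (k * (Tb + bnd.cost + 8) + bnd.cost + 5)
    (Q₁ := fun s' => s' = s.setReg x 0) (assign rfl rfl (by simp; omega) (by rw [hc0]) (by simp))
    ?_ (by omega)
  rintro s₁ hs₁ - rfl
  refine loop hbnd (fun s' => s'.reg x ≤ k ∧ Inv (s'.reg x) s')
    (fun s' => (k - s'.reg x) * (Tb + bnd.cost + 8) + bnd.cost + 5) (Tb + 4)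
    ⟨by simp, by simpa using h0⟩ (by simp) ?_ ?_
  · rintro s' hs' hf ⟨hle, hI⟩ he
    rw [Expr.eval_sub, hb s' (hfr s' hf), Expr.eval_reg] at he
    refine ⟨by rw [hc]; omega, hQ s' hs' (hfr s' hf) ?_⟩
    rwa [show s'.reg x = k by omega] at hI
  · rintro s' hs' hf ⟨hle, hI⟩ he
    rw [Expr.eval_sub, hb s' (hfr s' hf), Expr.eval_reg] at he
    refine seq Tb 4 (hstep _ s' (by omega) hs' (hfr s' hf) rfl hI) ?_ le_rfl
    intro s₂ hs₂ hf₂ hI₂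
    have hx₂ := hf₂.reg x hx
    refine assign hsmall (v := s'.reg x + 1) (by simp [hx₂]) (by omega) (by rw [hcx]) ?_
    refine ⟨⟨by simp; omega, by simpa using hI₂⟩, ?_⟩
    obtain ⟨d, hd⟩ : ∃ d, k = s'.reg x + 1 + d := ⟨k - s'.reg x - 1, by omega⟩
    simp only [Memory.setReg_reg, if_true, hc]
    rw [show k - (s'.reg x + 1) = d by omega, show k - s'.reg x = d + 1 by omega]
    nlinarith

end Runs

end TwoTokens

namespace TwoTokens

/-! ## Bits -/

/-- The bit of `p` of weight `P`, a power of two. -/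
def bitAt (P p : ℕ) : ℕ := p / P % 2

/-- The number `p` with its bit of weight `P` replaced by `b`. -/
def setBit (P p b : ℕ) : ℕ := p / (P * 2) * (P * 2) + b * P + p % P

/-- The number `p` with its bit of weight `P` changed. -/
def flipBit (P p : ℕ) : ℕ := setBit P p (1 - bitAt P p)

section Bits

variable {P M p q b b' : ℕ}

theorem bitAt_lt_two : bitAt P p < 2 := Nat.mod_lt _ (by norm_num)

theorem bitAt_eq_sub : p / P - p / (P * 2) * 2 = bitAt P p := by
  rw [bitAt, ← Nat.div_div_eq_div_mul]
  omega

theorem add_lt_mul_two (hP : 0 < P) (hb : b < 2) : b * P + p % P < P * 2 := by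
  have := Nat.mod_lt p hP
  have : b * P ≤ 1 * P := Nat.mul_le_mul_right _ (by omega)
  omega

theorem setBit_div (hP : 0 < P) (hb : b < 2) : setBit P p b / (P * 2) = p / (P * 2) := by
  rw [setBit, add_assoc, Nat.mul_comm, Nat.mul_add_div (by omega),
    Nat.div_eq_of_lt (add_lt_mul_two hP hb), add_zero]

theorem setBit_mod_two_mul (hP : 0 < P) (hb : b < 2) :
    setBit P p b % (P * 2) = b * P + p % P := by
  rw [setBit, add_assoc, Nat.mul_comm, Nat.mul_add_mod, Nat.mod_eq_of_lt (add_lt_mul_two hP hb)]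

theorem setBit_mod : setBit P p b % P = p % P := by
  rw [setBit, show p / (P * 2) * (P * 2) + b * P + p % P = P * (p / (P * 2) * 2 + b) + p % P by
    ring, Nat.mul_add_mod, Nat.mod_mod]

theorem bitAt_setBit (hP : 0 < P) (hb : b < 2) : bitAt P (setBit P p b) = b := by
  rw [bitAt, setBit, show p / (P * 2) * (P * 2) + b * P + p % P =
    P * (p / (P * 2) * 2 + b) + p % P by ring, Nat.mul_add_div hP,
    Nat.div_eq_of_lt (Nat.mod_lt _ hP)]
  omega

theorem setBit_setBit (hP : 0 < P) (hb : b < 2) :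
    setBit P (setBit P p b) b' = setBit P p b' := by
  rw [setBit, setBit_div hP hb, setBit_mod, setBit]

theorem mod_mul_two : p % (P * 2) = bitAt P p * P + p % P := by
  rw [Nat.mod_mul, bitAt]; ring

theorem setBit_bitAt : setBit P p (bitAt P p) = p := by
  rw [setBit, add_assoc, ← mod_mul_two, Nat.div_add_mod']

theorem setBit_lt (hP : 0 < P) (hM : P * 2 ∣ M) (hb : b < 2) (hp : p < M) :
    setBit P p b < M := by
  obtain ⟨c, rfl⟩ := hM
  rw [mul_comm, ← Nat.div_lt_iff_lt_mul (by omega), setBit_div hP hb]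
  exact Nat.div_lt_of_lt_mul hp

theorem setBit_left_inj (hP : 0 < P) (hb : b < 2) (hb' : b' < 2)
    (h : setBit P p b = setBit P q b') : b = b' := by
  rw [← bitAt_setBit (p := p) hP hb, h, bitAt_setBit hP hb']

/-- Overwriting the bit once more by its common original value undoes the first overwriting on both
sides. -/
theorem eq_of_setBit_eq (hP : 0 < P) (hb : b < 2) (hb' : b' < 2)
    (h : setBit P p b = setBit P q b') (hpq : bitAt P p = bitAt P q) : p = q := by
  rw [← setBit_bitAt (P := P) (p := p), ← setBit_setBit hP hb, h, setBit_setBit hP hb', hpq,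
    setBit_bitAt]

theorem flipBit_flipBit (hP : 0 < P) : flipBit P (flipBit P p) = p := by
  have := bitAt_lt_two (P := P) (p := p)
  rw [flipBit, flipBit, bitAt_setBit hP (by omega), setBit_setBit hP (by omega),
    show 1 - (1 - bitAt P p) = bitAt P p by omega, setBit_bitAt]

theorem bitAt_flipBit (hP : 0 < P) : bitAt P (flipBit P p) = 1 - bitAt P p :=
  bitAt_setBit hP (by omega)

theorem flipBit_ne (hP : 0 < P) : flipBit P p ≠ p := by
  intro h
  have h' := bitAt_flipBit (p := p) hP
  rw [h] at h'
  omega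

theorem flipBit_lt (hP : 0 < P) (hM : P * 2 ∣ M) (hp : p < M) : flipBit P p < M :=
  setBit_lt hP hM (by omega) hp

/-- Numbers that agree up to a bit are equal or obtained from each other by a flip. -/
theorem eq_or_eq_flipBit (hP : 0 < P) (hb : b < 2) (hb' : b' < 2)
    (h : setBit P p b = setBit P q b') : p = q ∨ p = flipBit P q := by
  by_cases hpq : bitAt P p = bitAt P q
  · exact Or.inl (eq_of_setBit_eq hP hb hb' h hpq)
  · have h1 := bitAt_lt_two (P := P) (p := p)
    have h2 := bitAt_lt_two (P := P) (p := q)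
    refine Or.inr (eq_of_setBit_eq hP hb (b' := b') hb' ?_ ?_)
    · rw [h, flipBit, setBit_setBit hP (by omega)]
    · rw [bitAt_flipBit hP]; omega

end Bits

/-! ## The routing network -/

/-- The bit that layer `t` of the network for `2 ^ L` elements changes. -/
def layerBit (L t : ℕ) : ℕ := if t < L then t else 2 * L - 1 - t

/-- The vertex at position `p` of layer `t` for the direction `b`. -/
def node (M t p b : ℕ) : ℕ := (t * M + p) * 2 + b

/-- The number of vertices of one copy of the network. -/
def half (L M : ℕ) : ℕ := (L * 2 + 1) * M * 2

/-- `pos t e` is the position of element `e` after `t` layers of the network, which carry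
every element `e` to the position `rank e`. -/
structure Routing (L : ℕ) (rank : ℕ → ℕ) (pos : ℕ → ℕ → ℕ) : Prop where
  lt : ∀ t e, t ≤ L * 2 → e < 2 ^ L → pos t e < 2 ^ L
  inj : ∀ t e e', t ≤ L * 2 → e < 2 ^ L → e' < 2 ^ L → pos t e = pos t e' → e = e'
  zero : ∀ e, e < 2 ^ L → pos 0 e = e
  last : ∀ e, e < 2 ^ L → pos (L * 2) e = rank e
  step : ∀ t e, t < L * 2 → e < 2 ^ L → pos (t + 1) e =
    setBit (2 ^ layerBit L t) (pos t e) (bitAt (2 ^ layerBit L t) (pos (t + 1) e))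

/-- The direction in which element `e` leaves layer `t`. -/
def direction (L : ℕ) (pos : ℕ → ℕ → ℕ) (t e : ℕ) : ℕ :=
  if t < L * 2 then bitAt (2 ^ layerBit L t) (pos (t + 1) e) else 0

/-- The vertices on the routes of the elements, in both copies of the network. -/
def Live (L : ℕ) (pos : ℕ → ℕ → ℕ) (v : ℕ) : Prop :=
  ∃ t e, t ≤ L * 2 ∧ e < 2 ^ L ∧ (v = node (2 ^ L) t (pos t e) (direction L pos t e) ∨
    v = half L (2 ^ L) + node (2 ^ L) t (pos t e) (direction L pos t e))

/-- The edges of Bob's graph: two copies of the network, the second one reversed, the order of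
the ranks in between, and the edges of the matrix `B` back to the start. -/
inductive NetEdge (L M H m : ℕ) (B : ℕ → ℕ → Prop) : ℕ → ℕ → Prop
  | forward (t p b b' : ℕ) (ht : t < L * 2) (hp : p < M) (hb : b < 2) (hb' : b' < 2) :
      NetEdge L M H m B (node M t p b) (node M (t + 1) (setBit (2 ^ layerBit L t) p b) b')
  | backward (t p b b' : ℕ) (ht : t < L * 2) (hp : p < M) (hb : b < 2) (hb' : b' < 2) :
      NetEdge L M H m B (half L M + node M (t + 1) (setBit (2 ^ layerBit L t) p b) b')
        (half L M + node M t p b)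
  | cross (q : ℕ) (hq : q < M) :
      NetEdge L M H m B (node M (L * 2) q 0) (half L M + node M (L * 2) q 0)
  | line (q : ℕ) (hq : q < M) :
      NetEdge L M H m B (half L M + node M (L * 2) q 0) (half L M + node M (L * 2) q 0 + 2)
  | matrix (k j b b' : ℕ) (hk : k < m) (hj : j < m) (hb : b < 2) (hb' : b' < 2) (h : B k j) :
      NetEdge L M H m B (half L M + node M 0 k b) (node M 0 (H + j) b')

section Network

variable {L M H m : ℕ} {B : ℕ → ℕ → Prop} {rank : ℕ → ℕ} {pos : ℕ → ℕ → ℕ}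

theorem node_lt_half {t p b : ℕ} (ht : t ≤ L * 2) (hp : p < M) (hb : b < 2) :
    node M t p b < half L M := by
  have : t * M ≤ L * 2 * M := Nat.mul_le_mul_right _ ht
  rw [node, half, Nat.add_mul (L * 2) 1 M]
  omega

theorem node_div {t p b : ℕ} (hp : p < M) (hb : b < 2) : node M t p b / 2 / M = t := by
  rw [show node M t p b / 2 = M * t + p by rw [node, mul_comm M]; omega,
    Nat.mul_add_div (by omega), Nat.div_eq_of_lt hp, add_zero]

theorem node_mod {t p b : ℕ} (hp : p < M) (hb : b < 2) : node M t p b / 2 % M = p := by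
  rw [show node M t p b / 2 = M * t + p by rw [node, mul_comm M]; omega, Nat.mul_add_mod,
    Nat.mod_eq_of_lt hp]

theorem node_inj {t p b t' p' b' : ℕ} (hp : p < M) (hb : b < 2) (hp' : p' < M) (hb' : b' < 2)
    (h : node M t p b = node M t' p' b') : t = t' ∧ p = p' ∧ b = b' := by
  have h1 := node_div (t := t) hp hb
  have h2 := node_mod (t := t) hp hb
  rw [h, node_div hp' hb'] at h1
  rw [h, node_mod hp' hb'] at h2
  subst h1 h2
  exact ⟨rfl, rfl, by unfold node at h; omega⟩

theorem direction_lt_two {t e : ℕ} : direction L pos t e < 2 := by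
  unfold direction
  split_ifs
  exacts [bitAt_lt_two, by norm_num]

theorem layerBit_lt {t : ℕ} (ht : t < L * 2) : layerBit L t < L := by
  unfold layerBit
  split_ifs <;> omega

theorem two_pow_layerBit_dvd {t : ℕ} (ht : t < L * 2) : 2 ^ layerBit L t * 2 ∣ 2 ^ L := by
  rw [← pow_succ]
  exact Nat.pow_dvd_pow _ (layerBit_lt ht)

namespace Routing

variable (hR : Routing L rank pos)
include hR

theorem step' {t e : ℕ} (ht : t < L * 2) (he : e < 2 ^ L) :
    pos (t + 1) e = setBit (2 ^ layerBit L t) (pos t e) (direction L pos t e) := by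
  rw [direction, if_pos ht]
  exact hR.step t e ht he

/-- The first copy occupies exactly the numbers below `half` and `node` is injective there, so a
live vertex reveals its element. The direction is known as well, which is what forbids switching to
another route. -/
theorem live_forward {t p b : ℕ} (ht : t ≤ L * 2) (hp : p < 2 ^ L) (hb : b < 2)
    (h : Live L pos (node (2 ^ L) t p b)) :
    ∃ e < 2 ^ L, pos t e = p ∧ direction L pos t e = b := by
  obtain ⟨t', e, ht', he, h | h⟩ := h
  · obtain ⟨rfl, rfl, rfl⟩ := node_inj hp hb (hR.lt _ _ ht' he) direction_lt_two h
    exact ⟨e, he, rfl, rfl⟩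
  · have := node_lt_half ht hp hb
    omega

theorem live_backward {t p b : ℕ} (hp : p < 2 ^ L) (hb : b < 2)
    (h : Live L pos (half L (2 ^ L) + node (2 ^ L) t p b)) :
    ∃ e < 2 ^ L, pos t e = p ∧ direction L pos t e = b := by
  obtain ⟨t', e, ht', he, h | h⟩ := h
  · have := node_lt_half ht' (hR.lt _ _ ht' he) (direction_lt_two (L := L) (pos := pos) (t := t')
      (e := e))
    omega
  · obtain ⟨rfl, rfl, rfl⟩ := node_inj hp hb (hR.lt _ _ ht' he) direction_lt_two
      (Nat.add_left_cancel h)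
    exact ⟨e, he, rfl, rfl⟩

/-- By injectivity in each layer the element can be read off from layer and position. This makes the
potential a function of the vertex alone. -/
theorem exists_owner : ∃ own : ℕ → ℕ → ℕ, ∀ t e, t ≤ L * 2 → e < 2 ^ L → own t (pos t e) = e := by
  classical
  refine ⟨fun t p => if h : ∃ e < 2 ^ L, pos t e = p then h.choose else 0, ?_⟩
  intro t e ht he
  have h : ∃ e' < 2 ^ L, pos t e' = pos t e := ⟨e, he, rfl⟩
  simp only [dif_pos h]
  exact hR.inj t _ _ ht h.choose_spec.1 he h.choose_spec.2

/-- Order the live vertices by the rank of their element, then by progress on its route through both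
copies. Route edges and `cross` keep the element and advance by one, `line` passes to the next rank,
and a `matrix` edge raises the rank by `hB`. -/
theorem exists_potential (hHm : H + m ≤ 2 ^ L)
    (hB : ∀ k j, k < m → j < m → B k j → rank k < rank (H + j)) :
    ∃ Φ : ℕ → ℕ, ∀ u v, Live L pos u → Live L pos v → NetEdge L (2 ^ L) H m B u v →
      Φ u < Φ v := by
  obtain ⟨own, hown⟩ := hR.exists_owner
  -- The progress on a route takes the values `0, …, 2L` in the first copy and `2L + 1, …, 4L + 1`
  -- in the second, so blocks of `4L + 3` keep different ranks apart.
  let R : ℕ → ℕ := fun v => rank (own (v / 2 / 2 ^ L) (v / 2 % 2 ^ L)) * (4 * L + 3)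
  let Φ : ℕ → ℕ := fun v => if v < half L (2 ^ L) then R v + v / 2 / 2 ^ L
    else R (v - half L (2 ^ L)) + (4 * L + 1 - (v - half L (2 ^ L)) / 2 / 2 ^ L)
  have hΦ₁ : ∀ t e b, t ≤ L * 2 → e < 2 ^ L → b < 2 →
      Φ (node (2 ^ L) t (pos t e) b) = rank e * (4 * L + 3) + t := by
    intro t e b ht he hb
    have hp := hR.lt t e ht he
    simp only [Φ, R, if_pos (node_lt_half ht hp hb), node_div hp hb, node_mod hp hb,
      hown t e ht he]
  have hΦ₂ : ∀ t e b, t ≤ L * 2 → e < 2 ^ L → b < 2 →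
      Φ (half L (2 ^ L) + node (2 ^ L) t (pos t e) b) =
        rank e * (4 * L + 3) + (4 * L + 1 - t) := by
    intro t e b ht he hb
    have hp := hR.lt t e ht he
    simp only [Φ, R, if_neg (show ¬ half L (2 ^ L) + node (2 ^ L) t (pos t e) b < half L (2 ^ L)
      by omega), Nat.add_sub_cancel_left, node_div hp hb, node_mod hp hb, hown t e ht he]
  have hΦ₀ : ∀ e b, e < 2 ^ L → b < 2 → Φ (node (2 ^ L) 0 e b) = rank e * (4 * L + 3) := by
    intro e b he hb
    simpa [hR.zero e he] using hΦ₁ 0 e b (Nat.zero_le _) he hb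
  have hΦ₀' : ∀ e b, e < 2 ^ L → b < 2 → Φ (half L (2 ^ L) + node (2 ^ L) 0 e b) =
      rank e * (4 * L + 3) + (4 * L + 1) := by
    intro e b he hb
    simpa [hR.zero e he] using hΦ₂ 0 e b (Nat.zero_le _) he hb
  refine ⟨Φ, ?_⟩
  intro u v hu hv huv
  cases huv with
  | forward t p b b' ht hp hb hb' =>
    obtain ⟨e, he, rfl, rfl⟩ := hR.live_forward ht.le hp hb hu
    rw [← hR.step' ht he, hΦ₁ _ _ _ ht.le he hb, hΦ₁ _ _ _ ht he hb']
    omega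
  | backward t p b b' ht hp hb hb' =>
    obtain ⟨e, he, rfl, rfl⟩ := hR.live_backward hp hb hv
    rw [← hR.step' ht he, hΦ₂ _ _ _ ht.le he hb, hΦ₂ _ _ _ ht he hb']
    omega
  | cross q hq =>
    obtain ⟨e, he, rfl, -⟩ := hR.live_forward le_rfl hq (by norm_num) hu
    rw [hΦ₁ _ _ _ le_rfl he (by norm_num), hΦ₂ _ _ _ le_rfl he (by norm_num)]
    omega
  | line q hq =>
    obtain ⟨e, he, rfl, -⟩ := hR.live_backward hq (by norm_num) hu
    have hnode : half L (2 ^ L) + node (2 ^ L) (L * 2) (pos (L * 2) e) 0 + 2 =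
        half L (2 ^ L) + node (2 ^ L) (L * 2) (pos (L * 2) e + 1) 0 := by
      unfold node; ring
    rw [hnode] at hv ⊢
    by_cases hq' : pos (L * 2) e + 1 < 2 ^ L
    · obtain ⟨e', he', h', -⟩ := hR.live_backward hq' (by norm_num) hv
      rw [← h', hΦ₂ _ _ _ le_rfl he (by norm_num), hΦ₂ _ _ _ le_rfl he' (by norm_num)]
      rw [hR.last _ he, hR.last _ he'] at h'
      rw [h', Nat.add_mul]
      omega
    -- From the last position the line leads to the number `2 * half`, just beyond both copies,
    -- which is never live. This is why Bob's graph has one additional vertex.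
    · exfalso
      have hval : node (2 ^ L) (L * 2) (pos (L * 2) e + 1) 0 = half L (2 ^ L) := by
        rw [show pos (L * 2) e + 1 = 2 ^ L by omega, node, half]; ring
      rw [hval] at hv
      obtain ⟨t, e', ht, he', h⟩ := hv
      have := node_lt_half ht (hR.lt _ _ ht he') (direction_lt_two (L := L) (pos := pos) (t := t)
        (e := e'))
      omega
  | matrix k j b b' hk hj hb hb' h =>
    rw [hΦ₀ _ _ (by omega) hb', hΦ₀' _ _ (by omega) hb]
    have := Nat.mul_le_mul_right (4 * L + 3) (hB k j hk hj h)
    rw [Nat.succ_mul] at this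
    omega

/-- The trap is a closed tour: the route of `H + j`, the line from `rank (H + j)` up to `rank k`,
the reversed route of `k`, and the matrix edge from `k` to `H + j`. Surjectivity of `rank` makes
every vertex of the line segment live. -/
theorem exists_trap (hL : 0 < L) (hHm : H + m ≤ 2 ^ L) {k j : ℕ} (hk : k < m) (hj : j < m) (hB : B k j)
    (hsurj : ∀ q < 2 ^ L, ∃ e < 2 ^ L, rank e = q) (hle : rank (H + j) ≤ rank k) :
    ∃ X : Set ℕ, X.Nonempty ∧
      ∀ v ∈ X, Live L pos v ∧ ∃ v' ∈ X, NetEdge L (2 ^ L) H m B v v' := by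
  let nd : ℕ → ℕ → ℕ := fun t e => node (2 ^ L) t (pos t e) (direction L pos t e)
  have hlast : ∀ e < 2 ^ L, nd (L * 2) e = node (2 ^ L) (L * 2) (rank e) 0 := by
    intro e he
    simp only [nd, hR.last e he, direction, lt_irrefl, if_false]
  have hk' : k < 2 ^ L := by omega
  have hj' : H + j < 2 ^ L := by omega
  have hrk : rank k < 2 ^ L := hR.last k hk' ▸ hR.lt _ _ le_rfl hk'
  -- The reversed route is listed only below layer `2L`, because its vertex in that layer is already
  -- the end of the line segment.
  refine ⟨{v | (∃ t ≤ L * 2, v = nd t (H + j)) ∨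
    (∃ q, rank (H + j) ≤ q ∧ q ≤ rank k ∧ v = half L (2 ^ L) + node (2 ^ L) (L * 2) q 0) ∨
    (∃ t < L * 2, v = half L (2 ^ L) + nd t k)}, ⟨_, Or.inl ⟨0, Nat.zero_le _, rfl⟩⟩, ?_⟩
  have hback : ∀ t ≤ L * 2, half L (2 ^ L) + nd t k ∈ {v | (∃ t ≤ L * 2, v = nd t (H + j)) ∨
    (∃ q, rank (H + j) ≤ q ∧ q ≤ rank k ∧ v = half L (2 ^ L) + node (2 ^ L) (L * 2) q 0) ∨
    (∃ t < L * 2, v = half L (2 ^ L) + nd t k)} := by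
    intro t ht
    rcases ht.lt_or_eq with h | rfl
    · exact Or.inr (Or.inr ⟨t, h, rfl⟩)
    · exact Or.inr (Or.inl ⟨rank k, hle, le_rfl, by rw [hlast k hk']⟩)
  have hedge : ∀ t, t < L * 2 → NetEdge L (2 ^ L) H m B (half L (2 ^ L) + nd (t + 1) k)
      (half L (2 ^ L) + nd t k) := by
    intro t ht
    have := NetEdge.backward (L := L) (M := 2 ^ L) (H := H) (m := m) (B := B) t (pos t k)
      (direction L pos t k) (direction L pos (t + 1) k) ht (hR.lt _ _ ht.le hk') direction_lt_two
      direction_lt_two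
    rwa [← hR.step' ht hk'] at this
  rintro v (⟨t, ht, rfl⟩ | ⟨q, hq, hq', rfl⟩ | ⟨t, ht, rfl⟩)
  · refine ⟨⟨t, _, ht, hj', Or.inl rfl⟩, ?_⟩
    rcases ht.lt_or_eq with h | rfl
    · refine ⟨nd (t + 1) (H + j), Or.inl ⟨t + 1, h, rfl⟩, ?_⟩
      have := NetEdge.forward (L := L) (M := 2 ^ L) (H := H) (m := m) (B := B) t (pos t (H + j))
        (direction L pos t (H + j)) (direction L pos (t + 1) (H + j)) h (hR.lt _ _ ht hj')
        direction_lt_two direction_lt_two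
      rwa [← hR.step' h hj'] at this
    · refine ⟨_, Or.inr (Or.inl ⟨rank (H + j), le_rfl, hle, rfl⟩), ?_⟩
      rw [hlast _ hj']
      exact .cross _ (by omega)
  · obtain ⟨e, he, rfl⟩ := hsurj q (by omega)
    refine ⟨⟨L * 2, e, le_rfl, he, Or.inr (by rw [← hlast e he])⟩, ?_⟩
    rcases hq'.lt_or_eq with h | h
    · refine ⟨_, Or.inr (Or.inl ⟨rank e + 1, by omega, h, rfl⟩), ?_⟩
      have := NetEdge.line (L := L) (M := 2 ^ L) (H := H) (m := m) (B := B) (rank e) (by omega)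
      rwa [show half L (2 ^ L) + node (2 ^ L) (L * 2) (rank e) 0 + 2 =
        half L (2 ^ L) + node (2 ^ L) (L * 2) (rank e + 1) 0 by unfold node; ring] at this
    -- At the end of the line segment the tour turns into the reversed route of `k`; this needs at
    -- least one layer.
    · have hL' : 0 < L * 2 := by omega
      refine ⟨_, hback (L * 2 - 1) (by omega), ?_⟩
      have := hedge (L * 2 - 1) (by omega)
      rw [Nat.sub_add_cancel hL', hlast k hk'] at this
      rwa [h]
  · refine ⟨⟨t, k, ht.le, hk', Or.inr rfl⟩, ?_⟩
    rcases Nat.eq_zero_or_pos t with rfl | h0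
    · refine ⟨_, Or.inl ⟨0, Nat.zero_le _, rfl⟩, ?_⟩
      simp only [nd, hR.zero k hk', hR.zero _ hj']
      exact .matrix k j _ _ hk hj direction_lt_two direction_lt_two hB
    · refine ⟨_, hback (t - 1) (by omega), ?_⟩
      have := hedge (t - 1) (by omega)
      rwa [Nat.sub_add_cancel h0] at this

end Routing

end Network

end TwoTokens

namespace TwoTokens

/-! ## The construction of Bob's graph -/

theorem Frame.env_reg {p : Prog} {s s' : Memory} {v x : ℕ} (h : Frame p s s') (hs : s.reg x = v)
    (hx : p.setsReg x = false) : s'.reg x = v := (h.reg x hx).trans hs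

/-- The parameters in memory: the sizes of the instance and of the network, and the powers of two
that belong to the layers of the network. -/
structure Env (n m L H : ℕ) (s : Memory) : Prop where
  r0 : s.reg 0 = n
  r1 : s.reg 1 = m
  r2 : s.reg 2 = half L (2 ^ L) * 2 + 1
  r5 : s.reg 5 = L
  r6 : s.reg 6 = 2 ^ L
  r7 : s.reg 7 = H
  r8 : s.reg 8 = L * 2
  r9 : s.reg 9 = half L (2 ^ L)

/-- The table of powers of two. -/
def PowTable (L : ℕ) (s : Memory) : Prop := ∀ t < L * 2, s.arr 15 t = 2 ^ layerBit L t

/-- The program leaves the parameters alone. -/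
def Prog.keepsEnv (p : Prog) : Bool :=
  !(p.setsReg 0 || p.setsReg 1 || p.setsReg 2 || p.setsReg 5 || p.setsReg 6 || p.setsReg 7 ||
    p.setsReg 8 || p.setsReg 9)

theorem Env.frame {n m L H : ℕ} {s s' : Memory} {p : Prog} (h : Env n m L H s)
    (hf : Frame p s s') (hp : p.keepsEnv = true) : Env n m L H s' := by
  simp only [Prog.keepsEnv, Bool.not_eq_true', Bool.or_eq_false_iff] at hp
  exact ⟨hf.env_reg h.r0 hp.1.1.1.1.1.1.1, hf.env_reg h.r1 hp.1.1.1.1.1.1.2,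
    hf.env_reg h.r2 hp.1.1.1.1.1.2, hf.env_reg h.r5 hp.1.1.1.1.2, hf.env_reg h.r6 hp.1.1.1.2,
    hf.env_reg h.r7 hp.1.1.2, hf.env_reg h.r8 hp.1.2, hf.env_reg h.r9 hp.2⟩

theorem PowTable.frame {L : ℕ} {s s' : Memory} {p : Prog} (h : PowTable L s)
    (hf : Frame p s s') (hp : p.setsArr 15 = false) : PowTable L s' := by
  intro t ht
  rw [hf.arr 15 hp, h t ht]

/-- The numbers that a run computes are smaller than `Z`. -/
structure Bounds (n m L H Z : ℕ) : Prop where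
  pos : 0 < L
  two : H * 2 = 2 ^ L
  lt : m < H
  lit : 100 < Z
  cells : (n + 1) * (half L (2 ^ L) * 2 + 1) < Z
  edges : 6 * half L (2 ^ L) + m * m * 4 < Z
  keys : n * m * 2 + H * 2 < Z
  verts : n < Z

theorem layers_eq {L : ℕ} : L * 2 * 2 ^ L * 2 + 2 ^ L * 2 = half L (2 ^ L) := by
  unfold half; ring

section Bounds

variable {n m L H Z : ℕ} (h : Bounds n m L H Z)
include h

theorem Bounds.verts₁_lt : half L (2 ^ L) * 2 + 1 < Z :=
  lt_of_le_of_lt (Nat.le_mul_of_pos_left _ (by omega)) h.cells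

theorem Bounds.levels_lt : L * 2 + 1 < Z := by
  have h1 := h.verts₁_lt
  have h2 : (L * 2 + 1) * 1 ≤ (L * 2 + 1) * 2 ^ L := Nat.mul_le_mul_left _ Nat.one_le_two_pow
  unfold half at h1
  omega

theorem Bounds.size_lt : 2 ^ L * 2 < Z := by
  have h1 := h.verts₁_lt
  have h2 := layers_eq (L := L)
  omega

end Bounds

/-- The expression for `setBit`. -/
def setBitExpr (P p b : Expr) : Expr := p / (P * 2) * (P * 2) + b * P + (p - p / P * P)

/-- The expression for `bitAt`. -/
def bitExpr (P p : Expr) : Expr := p / P - p / (P * 2) * 2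

section Programs

variable {K : Type*} [LinearOrder K] {Z : ℕ} {keys : ℕ → K} {n m L H : ℕ} {s : Memory}

theorem eval_setBitExpr (P p b : Expr) : (setBitExpr P p b).eval keys s =
    setBit (P.eval keys s) (p.eval keys s) (b.eval keys s) := by
  simp only [setBitExpr, Expr.eval_add, Expr.eval_mul, Expr.eval_div, Expr.eval_ofNat,
    Expr.eval_sub, setBit]
  congr 1
  have := Nat.div_add_mod' (p.eval keys s) (P.eval keys s)
  omega

theorem eval_bitExpr (P p : Expr) : (bitExpr P p).eval keys s =
    bitAt (P.eval keys s) (p.eval keys s) := by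
  simp only [bitExpr, Expr.eval_mul, Expr.eval_div, Expr.eval_ofNat, Expr.eval_sub, bitAt_eq_sub]

/-- Computes the sizes of the network. -/
def sizeProg : Prog :=
  .assign 7 1 ;; .assign 5 1 ;;
  .loop (.reg 1 + 1 - .reg 7) (.assign 7 (.reg 7 * 2) ;; .assign 5 (.reg 5 + 1)) ;;
  .assign 6 (.reg 7 * 2) ;; .assign 8 (.reg 5 * 2) ;;
  .assign 9 ((.reg 8 + 1) * .reg 6 * 2) ;; .assign 2 (.reg 9 * 2 + 1)

theorem runs_sizeProg (hm : m ≠ 0) (hb : Bounds n m (Nat.log 2 m + 2) (2 ^ (Nat.log 2 m + 1)) Z)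
    (h0 : s.reg 0 = n) (h1 : s.reg 1 = m) :
    Runs Z keys sizeProg s ((Nat.log 2 m + 2) * 20 + 40)
      (Env n m (Nat.log 2 m + 2) (2 ^ (Nat.log 2 m + 1))) := by
  have hlit := hb.lit
  have hsz := hb.size_lt
  have hlv := hb.levels_lt
  have hv := hb.verts₁_lt
  have hpow : ∀ c, c ≤ Nat.log 2 m + 1 → 2 ^ c < Z := by
    intro c hc
    have : 2 ^ c ≤ 2 ^ (Nat.log 2 m + 2) := Nat.pow_le_pow_right (by norm_num) (by omega)
    omega
  have hlog : ∀ c, 2 ^ c ≤ m → c ≤ Nat.log 2 m := fun c hc => Nat.le_log_of_pow_le (by norm_num) hc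
  unfold sizeProg
  refine Runs.assign_seq (v := 1) rfl (by simp) (by omega) (by simp [Expr.cost]) ?_
  refine Runs.assign_seq (v := 1) rfl (by simp) (by omega) (by simp [Expr.cost]) ?_
  refine Runs.seq ((Nat.log 2 m + 2) * 20 + 6) 30
    (Q₁ := fun s' => s'.reg 7 = 2 ^ (Nat.log 2 m + 1) ∧ s'.reg 5 = Nat.log 2 m + 2)
    -- Register 7 is doubled until it exceeds `m`, so it ends as the least power of two above `m`;
    -- register 5 stays one ahead of its exponent.
    (Runs.loop rfl (fun s' => ∃ c ≤ Nat.log 2 m + 1, s'.reg 7 = 2 ^ c ∧ s'.reg 5 = c + 1)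
      (fun s' => (Nat.log 2 m + 2 - s'.reg 5) * 20 + 6) 10 ⟨0, by simp⟩ (by simp) ?_ ?_) ?_
      (by simp [Expr.cost])
  · rintro s' - hf ⟨c, hc, h7, h5⟩ he
    have h1' : s'.reg 1 = m := (hf.reg 1 rfl).trans (by simpa using h1)
    simp only [Expr.eval_sub, Expr.eval_add, Expr.eval_reg, Expr.eval_one, h1', h7] at he
    have : c = Nat.log 2 m + 1 := by
      refine le_antisymm hc (Nat.lt_of_not_le fun hlt => ?_)
      have := Nat.pow_le_of_le_log (b := 2) hm hlt
      omega
    subst this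
    exact ⟨by change 6 ≤ _; omega, h7, h5⟩
  · rintro s' - hf ⟨c, hc, h7, h5⟩ he
    have h1' : s'.reg 1 = m := (hf.reg 1 rfl).trans (by simpa using h1)
    simp only [Expr.eval_sub, Expr.eval_add, Expr.eval_reg, Expr.eval_one, h1', h7] at he
    have hc' := hlog c (by omega)
    have := hpow (c + 1) (by omega)
    refine Runs.assign_seq (v := 2 ^ (c + 1)) rfl (by simp [h7, pow_succ]) this (by decide) ?_
    refine Runs.assign (v := c + 2) rfl (by simp [h5]) (by omega) (by decide) ?_
    refine ⟨⟨c + 1, by omega, by simp, by simp⟩, ?_⟩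
    simp only [Memory.setReg_reg, if_true, h5]
    obtain ⟨d, hd⟩ : ∃ d, Nat.log 2 m = c + d := ⟨_, (Nat.add_sub_of_le hc').symm⟩
    rw [show Nat.log 2 m + 2 - (c + 2) = d by omega,
      show Nat.log 2 m + 2 - (c + 1) = d + 1 by omega]
    change 5 + 1 + 10 + _ ≤ _
    omega
  rintro s' - hf ⟨h7, h5⟩
  have h0' : s'.reg 0 = n := (hf.reg 0 rfl).trans (by simpa using h0)
  have h1' : s'.reg 1 = m := (hf.reg 1 rfl).trans (by simpa using h1)
  refine Runs.assign_seq (v := 2 ^ (Nat.log 2 m + 2)) rfl (by simp [h7, pow_succ]) (by omega)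
    (by decide) ?_
  refine Runs.assign_seq (v := (Nat.log 2 m + 2) * 2) rfl (by simp [h5]) (by omega) (by decide) ?_
  refine Runs.assign_seq (v := half (Nat.log 2 m + 2) (2 ^ (Nat.log 2 m + 2))) rfl
    (by simp [half]) (by omega) (by decide) ?_
  refine Runs.assign (v := half (Nat.log 2 m + 2) (2 ^ (Nat.log 2 m + 2)) * 2 + 1) rfl
    (by simp) (by omega) (by decide) ?_
  constructor <;> simp [h0', h1', h5, h7]

/-- Computes the table of powers of two. -/
def powProg : Prog :=
  .assign 16 1 ;;
  forUp 13 (.reg 5) (.store 15 (.reg 13) (.reg 16) ;;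
    .store 15 (.reg 8 - 1 - .reg 13) (.reg 16) ;; .assign 16 (.reg 16 * 2))

theorem runs_powProg (hb : Bounds n m L H Z) (h : Env n m L H s) :
    Runs Z keys powProg s (L * 40 + 20) (PowTable L) := by
  have hlit := hb.lit
  have hsz := hb.size_lt
  have hlv := hb.levels_lt
  have hpow : ∀ c, c ≤ L → 2 ^ c < Z := by
    intro c hc
    have : 2 ^ c ≤ 2 ^ L := Nat.pow_le_pow_right (by norm_num) hc
    omega
  refine Runs.assign_seq (v := 1) rfl (by simp) (by omega) (by simp [Expr.cost]) ?_
  -- Mirrored layers change the same bit, so the table is filled from both ends towards the middle.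
  refine Runs.forUp L 30 (fun j s' => s'.reg 16 = 2 ^ j ∧
    ∀ t < L * 2, (t < j ∨ L * 2 - 1 - j < t) → s'.arr 15 t = 2 ^ layerBit L t)
    rfl rfl (by omega) (by simp [Expr.cost]; omega) (fun s' hf => ?_) ⟨by simp, ?_⟩ ?_ ?_
  · simp [hf.reg 5 rfl, h.r5]
  · intro t ht h'
    omega
  · rintro j s' hj - hf hx ⟨h16, hI⟩
    have h8 : s'.reg 8 = L * 2 := by simp [hf.reg 8 rfl, h.r8]
    refine Runs.store_seq (i := j) (v := 2 ^ j) rfl rfl (by simp [hx]) (by simp [h16])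
      (hpow _ hj.le) (by decide) ?_
    refine Runs.store_seq (i := L * 2 - 1 - j) (v := 2 ^ j) rfl rfl (by simp [hx, h8])
      (by simp [h16]) (hpow _ hj.le) (by decide) ?_
    refine Runs.assign (v := 2 ^ (j + 1)) rfl (by simp [h16, pow_succ]) (hpow _ hj) (by decide) ?_
    refine ⟨by simp, ?_⟩
    intro t ht h'
    simp only [Memory.setReg_arr, Memory.setCell_arr, if_true, Function.update_apply]
    split_ifs with h1 h2
    · rw [layerBit, if_neg (by omega)]
      congr 1; omega
    · rw [layerBit, if_pos (by omega), h2]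
    · exact hI t ht (by omega)
  · rintro s' - hf ⟨-, hI⟩ t ht
    exact hI t ht (by omega)

/-- Writes Alice's graph. -/
def waitProg : Prog :=
  forUp 13 (.reg 0) (.store 1 (.reg 13) (.reg 13) ;; .store 2 (.reg 13) (.reg 13)) ;;
  .assign 3 (.reg 0)

theorem runs_waitProg (hb : Bounds n m L H Z) (h : Env n m L H s) :
    Runs Z keys waitProg s (n * 20 + 20) (fun s' => s'.reg 3 = n ∧
      ∀ x < n, s'.arr 1 x = x ∧ s'.arr 2 x = x) := by
  have hn := hb.verts
  refine Runs.seq (n * 18 + 15) 2 (Q₁ := fun s' => ∀ x < n, s'.arr 1 x = x ∧ s'.arr 2 x = x)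
    (Runs.forUp n 8 (fun j s' => ∀ x < j, s'.arr 1 x = x ∧ s'.arr 2 x = x)
      rfl rfl hn (by simp [Expr.cost]; omega) (fun s' hf => ?_) (by simp) ?_ ?_) ?_ (by omega)
  · simp [hf.reg 0 rfl, h.r0]
  · rintro j s' hj - hf hx hI
    refine Runs.store_seq (i := j) (v := j) rfl rfl (by simp [hx]) (by simp [hx])
      (by omega) (by decide) ?_
    refine Runs.store (i := j) (v := j) rfl rfl (by simp [hx]) (by simp [hx])
      (by omega) (by decide) ?_
    intro x hx'
    by_cases h1 : x = j
    · simp [h1]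
    · simpa [h1] using hI x (by omega)
  · exact fun s' _ _ h => h
  · intro s' hs' hf hI
    have h0 : s'.reg 0 = n := (hf.reg 0 rfl).trans h.r0
    refine Runs.assign (v := n) rfl (by simp [h0]) hn (by decide) ⟨by simp, ?_⟩
    simpa using hI

/-- Appends an edge to the list of Bob's edges. -/
def emit (e f : Expr) : Prog :=
  .store 3 (.reg 4) e ;; .store 4 (.reg 4) f ;; .assign 4 (.reg 4 + 1)

/-- The list of Bob's edges contains `(u, v)`. -/
def EdgeIn (s : Memory) (u v : ℕ) : Prop := ∃ x < s.reg 4, s.arr 3 x = u ∧ s.arr 4 x = v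

/-- The second endpoint is evaluated after the first has been stored, hence the modified memory in
`hv`. The equivalence for `EdgeIn` records that the list grows by exactly this edge. -/
theorem runs_emit {e f : Expr} {u v T : ℕ} (he : e.small = true) (hf : f.small = true)
    (hu : e.eval keys s = u) (hv : ∀ i, f.eval keys (s.setCell 3 i u) = v) (huZ : u < Z) (hvZ : v < Z)
    (hZ : s.reg 4 + 1 < Z) (hT : e.cost + f.cost + 8 ≤ T) :
    Runs Z keys (emit e f) s T (fun s' => s'.reg 4 = s.reg 4 + 1 ∧
      ∀ a b, EdgeIn s' a b ↔ EdgeIn s a b ∨ (a = u ∧ b = v)) := by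
  refine Runs.weaken (T₁ := e.cost + f.cost + 8) (Q₁ := fun s' => s'.reg 4 = s.reg 4 + 1 ∧
      ∀ a b, EdgeIn s' a b ↔ EdgeIn s a b ∨ (a = u ∧ b = v)) ?_ hT (fun _ _ _ h => h)
  refine Runs.store_seq (i := s.reg 4) (v := u) rfl he (by simp) hu huZ
    (by simp [Expr.cost]; omega) ?_
  refine Runs.store_seq (i := s.reg 4) (v := v) rfl hf (by simp) (hv _) hvZ
    (by simp [Expr.cost]; omega) ?_
  refine Runs.assign (v := s.reg 4 + 1) rfl (by simp) hZ (by simp [Expr.cost]; omega) ?_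
  refine ⟨by simp, fun a b => ?_⟩
  have key : EdgeIn (((s.setCell 3 (s.reg 4) u).setCell 4 (s.reg 4) v).setReg 4 (s.reg 4 + 1)) a b ↔
      ∃ x < s.reg 4 + 1, (if x = s.reg 4 then u else s.arr 3 x) = a ∧
        (if x = s.reg 4 then v else s.arr 4 x) = b := by
    simp [EdgeIn, Function.update_apply]
  rw [key]
  constructor
  · rintro ⟨x, hx, h⟩
    split_ifs at h with hx'
    · exact Or.inr ⟨h.1.symm, h.2.symm⟩
    · exact Or.inl ⟨x, by omega, h⟩
  · rintro (⟨x, hx, h⟩ | ⟨rfl, rfl⟩)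
    · refine ⟨x, by omega, ?_⟩
      rwa [if_neg (by omega), if_neg (by omega)]
    · exact ⟨s.reg 4, by omega, by simp, by simp⟩

end Programs
end TwoTokens

namespace TwoTokens

/-! ### Writing Bob's edges and the constant tables -/

section Programs

variable {K : Type*} [LinearOrder K] {Z : ℕ} {keys : ℕ → K} {n m L H : ℕ} {s : Memory}

/-- Writes the edges of both copies of the network. -/
def netProg : Prog :=
  forUp 13 (.reg 8 * .reg 6 * 4)
    (.assign 21 (.reg 13 / 2) ;; .assign 22 (.reg 13 / 4 / .reg 6) ;;
      .assign 23 (.reg 13 / 4 - .reg 22 * .reg 6) ;; .assign 24 (.reg 21 - .reg 13 / 4 * 2) ;;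
      .assign 25 (.cell 15 (.reg 22)) ;;
      .assign 26 (((.reg 22 + 1) * .reg 6 + setBitExpr (.reg 25) (.reg 23) (.reg 24)) * 2 +
        (.reg 13 - .reg 21 * 2)) ;;
      emit (.reg 21) (.reg 26) ;; emit (.reg 9 + .reg 26) (.reg 9 + .reg 21))

theorem runs_netProg (hb : Bounds n m L H Z) (h : Env n m L H s) (hp : PowTable L s)
    (h4 : s.reg 4 = 0) :
    Runs Z keys netProg s (L * 2 * 2 ^ L * 4 * 120 + 20) (fun s' =>
      s'.reg 4 = L * 2 * 2 ^ L * 8 ∧ ∀ u v, EdgeIn s' u v ↔ ∃ t p b b', t < L * 2 ∧ p < 2 ^ L ∧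
        b < 2 ∧ b' < 2 ∧ ((u = node (2 ^ L) t p b ∧
            v = node (2 ^ L) (t + 1) (setBit (2 ^ layerBit L t) p b) b') ∨
          (u = half L (2 ^ L) + node (2 ^ L) (t + 1) (setBit (2 ^ layerBit L t) p b) b' ∧
            v = half L (2 ^ L) + node (2 ^ L) t p b))) := by
  have hlit := hb.lit
  have hv := hb.verts₁_lt
  have he := hb.edges
  have hM : 0 < 2 ^ L := by positivity
  have hl := layers_eq (L := L)
  -- The counter is `x = node t p b * 2 + b'`, so its quotient by `2` is already the number of the
  -- source vertex, and the four parameters are its digits.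
  let src : ℕ → ℕ := fun x => node (2 ^ L) (x / 4 / 2 ^ L) (x / 4 % 2 ^ L) (x / 2 % 2)
  let tgt : ℕ → ℕ := fun x => node (2 ^ L) (x / 4 / 2 ^ L + 1)
    (setBit (2 ^ layerBit L (x / 4 / 2 ^ L)) (x / 4 % 2 ^ L) (x / 2 % 2)) (x % 2)
  have ht : ∀ x, x < L * 2 * 2 ^ L * 4 → x / 4 / 2 ^ L < L * 2 := fun x hx =>
    (Nat.div_lt_iff_lt_mul hM).2 (by omega)
  have hp' : ∀ x, x / 4 % 2 ^ L < 2 ^ L := fun x => Nat.mod_lt _ hM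
  have hset : ∀ t p b, t < L * 2 → p < 2 ^ L → b < 2 →
      setBit (2 ^ layerBit L t) p b < 2 ^ L := fun t p b ht hp hb =>
    setBit_lt (by positivity) (two_pow_layerBit_dvd ht) hb hp
  refine Runs.forUp (L * 2 * 2 ^ L * 4) 100 (fun j s' => s'.reg 4 = j * 2 ∧
    ∀ u v, EdgeIn s' u v ↔ ∃ x < j, (u = src x ∧ v = tgt x) ∨
      (u = half L (2 ^ L) + tgt x ∧ v = half L (2 ^ L) + src x))
    rfl rfl (by omega) (by simp [Expr.cost]; omega) (fun s' hf => ?_) ⟨by simp [h4], ?_⟩ ?_ ?_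
  · simp [hf.reg 8 rfl, hf.reg 6 rfl, h.r8, h.r6]
  · simp [EdgeIn, h4]
  · rintro x s' hx hs' hf hxr ⟨h4', hI⟩
    have h6 : s'.reg 6 = 2 ^ L := (hf.reg 6 rfl).trans h.r6
    have h9 : s'.reg 9 = half L (2 ^ L) := (hf.reg 9 rfl).trans h.r9
    have h15 := hp.frame hf rfl _ (ht x hx)
    have hsrc : x / 2 = src x := by
      have := Nat.div_add_mod' (x / 4) (2 ^ L)
      simp only [src, node]
      omega
    have hsl : src x < half L (2 ^ L) := node_lt_half (ht x hx).le (hp' x) (by omega)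
    have htl : tgt x < half L (2 ^ L) :=
      node_lt_half (ht x hx) (hset _ _ _ (ht x hx) (hp' x) (by omega)) (by omega)
    have htx := ht x hx
    have hpx := hp' x
    have hlv := hb.levels_lt
    have hsz := hb.size_lt
    have hpw : 2 ^ layerBit L (x / 4 / 2 ^ L) < Z := by rw [← h15]; exact hs'.arr _ _
    refine Runs.assign_seq (v := src x) rfl (by simp [hxr, hsrc]) (by omega) (by decide) ?_
    refine Runs.assign_seq (v := x / 4 / 2 ^ L) rfl (by simp [hxr, h6]) (by omega) (by decide) ?_
    refine Runs.assign_seq (v := x / 4 % 2 ^ L) rfl ?_ (by omega) (by decide) ?_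
    · simp only [Expr.eval_sub, Expr.eval_div, Expr.eval_reg, Memory.setReg_reg, Nat.reduceEqDiff,
        if_false, if_true, hxr, h6, Expr.eval_ofNat, Expr.eval_mul]
      have := Nat.div_add_mod' (x / 4) (2 ^ L)
      omega
    refine Runs.assign_seq (v := x / 2 % 2) rfl (by simp [hxr, ← hsrc]; omega) (by omega)
      (by decide) ?_
    refine Runs.assign_seq (v := 2 ^ layerBit L (x / 4 / 2 ^ L)) rfl (by simp [h15]) hpw
      (by decide) ?_
    refine Runs.assign_seq (v := tgt x) rfl
      (by simp [eval_setBitExpr, hxr, h6, tgt, node, ← hsrc]; omega) (by omega) (by decide) ?_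
    refine Runs.seq 12 14 (runs_emit (u := src x) (v := tgt x) rfl rfl (by simp) (by simp) (by omega)
      (by omega) (by simp [h4']; omega) (by decide)) ?_ (by decide)
    rintro s₁ hs₁ hf₁ ⟨h41, hE₁⟩
    have h9₁ : s₁.reg 9 = half L (2 ^ L) := by simp [hf₁.reg 9 rfl, h9]
    have h21 : s₁.reg 21 = src x := by simp [hf₁.reg 21 rfl]
    have h26 : s₁.reg 26 = tgt x := by simp [hf₁.reg 26 rfl]
    simp only [Memory.setReg_reg, Nat.reduceEqDiff, if_false, h4'] at h41
    refine Runs.weaken (runs_emit (T := 14) (u := half L (2 ^ L) + tgt x)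
      (v := half L (2 ^ L) + src x) rfl rfl (by simp [h9₁, h26]) (by simp [h9₁, h21])
      (by omega) (by omega) (by omega) (by decide)) le_rfl ?_
    rintro s₂ - - ⟨h42, hE₂⟩
    refine ⟨by simp [h42, h41]; ring, fun u v => ?_⟩
    change EdgeIn s₂ u v ↔ _
    rw [hE₂, hE₁]
    change ((EdgeIn s' u v) ∨ _) ∨ _ ↔ _
    rw [hI, Nat.exists_lt_succ_right]
    simp only [or_assoc]
  · rintro s' hs' hf ⟨h4', hI⟩
    refine ⟨by omega, fun u v => ?_⟩
    rw [hI]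
    constructor
    · rintro ⟨x, hx, h⟩
      exact ⟨_, _, _, _, ht x hx, hp' x, Nat.mod_lt _ (by norm_num), Nat.mod_lt _ (by norm_num), h⟩
    · rintro ⟨t, p, b, b', ht, hp, hb, hb', h⟩
      have hx2 : (node (2 ^ L) t p b * 2 + b') / 2 = node (2 ^ L) t p b := by omega
      have hx4 : (node (2 ^ L) t p b * 2 + b') / 4 = node (2 ^ L) t p b / 2 := by omega
      have hlt : node (2 ^ L) t p b < L * 2 * 2 ^ L * 2 := by
        have : (t + 1) * 2 ^ L ≤ L * 2 * 2 ^ L := Nat.mul_le_mul_right _ ht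
        rw [Nat.succ_mul] at this
        unfold node; omega
      refine ⟨node (2 ^ L) t p b * 2 + b', by omega, ?_⟩
      simp only [src, tgt, hx4, hx2, node_div hp hb, node_mod hp hb]
      rw [show node (2 ^ L) t p b % 2 = b by unfold node; omega,
        show (node (2 ^ L) t p b * 2 + b') % 2 = b' by omega]
      exact h

/-- Writes the edges along the order of the ranks. -/
def lineProg : Prog :=
  forUp 13 (.reg 6)
    (.assign 21 ((.reg 8 * .reg 6 + .reg 13) * 2) ;; emit (.reg 21) (.reg 9 + .reg 21) ;;
      emit (.reg 9 + .reg 21) (.reg 9 + .reg 21 + 2))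

theorem runs_lineProg (hb : Bounds n m L H Z) (h : Env n m L H s)
    (h4 : s.reg 4 = L * 2 * 2 ^ L * 8) :
    Runs Z keys lineProg s (2 ^ L * 80 + 20) (fun s' =>
      s'.reg 4 = L * 2 * 2 ^ L * 8 + 2 ^ L * 2 ∧ ∀ u v, EdgeIn s' u v ↔ EdgeIn s u v ∨
        ∃ q < 2 ^ L, (u = node (2 ^ L) (L * 2) q 0 ∧
            v = half L (2 ^ L) + node (2 ^ L) (L * 2) q 0) ∨
          (u = half L (2 ^ L) + node (2 ^ L) (L * 2) q 0 ∧
            v = half L (2 ^ L) + node (2 ^ L) (L * 2) q 0 + 2)) := by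
  have hlit := hb.lit
  have hv := hb.verts₁_lt
  have he := hb.edges
  have hl := layers_eq (L := L)
  refine Runs.forUp (2 ^ L) 70 (fun j s' => s'.reg 4 = L * 2 * 2 ^ L * 8 + j * 2 ∧
    ∀ u v, EdgeIn s' u v ↔ EdgeIn s u v ∨ ∃ q < j, (u = node (2 ^ L) (L * 2) q 0 ∧
            v = half L (2 ^ L) + node (2 ^ L) (L * 2) q 0) ∨
          (u = half L (2 ^ L) + node (2 ^ L) (L * 2) q 0 ∧
            v = half L (2 ^ L) + node (2 ^ L) (L * 2) q 0 + 2))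
    rfl rfl (by omega) (by simp [Expr.cost]; omega) (fun s' hf => ?_) ⟨by simp [h4], ?_⟩ ?_ ?_
  · simp [hf.reg 6 rfl, h.r6]
  · simp [EdgeIn]
  · rintro q s' hq hs' hf hxr ⟨h4', hI⟩
    have h6 : s'.reg 6 = 2 ^ L := (hf.reg 6 rfl).trans h.r6
    have h8 : s'.reg 8 = L * 2 := (hf.reg 8 rfl).trans h.r8
    have h9 : s'.reg 9 = half L (2 ^ L) := (hf.reg 9 rfl).trans h.r9
    have hlt : node (2 ^ L) (L * 2) q 0 < half L (2 ^ L) := node_lt_half le_rfl hq (by norm_num)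
    refine Runs.assign_seq (v := node (2 ^ L) (L * 2) q 0) rfl (by simp [node, h6, h8, hxr])
      (by omega) (by decide) ?_
    refine Runs.seq 14 20 (runs_emit (u := node (2 ^ L) (L * 2) q 0)
      (v := half L (2 ^ L) + node (2 ^ L) (L * 2) q 0) rfl rfl (by simp) (by simp [h9])
      (by omega) (by omega) (by simp [h4']; omega) (by decide)) ?_ (by decide)
    rintro s₁ hs₁ hf₁ ⟨h41, hE₁⟩
    have h9₁ : s₁.reg 9 = half L (2 ^ L) := by simp [hf₁.reg 9 rfl, h9]
    have h21 : s₁.reg 21 = node (2 ^ L) (L * 2) q 0 := by simp [hf₁.reg 21 rfl]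
    simp only [Memory.setReg_reg, Nat.reduceEqDiff, if_false, h4'] at h41
    refine Runs.weaken (runs_emit (T := 20) (u := half L (2 ^ L) + node (2 ^ L) (L * 2) q 0)
      (v := half L (2 ^ L) + node (2 ^ L) (L * 2) q 0 + 2) rfl rfl (by simp [h9₁, h21])
      (by simp [h9₁, h21]) (by omega) (by omega) (by omega) (by decide)) le_rfl ?_
    rintro s₂ - - ⟨h42, hE₂⟩
    refine ⟨by simp [h42, h41]; ring, fun u v => ?_⟩
    change EdgeIn s₂ u v ↔ _
    rw [hE₂, hE₁]
    change ((EdgeIn s' u v) ∨ _) ∨ _ ↔ _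
    rw [hI, Nat.exists_lt_succ_right]
    simp only [or_assoc]
  · exact fun s' _ _ h => h

/-- Writes the edges that belong to the boolean matrix. -/
def matrixProg : Prog :=
  forUp 13 (.reg 1 * .reg 1 * 4)
    (.ite (.cell 0 (.reg 13 / 4))
      (.assign 21 (.reg 13 / 4 / .reg 1) ;; .assign 22 (.reg 13 / 4 - .reg 21 * .reg 1) ;;
        .assign 23 (.reg 13 / 2 - .reg 13 / 4 * 2) ;;
        emit (.reg 9 + .reg 21 * 2 + .reg 23)
          ((.reg 7 + .reg 22) * 2 + (.reg 13 - .reg 13 / 2 * 2)))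
      .skip)

theorem runs_matrixProg {E : ℕ} (hb : Bounds n m L H Z) (h : Env n m L H s)
    (h4 : s.reg 4 = E) (hE : E ≤ half L (2 ^ L) * 4) :
    Runs Z keys matrixProg s (m * m * 4 * 90 + 20) (fun s' => s'.reg 4 ≤ E + m * m * 4 ∧
      ∀ u v, EdgeIn s' u v ↔ EdgeIn s u v ∨ ∃ k j b b', k < m ∧ j < m ∧ b < 2 ∧ b' < 2 ∧
        s.arr 0 (j + m * k) ≠ 0 ∧ u = half L (2 ^ L) + node (2 ^ L) 0 k b ∧
        v = node (2 ^ L) 0 (H + j) b') := by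
  have hlit := hb.lit
  have hv := hb.verts₁_lt
  have he := hb.edges
  have h2 := hb.two
  have hlt := hb.lt
  have hl := layers_eq (L := L)
  refine Runs.forUp (m * m * 4) 70 (fun i s' => s'.reg 4 ≤ E + i ∧
    ∀ u v, EdgeIn s' u v ↔ EdgeIn s u v ∨ ∃ x < i, s.arr 0 (x / 4) ≠ 0 ∧
      u = half L (2 ^ L) + node (2 ^ L) 0 (x / 4 / m) (x / 2 % 2) ∧
      v = node (2 ^ L) 0 (H + x / 4 % m) (x % 2))
    rfl rfl (by omega) (by simp [Expr.cost]; omega) (fun s' hf => ?_) ⟨by simp [h4], ?_⟩ ?_ ?_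
  · simp [hf.reg 1 rfl, h.r1]
  · simp [EdgeIn]
  · rintro x s' hx hs' hf hxr ⟨h4', hI⟩
    have h1 : s'.reg 1 = m := (hf.reg 1 rfl).trans h.r1
    have h7 : s'.reg 7 = H := (hf.reg 7 rfl).trans h.r7
    have h9 : s'.reg 9 = half L (2 ^ L) := (hf.reg 9 rfl).trans h.r9
    have h0 : s'.arr 0 = s.arr 0 := hf.arr 0 rfl
    have hm : 0 < m := Nat.pos_of_ne_zero (by rintro rfl; omega)
    have hk : x / 4 / m < m := (Nat.div_lt_iff_lt_mul hm).2 (by omega)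
    have hj : x / 4 % m < m := Nat.mod_lt _ hm
    have hnk : node (2 ^ L) 0 (x / 4 / m) (x / 2 % 2) < half L (2 ^ L) :=
      node_lt_half (Nat.zero_le _) (by omega) (by omega)
    have hnj : node (2 ^ L) 0 (H + x / 4 % m) (x % 2) < half L (2 ^ L) :=
      node_lt_half (Nat.zero_le _) (by omega) (by omega)
    refine Runs.ite rfl (by decide) (fun hc => ?_) (fun hc => ?_)
    · simp only [Expr.eval_cell, Expr.eval_div, Expr.eval_reg, hxr, Expr.eval_ofNat, h0] at hc
      refine Runs.assign_seq (v := x / 4 / m) rfl (by simp [hxr, h1]) (by omega) (by decide) ?_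
      refine Runs.assign_seq (v := x / 4 % m) rfl ?_ (by omega) (by decide) ?_
      · simp only [Expr.eval_sub, Expr.eval_div, Expr.eval_reg, Memory.setReg_reg,
          Nat.reduceEqDiff, if_false, if_true, hxr, h1, Expr.eval_ofNat, Expr.eval_mul]
        have := Nat.div_add_mod' (x / 4) m
        omega
      refine Runs.assign_seq (v := x / 2 % 2) rfl (by simp [hxr]; omega) (by omega) (by decide) ?_
      refine Runs.weaken (runs_emit (T := 40) (u := half L (2 ^ L) +
        node (2 ^ L) 0 (x / 4 / m) (x / 2 % 2)) (v := node (2 ^ L) 0 (H + x / 4 % m) (x % 2))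
        rfl rfl (by simp [h9, node]; ring) (by simp [h7, hxr, node]; omega) (by omega) (by omega)
        (by simp; omega) (by decide)) (by decide) ?_
      rintro s₂ - - ⟨h42, hE₂⟩
      simp only [Memory.setReg_reg, Nat.reduceEqDiff, if_false] at h42
      refine ⟨by simp [h42]; omega, fun u v => ?_⟩
      change EdgeIn s₂ u v ↔ _
      rw [hE₂]
      change (EdgeIn s' u v) ∨ _ ↔ _
      rw [hI, Nat.exists_lt_succ_right]
      simp only [or_assoc, hc, ne_eq, not_false_eq_true, true_and]
    · simp only [Expr.eval_cell, Expr.eval_div, Expr.eval_reg, hxr, Expr.eval_ofNat, h0] at hc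
      refine Runs.skip (by decide) ⟨by simp; omega, fun u v => ?_⟩
      change EdgeIn s' u v ↔ _
      rw [hI, Nat.exists_lt_succ_right]
      simp only [hc, ne_eq, not_true_eq_false, false_and, or_false]
  · rintro s' hs' hf ⟨h4', hI⟩
    refine ⟨h4', fun u v => ?_⟩
    rw [hI]
    refine or_congr Iff.rfl ?_
    constructor
    · rintro ⟨x, hx, h0, hu, hv⟩
      have hm : 0 < m := Nat.pos_of_ne_zero (by rintro rfl; omega)
      refine ⟨x / 4 / m, x / 4 % m, _, _, (Nat.div_lt_iff_lt_mul hm).2 (by omega),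
        Nat.mod_lt _ hm, Nat.mod_lt _ (by norm_num), Nat.mod_lt _ (by norm_num), ?_, hu, hv⟩
      rwa [Nat.mod_add_div]
    · rintro ⟨k, j, b, b', hk, hj, hb, hb', h0, hu, hv⟩
      -- The counter has the digits `k`, `j`, `b`, `b'`; its quotient by `4` is the address of the
      -- matrix entry.
      have h4 : ((m * k + j) * 4 + b * 2 + b') / 4 = m * k + j := by omega
      have hlt : m * k + j < m * m := by
        have : m * (k + 1) ≤ m * m := Nat.mul_le_mul_left _ hk
        rw [Nat.mul_succ] at this
        omega
      refine ⟨(m * k + j) * 4 + b * 2 + b', by omega, ?_⟩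
      rw [h4, Nat.mul_add_div (by omega), Nat.div_eq_of_lt hj, Nat.mul_add_mod,
        Nat.mod_eq_of_lt hj, show ((m * k + j) * 4 + b * 2 + b') / 2 % 2 = b by omega,
        show ((m * k + j) * 4 + b * 2 + b') % 2 = b' by omega]
      exact ⟨by rwa [add_comm], hu, hv⟩

/-- Marks all configurations as won by Alice. -/
def fillProg : Prog :=
  forUp 13 (.reg 0 * .reg 2)
    (.store 5 (.reg 13) 1 ;; .store 6 (.reg 13) 1 ;; .store 7 (.reg 13) 1 ;;
      .store 8 (.reg 13) 1 ;; .store 9 (.reg 13) 1 ;; .store 10 (.reg 13) 1)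

theorem runs_fillProg (hb : Bounds n m L H Z) (h : Env n m L H s) :
    Runs Z keys fillProg s (n * (half L (2 ^ L) * 2 + 1) * 50 + 20) (fun s' =>
      ∀ a, 5 ≤ a → a ≤ 10 → ∀ x < n * (half L (2 ^ L) * 2 + 1), s'.arr a x = 1) := by
  have hlit := hb.lit
  have hc := hb.cells
  rw [Nat.succ_mul] at hc
  refine Runs.forUp (n * (half L (2 ^ L) * 2 + 1)) 30
    (fun j s' => ∀ a, 5 ≤ a → a ≤ 10 → ∀ x < j, s'.arr a x = 1)
    rfl rfl (by omega) (by simp [Expr.cost]; omega) (fun s' hf => ?_) (by simp) ?_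
    (fun s' _ _ h => h)
  · simp [hf.reg 0 rfl, hf.reg 2 rfl, h.r0, h.r2]
  · rintro j s' hj - hf hx hI
    refine Runs.store_seq (i := j) (v := 1) rfl rfl (by simp [hx]) (by simp) (by omega) (by decide) ?_
    refine Runs.store_seq (i := j) (v := 1) rfl rfl (by simp [hx]) (by simp) (by omega) (by decide) ?_
    refine Runs.store_seq (i := j) (v := 1) rfl rfl (by simp [hx]) (by simp) (by omega) (by decide) ?_
    refine Runs.store_seq (i := j) (v := 1) rfl rfl (by simp [hx]) (by simp) (by omega) (by decide) ?_
    refine Runs.store_seq (i := j) (v := 1) rfl rfl (by simp [hx]) (by simp) (by omega) (by decide) ?_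
    refine Runs.store (i := j) (v := 1) rfl rfl (by simp [hx]) (by simp) (by omega) (by decide) ?_
    intro a ha ha' x hx'
    by_cases h1 : x = j
    · interval_cases a <;> simp [h1]
    · have := hI a ha ha' x (by omega)
      interval_cases a <;> simpa [h1] using this

end Programs
end TwoTokens

namespace TwoTokens

/-! ## Sorting the elements of a row -/

section Merge

variable {K : Type*} [LinearOrder K]

/-- Element `e` has the smaller key, or the same key and the smaller index. -/
def Before (κ : ℕ → K) (e f : ℕ) : Prop := κ e < κ f ∨ κ e = κ f ∧ e < f

variable {κ : ℕ → K} {e f g : ℕ}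

theorem Before.trans (h : Before κ e f) (h' : Before κ f g) : Before κ e g := by
  rcases h with h | ⟨h, hlt⟩ <;> rcases h' with h' | ⟨h', hlt'⟩
  · exact Or.inl (h.trans h')
  · exact Or.inl (h' ▸ h)
  · exact Or.inl (h ▸ h')
  · exact Or.inr ⟨h.trans h', hlt.trans hlt'⟩

theorem Before.irrefl : ¬ Before κ e e := by
  rintro (h | ⟨-, h⟩) <;> exact lt_irrefl _ h

theorem before_of_le (h : κ e ≤ κ f) (hlt : e < f) : Before κ e f := by
  rcases h.lt_or_eq with h | h
  exacts [Or.inl h, Or.inr ⟨h, hlt⟩]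

/-- The first `j` entries of `ord` respect blocks of width `W` and are sorted within blocks. -/
structure SortedBlocks (κ : ℕ → K) (W j : ℕ) (ord : ℕ → ℕ) : Prop where
  block : ∀ q < j, ord q / W = q / W
  sorted : ∀ q q', q < q' → q' < j → q / W = q' / W → Before κ (ord q) (ord q')

/-- The cursors of the merge of the two halves of block `c`, when the next entry is `j`. -/
structure MergeCursor (κ : ℕ → K) (ord tmp : ℕ → ℕ) (W c j a b : ℕ) : Prop where
  le_a : c * (W * 2) ≤ a
  a_le : a ≤ c * (W * 2) + W
  le_b : c * (W * 2) + W ≤ b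
  b_le : b ≤ c * (W * 2) + W * 2
  sum : a + b = j + c * (W * 2) + W
  left : ∀ q < j, c * (W * 2) ≤ q → ∀ x, a ≤ x → x < c * (W * 2) + W → Before κ (tmp q) (ord x)
  right : ∀ q < j, c * (W * 2) ≤ q → ∀ x, b ≤ x → x < c * (W * 2) + W * 2 →
    Before κ (tmp q) (ord x)

variable {ord tmp : ℕ → ℕ} {W c j a b M : ℕ}

theorem SortedBlocks.congr {ord' : ℕ → ℕ} (h : SortedBlocks κ W j ord)
    (h' : ∀ q < j, ord' q = ord q) : SortedBlocks κ W j ord' :=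
  ⟨fun q hq => by rw [h' q hq, h.block q hq],
    fun q q' hlt hq' hb => by rw [h' q (by omega), h' q' hq']; exact h.sorted q q' hlt hq' hb⟩

theorem SortedBlocks.push (h : SortedBlocks κ W j tmp) {x : ℕ} (hx : x / W = j / W)
    (hlt : ∀ q < j, q / W = j / W → Before κ (tmp q) x) :
    SortedBlocks κ W (j + 1) (Function.update tmp j x) := by
  constructor
  · intro q hq
    by_cases hqj : q = j
    · subst hqj; simpa using hx
    · rw [Function.update_of_ne hqj, h.block q (by omega)]
  · intro q q' hq hq' hb
    rw [Function.update_of_ne (by omega)]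
    by_cases hqj : q' = j
    · subst hqj
      simpa using hlt q hq hb
    · rw [Function.update_of_ne hqj]
      exact h.sorted q q' hq (by omega) hb

theorem div_eq_left {q : ℕ} (h : c * (W * 2) ≤ q) (h' : q < c * (W * 2) + W) :
    q / W = c * 2 := by
  refine Nat.div_eq_of_lt_le ?_ ?_
  · rwa [mul_assoc, mul_comm 2 W]
  · rwa [Nat.succ_mul, mul_assoc, mul_comm 2 W]

theorem div_eq_right {q : ℕ} (h : c * (W * 2) + W ≤ q)
    (h' : q < c * (W * 2) + W * 2) : q / W = c * 2 + 1 := by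
  refine Nat.div_eq_of_lt_le ?_ ?_
  · rwa [Nat.succ_mul, mul_assoc, mul_comm 2 W]
  · rwa [Nat.succ_mul, Nat.succ_mul, mul_assoc, mul_comm 2 W, add_assoc, ← mul_two]

theorem MergeCursor.init (hj : j = c * (W * 2)) :
    MergeCursor κ ord tmp W c j j (j + W) where
  le_a := hj.ge
  a_le := by omega
  le_b := by omega
  b_le := by omega
  sum := by omega
  left := fun q hq hq' => by omega
  right := fun q hq hq' => by omega

/-- The element under the left cursor precedes everything left in its own half by sortedness. For
the right half a weak inequality of keys suffices: elements stay within their blocks, so the left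
one has the smaller index and wins ties. -/
theorem MergeCursor.push_left (hW : 0 < W) (hs : SortedBlocks κ W M ord)
    (ht : SortedBlocks κ (W * 2) j tmp) (h : MergeCursor κ ord tmp W c j a b)
    (hM : c * (W * 2) + W * 2 ≤ M) (ha : a < c * (W * 2) + W)
    (hcond : c * (W * 2) + W * 2 ≤ b ∨ κ (ord a) ≤ κ (ord b)) :
    SortedBlocks κ (W * 2) (j + 1) (Function.update tmp j (ord a)) ∧
      MergeCursor κ ord (Function.update tmp j (ord a)) W c (j + 1) (a + 1) b := by
  obtain ⟨h1, h2, h3, h4, h5, h6, h7⟩ := h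
  have hda := div_eq_left h1 ha
  have hjc : j / (W * 2) = c := Nat.div_eq_of_lt_le (by omega) (by rw [Nat.succ_mul]; omega)
  have hcross : ∀ x, b ≤ x → x < c * (W * 2) + W * 2 → Before κ (ord a) (ord x) := by
    intro x hx hx'
    have hdb := div_eq_right h3 (lt_of_le_of_lt hx hx')
    have hlt : ord a < ord b := by
      have e1 := hs.block a (by omega)
      have e2 := hs.block b (by omega)
      by_contra hcon
      have := Nat.div_le_div_right (c := W) (not_lt.1 hcon)
      omega
    have hab := before_of_le (hcond.resolve_left (by omega)) hlt
    rcases hx.lt_or_eq with hx | rfl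
    · exact hab.trans (hs.sorted _ _ hx (by omega)
        (by rw [hdb, div_eq_right (by omega) hx']))
    · exact hab
  refine ⟨ht.push ?_ ?_, ⟨by omega, by omega, h3, h4, by omega, ?_, ?_⟩⟩
  · rw [← Nat.div_div_eq_div_mul, hs.block a (by omega), hda, hjc]
    omega
  · intro q hq hqj
    rw [hjc] at hqj
    refine h6 q hq ?_ a le_rfl ha
    rw [← hqj]
    exact Nat.div_mul_le_self q _
  · intro q hq hq' x hx hx'
    by_cases hqj : q = j
    · subst hqj
      rw [Function.update_self]
      exact hs.sorted _ _ hx (by omega) (by rw [hda, div_eq_left (by omega) hx'])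
    · rw [Function.update_of_ne hqj]
      exact h6 q (by omega) hq' x (by omega) hx'
  · intro q hq hq' x hx hx'
    by_cases hqj : q = j
    · subst hqj
      rw [Function.update_self]
      exact hcross x hx hx'
    · rw [Function.update_of_ne hqj]
      exact h7 q (by omega) hq' x (by omega) hx'

/-- Here the key has to be strictly smaller, since the element on the right has the larger index and
loses ties. -/
theorem MergeCursor.push_right (hs : SortedBlocks κ W M ord)
    (ht : SortedBlocks κ (W * 2) j tmp) (h : MergeCursor κ ord tmp W c j a b)
    (hM : c * (W * 2) + W * 2 ≤ M) (hb : b < c * (W * 2) + W * 2)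
    (hcond : c * (W * 2) + W ≤ a ∨ κ (ord b) < κ (ord a)) :
    SortedBlocks κ (W * 2) (j + 1) (Function.update tmp j (ord b)) ∧
      MergeCursor κ ord (Function.update tmp j (ord b)) W c (j + 1) a (b + 1) := by
  obtain ⟨h1, h2, h3, h4, h5, h6, h7⟩ := h
  have hdb := div_eq_right h3 hb
  have hjc : j / (W * 2) = c := Nat.div_eq_of_lt_le (by omega) (by rw [Nat.succ_mul]; omega)
  have hcross : ∀ x, a ≤ x → x < c * (W * 2) + W → Before κ (ord b) (ord x) := by
    intro x hx hx'
    have hda := div_eq_left h1 (lt_of_le_of_lt hx hx')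
    have hab : Before κ (ord b) (ord a) := Or.inl (hcond.resolve_left (by omega))
    rcases hx.lt_or_eq with hx | rfl
    · exact hab.trans (hs.sorted _ _ hx (by omega)
        (by rw [hda, div_eq_left (by omega) hx']))
    · exact hab
  refine ⟨ht.push ?_ ?_, ⟨h1, h2, by omega, by omega, by omega, ?_, ?_⟩⟩
  · rw [← Nat.div_div_eq_div_mul, hs.block b (by omega), hdb, hjc]
    omega
  · intro q hq hqj
    rw [hjc] at hqj
    refine h7 q hq ?_ b le_rfl hb
    rw [← hqj]
    exact Nat.div_mul_le_self q _
  · intro q hq hq' x hx hx'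
    by_cases hqj : q = j
    · subst hqj
      rw [Function.update_self]
      exact hcross x hx hx'
    · rw [Function.update_of_ne hqj]
      exact h6 q (by omega) hq' x (by omega) hx'
  · intro q hq hq' x hx hx'
    by_cases hqj : q = j
    · subst hqj
      rw [Function.update_self]
      exact hs.sorted _ _ hx (by omega) (by rw [hdb, div_eq_right (by omega) hx'])
    · rw [Function.update_of_ne hqj]
      exact h7 q (by omega) hq' x (by omega) hx'

end Merge

/-! ### Merge sort on the machine -/

section Programs

variable {K : Type*} [LinearOrder K] {Z : ℕ} {keys : ℕ → K} {n m L H : ℕ} {s : Memory}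

/-- Merges neighbouring blocks, whose width is in register 16, from array 17 to array 22. -/
def mergeProg : Prog :=
  forUp 13 (.reg 6)
    (.assign 19 (.reg 13 / (.reg 16 * 2) * (.reg 16 * 2)) ;;
      .ite (.reg 13 - .reg 19) .skip (.assign 17 (.reg 13) ;; .assign 18 (.reg 13 + .reg 16)) ;;
      .ite ((.reg 19 + .reg 16 - .reg 17) *
          (.keyLe (.cell 16 (.cell 17 (.reg 17))) (.cell 16 (.cell 17 (.reg 18))) +
            (.reg 18 + 1 - (.reg 19 + .reg 16 * 2))))
        (.store 22 (.reg 13) (.cell 17 (.reg 17)) ;; .assign 17 (.reg 17 + 1))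
        (.store 22 (.reg 13) (.cell 17 (.reg 18)) ;; .assign 18 (.reg 18 + 1)))

theorem runs_mergeProg {W : ℕ} {κ : ℕ → K} (hb : Bounds n m L H Z) (h : Env n m L H s) (hW : 0 < W)
    (hWM : W * 2 ∣ 2 ^ L) (h16 : s.reg 16 = W) (hκ : ∀ e, κ e = keys (s.arr 16 e))
    (hs : SortedBlocks κ W (2 ^ L) (s.arr 17)) :
    Runs Z keys mergeProg s (2 ^ L * 90 + 20)
      (fun s' => SortedBlocks κ (W * 2) (2 ^ L) (s'.arr 22)) := by
  have hsz := hb.size_lt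
  -- The cursors are constrained only strictly inside a block of width `2W`; at the start of a block
  -- the program resets them.
  refine Runs.forUp (2 ^ L) 80 (fun j s' => SortedBlocks κ (W * 2) j (s'.arr 22) ∧
    (j % (W * 2) ≠ 0 → MergeCursor κ (s.arr 17) (s'.arr 22) W (j / (W * 2)) j
      (s'.reg 17) (s'.reg 18)))
    rfl rfl (by omega) (by simp [Expr.cost]; omega) (fun s' hf => ?_) ⟨⟨by simp, by simp⟩, by simp⟩
    ?_ (fun s' _ _ h => h.1)
  · simp [hf.reg 6 rfl, h.r6]
  rintro j s' hj hs' hf hx ⟨hS, hC⟩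
  have h16' : s'.reg 16 = W := (hf.reg 16 rfl).trans h16
  have ha16 : s'.arr 16 = s.arr 16 := hf.arr 16 rfl
  have ha17 : s'.arr 17 = s.arr 17 := hf.arr 17 rfl
  have hdm := Nat.div_add_mod' j (W * 2)
  have hmod := Nat.mod_lt j (show 0 < W * 2 by omega)
  set c := j / (W * 2) with hc
  have hcM : c * (W * 2) + W * 2 ≤ 2 ^ L := by
    obtain ⟨d, hd⟩ := hWM
    have : c < d := Nat.div_lt_of_lt_mul (by omega)
    have := Nat.mul_le_mul_right (W * 2) this
    rw [Nat.succ_mul] at this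
    rw [hd, mul_comm (W * 2) d]
    exact this
  refine Runs.assign_seq (v := c * (W * 2)) rfl (by simp [hx, h16', hc]) (by omega) (by decide) ?_
  -- The merge step after the optional reset of the cursors, for both cases at once. The test is a
  -- product: the left half is not exhausted, and either its key is at most the right one or the
  -- right half is exhausted.
  have main : ∀ (a b T : ℕ) (s₁ : Memory), 50 ≤ T → s₁.reg 13 = j → s₁.reg 16 = W →
      s₁.reg 17 = a → s₁.reg 18 = b → s₁.reg 19 = c * (W * 2) → s₁.arr = s'.arr →
      MergeCursor κ (s.arr 17) (s'.arr 22) W c j a b →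
      Runs Z keys (.ite ((.reg 19 + .reg 16 - .reg 17) *
          (.keyLe (.cell 16 (.cell 17 (.reg 17))) (.cell 16 (.cell 17 (.reg 18))) +
            (.reg 18 + 1 - (.reg 19 + .reg 16 * 2))))
        (.store 22 (.reg 13) (.cell 17 (.reg 17)) ;; .assign 17 (.reg 17 + 1))
        (.store 22 (.reg 13) (.cell 17 (.reg 18)) ;; .assign 18 (.reg 18 + 1))) s₁ T
        (fun s'' => SortedBlocks κ (W * 2) (j + 1) ((s''.setReg 13 (j + 1)).arr 22) ∧
          ((j + 1) % (W * 2) ≠ 0 → MergeCursor κ (s.arr 17) ((s''.setReg 13 (j + 1)).arr 22) W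
            ((j + 1) / (W * 2)) (j + 1) ((s''.setReg 13 (j + 1)).reg 17)
            ((s''.setReg 13 (j + 1)).reg 18))) := by
    intro a b T s₁ hT h13 h16 h17 h18 h19 harr hcur
    have hdiv : (j + 1) % (W * 2) ≠ 0 → (j + 1) / (W * 2) = c := by
      intro hne
      have h1 := Nat.div_add_mod' (j + 1) (W * 2)
      rw [Nat.succ_div, if_neg (fun hd => hne (Nat.mod_eq_zero_of_dvd hd)), hc, add_zero]
    have ha := hcur.a_le
    have hb := hcur.b_le
    have hsum := hcur.sum
    refine Runs.ite rfl (le_trans (by decide) hT) (fun hcond => ?_) (fun hcond => ?_)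
    · simp only [Expr.eval_mul, Expr.eval_sub, Expr.eval_add, Expr.eval_reg, Expr.eval_keyLe,
        Expr.eval_cell, h16, h17, h18, h19, harr, ha17, ha16, ← hκ, Expr.eval_one,
        Expr.eval_ofNat] at hcond
      have hcond1 := left_ne_zero_of_mul hcond
      have hcond2 := right_ne_zero_of_mul hcond
      obtain ⟨hS', hC'⟩ := hcur.push_left hW hs hS hcM (by omega) (by
        by_cases hk : κ (s.arr 17 a) ≤ κ (s.arr 17 b)
        · exact Or.inr hk
        · rw [if_neg hk] at hcond2
          exact Or.inl (by omega))
      refine Runs.store_seq (i := j) (v := s.arr 17 a) rfl rfl (by simp [h13])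
        (by simp [h17, harr, ha17]) (by rw [← ha17]; exact hs'.arr _ _)
        (le_trans (by decide) (Nat.sub_le_sub_right hT _)) ?_
      refine Runs.assign (v := a + 1) rfl (by simp [h17]) (by omega)
        (le_trans (by decide) (Nat.sub_le_sub_right (Nat.sub_le_sub_right hT _) _)) ?_
      refine ⟨by simpa [harr] using hS', fun hne => ?_⟩
      rw [hdiv hne]
      simpa [harr, h18] using hC'
    · simp only [Expr.eval_mul, Expr.eval_sub, Expr.eval_add, Expr.eval_reg, Expr.eval_keyLe,
        Expr.eval_cell, h16, h17, h18, h19, harr, ha17, ha16, ← hκ, Expr.eval_one,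
        Expr.eval_ofNat, mul_eq_zero, Nat.add_eq_zero_iff] at hcond
      obtain ⟨hS', hC'⟩ := hcur.push_right hs hS hcM (by omega) (by
        rcases hcond with hcond | ⟨hcond, -⟩
        · exact Or.inl (by omega)
        · split_ifs at hcond with hk
          exact Or.inr (not_le.1 hk))
      refine Runs.store_seq (i := j) (v := s.arr 17 b) rfl rfl (by simp [h13])
        (by simp [h18, harr, ha17]) (by rw [← ha17]; exact hs'.arr _ _)
        (le_trans (by decide) (Nat.sub_le_sub_right hT _)) ?_
      refine Runs.assign (v := b + 1) rfl (by simp [h18]) (by omega)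
        (le_trans (by decide) (Nat.sub_le_sub_right (Nat.sub_le_sub_right hT _) _)) ?_
      refine ⟨by simpa [harr] using hS', fun hne => ?_⟩
      rw [hdiv hne]
      simpa [harr, h17] using hC'
  refine Runs.ite_seq rfl (by decide) (fun hcond => ?_) (fun hcond => ?_)
  · simp only [Expr.eval_sub, Expr.eval_reg, Memory.setReg_reg, Nat.reduceEqDiff, if_false,
      if_true, hx] at hcond
    refine Runs.skip_seq (by decide) ?_
    refine main (s'.reg 17) (s'.reg 18) _ _ (by decide) (by simp [hx]) (by simp [h16'])
      (by simp) (by simp) (by simp) (by simp) (hC (by omega))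
  · simp only [Expr.eval_sub, Expr.eval_reg, Memory.setReg_reg, Nat.reduceEqDiff, if_false,
      if_true, hx] at hcond
    refine Runs.seq_assoc ?_
    refine Runs.assign_seq (v := j) rfl (by simp [hx]) (by omega) (by decide) ?_
    refine Runs.assign_seq (v := j + W) rfl (by simp [hx, h16']) (by omega) (by decide) ?_
    exact main j (j + W) _ _ (by decide) (by simp [hx]) (by simp [h16'])
      (by simp) (by simp) (by simp) (by simp) (MergeCursor.init (by omega))

/-- Copies an array of the size of the network. -/
def copyProg (src dst : ℕ) : Prog := forUp 13 (.reg 6) (.store dst (.reg 13) (.cell src (.reg 13)))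

theorem runs_copyProg {src dst : ℕ} (hb : Bounds n m L H Z) (h : Env n m L H s)
    (hne : src ≠ dst) :
    Runs Z keys (copyProg src dst) s (2 ^ L * 15 + 20)
      (fun s' => ∀ x < 2 ^ L, s'.arr dst x = s.arr src x) := by
  have hsz := hb.size_lt
  refine Runs.forUp (2 ^ L) 5 (fun j s' => ∀ x < j, s'.arr dst x = s.arr src x)
    rfl rfl (by omega) (by simp [Expr.cost]; omega) (fun s' hf => ?_) (by simp) ?_
    (fun s' _ _ h => h)
  · simp [hf.reg 6 rfl, h.r6]
  · intro j s' hj hs' hf hx hI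
    have hsrc : s'.arr src = s.arr src := hf.arr src (by simp [forUp, Prog.setsArr, hne])
    refine Runs.store (i := j) (v := s.arr src j) rfl rfl (by simp [hx]) (by simp [hx, hsrc])
      (by rw [← hsrc]; exact hs'.arr _ _) (by simp [Expr.cost]) ?_
    intro x hx'
    by_cases hxj : x = j
    · simp [hxj]
    · simpa [hxj] using hI x (by omega)

/-- Sorts array 17 by the keys whose addresses are in array 16. -/
def sortProg : Prog :=
  .assign 16 1 ;; forUp 14 (.reg 5) (mergeProg ;; copyProg 22 17 ;; .assign 16 (.reg 16 * 2))

theorem runs_sortProg {κ : ℕ → K} (hb : Bounds n m L H Z) (h : Env n m L H s)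
    (hκ : ∀ e, κ e = keys (s.arr 16 e)) (hs : ∀ x < 2 ^ L, s.arr 17 x = x) :
    Runs Z keys sortProg s (L * (2 ^ L * 105 + 60) + 20)
      (fun s' => SortedBlocks κ (2 ^ L) (2 ^ L) (s'.arr 17)) := by
  have hlit := hb.lit
  have hlv := hb.levels_lt
  have hsz := hb.size_lt
  refine Runs.assign_seq (v := 1) rfl (by simp) (by omega) (by simp [Expr.cost]) ?_
  refine Runs.forUp L (2 ^ L * 105 + 50) (fun j s' => s'.reg 16 = 2 ^ j ∧
    SortedBlocks κ (2 ^ j) (2 ^ L) (s'.arr 17))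
    rfl rfl (by omega) (by simp [Expr.cost]; ring_nf; omega) (fun s' hf => ?_)
    -- At first every block is a single element and nothing has to be compared.
    ⟨by simp, ⟨fun q hq => by simp [hs q hq], fun q q' hlt _ hb => by simp at hb; omega⟩⟩ ?_
    (fun s' _ _ h => h.2)
  · simp [hf.reg 5 rfl, h.r5]
  rintro j s' hj hs' hf hx ⟨h16, hI⟩
  have hE : Env n m L H s' := by
    refine Env.frame (s := s.setReg 16 1) ?_ hf rfl
    constructor <;> simp [h.r0, h.r1, h.r2, h.r5, h.r6, h.r7, h.r8, h.r9]
  have hk : ∀ e, κ e = keys (s'.arr 16 e) := fun e => by rw [hκ, hf.arr 16 rfl]; rfl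
  have hpow : 2 ^ (j + 1) ≤ 2 ^ L := Nat.pow_le_pow_right (by norm_num) hj
  refine Runs.seq (2 ^ L * 90 + 20) (2 ^ L * 15 + 30)
    (runs_mergeProg (W := 2 ^ j) hb hE (by positivity)
      (by rw [← pow_succ]; exact Nat.pow_dvd_pow _ hj) h16 hk hI) ?_ (by omega)
  intro s₁ hs₁ hf₁ hI₁
  refine Runs.seq (2 ^ L * 15 + 20) 10
    (runs_copyProg hb (hE.frame hf₁ rfl) (by norm_num)) ?_ (by omega)
  intro s₂ hs₂ hf₂ hI₂
  have h16₂ : s₂.reg 16 = 2 ^ j := by rw [hf₂.reg 16 rfl, hf₁.reg 16 rfl, h16]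
  refine Runs.assign (v := 2 ^ (j + 1)) rfl (by simp [h16₂, pow_succ]) (by omega) (by decide) ?_
  refine ⟨by simp, ?_⟩
  rw [pow_succ]
  simpa using hI₁.congr hI₂

end Programs
end TwoTokens

namespace TwoTokens

/-! ## Two-colouring along two pairings -/

/-- `f` pairs the numbers below `M`. -/
structure IsPairing (M : ℕ) (f : ℕ → ℕ) : Prop where
  lt : ∀ x < M, f x < M
  invol : ∀ x < M, f (f x) = x
  ne : ∀ x < M, f x ≠ x

/-- The colours `0` and `1` differ on every pair, as far as they have been assigned; `2` stands
for a missing colour. -/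
def OppositeOn (M : ℕ) (f col : ℕ → ℕ) : Prop :=
  ∀ x < M, col x ≠ 2 → col x + col (f x) = 1

/-- The state of the colouring at the vertex `p` of a cycle that starts in `p₀`. -/
structure ColourState (M : ℕ) (f g col : ℕ → ℕ) (p p₀ : ℕ) : Prop where
  le : p₀ ≤ M
  done : ∀ x < p₀, col x ≠ 2
  left : OppositeOn M f col
  right : (p = p₀ ∧ OppositeOn M g col) ∨
    (p < M ∧ p₀ < M ∧ p ≠ p₀ ∧ col (g p) = 1 ∧ col p₀ = 0 ∧ col p = 2 ∧ col (g p₀) = 2 ∧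
      ∀ x < M, x ≠ p₀ → x ≠ g p₀ → x ≠ p → x ≠ g p → col x ≠ 2 → col x + col (g x) = 1)

section Colour

variable {M : ℕ} {f g col : ℕ → ℕ} {p p₀ : ℕ}

theorem ColourState.lt (h : ColourState M f g col p p₀) (hp₀ : p₀ < M) : p < M := by
  rcases h.right with ⟨rfl, -⟩ | ⟨h, -⟩
  exacts [hp₀, h]

/-- A coloured current vertex means that no cycle is open: the walk is at `p₀` and all colours are
consistent, so the search for an uncoloured start moves on. -/
theorem ColourState.next (h : ColourState M f g col p p₀) (hp₀ : p₀ < M) (hp : col p ≠ 2) :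
    ColourState M f g col (p₀ + 1) (p₀ + 1) := by
  rcases h.right with ⟨rfl, h'⟩ | ⟨-, -, -, -, -, h', -⟩
  · refine ⟨hp₀, fun x hx => ?_, h.left, Or.inl ⟨rfl, h'⟩⟩
    rcases Nat.lt_succ_iff_lt_or_eq.1 hx with hx | rfl
    exacts [h.done x hx, hp]
  · exact absurd h' hp

/-- The walk gives `0` to `p` and `1` to its partner `f p`, then moves to the `g`-partner of `f p`,
which must get `0` next. So `f` is never violated, and `g` can fail only on the pairs of the two
ends of the open path. When the walk is back at `p₀`, the two ends are partners coloured `0` and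
`1`. -/
theorem ColourState.step (hf : IsPairing M f) (hg : IsPairing M g)
    (h : ColourState M f g col p p₀) (hp₀ : p₀ < M) (hp : col p = 2) :
    ColourState M f g (Function.update (Function.update col p 0) (f p) 1) (g (f p)) p₀ := by
  have hpM := h.lt hp₀
  have hfp := hf.lt p hpM
  have hgp := hg.lt p hpM
  have hfne := hf.ne p hpM
  have hcol : ∀ x, Function.update (Function.update col p 0) (f p) 1 x =
      if x = f p then 1 else if x = p then 0 else col x := by
    intro x
    simp only [Function.update_apply]
  have hfp2 : col (f p) = 2 := by
    by_contra hne
    have := h.left (f p) hfp hne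
    rw [hf.invol p hpM] at this
    omega
  have hggfp := hg.invol (f p) hfp
  have hgfp := hg.lt (f p) hfp
  have hgfne := hg.ne (f p) hfp
  have hgp₀ := hg.lt p₀ hp₀
  have hggp₀ := hg.invol p₀ hp₀
  have hgp₀ne := hg.ne p₀ hp₀
  refine ⟨h.le, fun x hx => ?_, fun x hx hx2 => ?_, ?_⟩
  · have := h.done x hx
    rw [hcol]
    split_ifs <;> omega
  · have h1 := hf.invol x hx
    have h2 := hf.invol p hpM
    rw [hcol] at hx2
    rw [hcol, hcol]
    by_cases e1 : x = f p
    · subst e1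
      rw [if_pos rfl, h2, if_neg hfne.symm, if_pos rfl]
    · by_cases e2 : x = p
      · subst e2
        rw [if_neg e1, if_pos rfl, if_pos rfl]
      · rw [if_neg e1, if_neg e2] at hx2 ⊢
        rw [if_neg (fun e => e2 (by rw [← h1, e, h2])), if_neg (fun e => e1 (by rw [← h1, e]))]
        exact h.left x hx hx2
  · simp only [OppositeOn, hcol]
    rcases h.right with ⟨rfl, hc⟩ | ⟨-, -, hne, hgp1, hp₀0, -, hgp₀2, hb⟩
    -- The walk starts a new cycle here. The partner of an uncoloured vertex is uncoloured, as the
    -- colours are consistent so far.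
    · have hgp2 : col (g p) = 2 := by
        by_contra hne
        have := hc (g p) hgp hne
        rw [hggp₀] at this
        omega
      by_cases e : g (f p) = p
      · left
        refine ⟨e, fun x hx hx2 => ?_⟩
        have := hg.invol x hx
        have := hc x hx
        grind
      · right
        have hgf2 : col (g (f p)) = 2 := by
          by_contra hne
          have := hc (g (f p)) hgfp hne
          rw [hggfp] at this
          omega
        refine ⟨hgfp, hp₀, e, ?_, ?_, ?_, ?_, fun x hx h1 h2 h3 h4 h5 => ?_⟩
        · grind
        · grind
        · grind
        · grind
        · have := hg.invol x hx
          have := hc x hx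
          grind
    · have hggp := hg.invol p hpM
      have hgpne := hg.ne p hpM
      -- The pair of `p` and `g p` has been repaired, since `g p` has colour `1` and `p` now has
      -- `0`. The exceptions that remain are the pair of `p₀` and the new pair of `f p`.
      have hbb : ∀ x < M, x ≠ p₀ → x ≠ g p₀ → x ≠ g (f p) → x ≠ f p →
          (if x = f p then 1 else if x = p then 0 else col x) ≠ 2 →
          (if x = f p then 1 else if x = p then 0 else col x) +
            (if g x = f p then 1 else if g x = p then 0 else col (g x)) = 1 := by
        intro x hx h1 h2 h3 h4 h5
        have := hg.invol x hx
        have := hb x hx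
        grind
      by_cases e : g (f p) = p₀
      · left
        refine ⟨e, fun x hx hx2 => ?_⟩
        have := hbb x hx
        grind
      · right
        refine ⟨hgfp, hp₀, e, ?_, ?_, ?_, ?_, fun x hx h1 h2 h3 h4 h5 => ?_⟩
        · grind
        · grind
        · have := hb (g (f p)) hgfp
          grind
        · grind
        · exact hbb x hx h1 h2 h3 (by rwa [hggfp] at h4) h5

end Colour

theorem exists_lt_eq_of_inj {M : ℕ} {f : ℕ → ℕ} (hf : ∀ x < M, f x < M)
    (hinj : ∀ x < M, ∀ y < M, f x = f y → x = y) : ∀ y < M, ∃ x < M, f x = y := by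
  intro y hy
  have h := Finset.eq_of_subset_of_card_le (s := (Finset.range M).image f) (t := Finset.range M)
    (by
      intro z hz
      obtain ⟨x, hx, rfl⟩ := Finset.mem_image.1 hz
      exact Finset.mem_range.2 (hf x (Finset.mem_range.1 hx)))
    (by
      rw [Finset.card_image_of_injOn]
      intro x hx y hy hxy
      exact hinj x (by simpa using hx) y (by simpa using hy) hxy)
  have hy' : y ∈ (Finset.range M).image f := by rw [h]; exact Finset.mem_range.2 hy
  obtain ⟨x, hx, rfl⟩ := Finset.mem_image.1 hy'
  exact ⟨x, Finset.mem_range.1 hx, rfl⟩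

/-! ## One level of the routing -/

/-- `π` and `π'` are inverse permutations of the numbers below `M`. -/
structure IsPerm (M : ℕ) (π π' : ℕ → ℕ) : Prop where
  lt : ∀ p < M, π p < M
  lt' : ∀ p < M, π' p < M
  left : ∀ p < M, π' (π p) = p
  right : ∀ p < M, π (π' p) = p

/-- Colours that separate the positions that differ in the bit of weight `P`, before and after
the permutation `π`. -/
structure IsSplit (M P : ℕ) (π π' c : ℕ → ℕ) : Prop where
  lt : ∀ p < M, c p < 2
  left : ∀ p < M, c p + c (flipBit P p) = 1
  right : ∀ p < M, c p + c (π' (flipBit P (π p))) = 1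

section Level

variable {M P : ℕ} {π π' c : ℕ → ℕ}

theorem isPairing_flipBit (hP : 0 < P) (hM : P * 2 ∣ M) : IsPairing M (flipBit P) :=
  ⟨fun _ => flipBit_lt hP hM, fun _ _ => flipBit_flipBit hP, fun _ _ => flipBit_ne hP⟩

/-- The flip on the output side, conjugated by the permutation: it pairs the inputs whose images
differ just in the bit of weight `P`. -/
theorem IsPerm.isPairing (h : IsPerm M π π') (hP : 0 < P) (hM : P * 2 ∣ M) :
    IsPairing M (fun p => π' (flipBit P (π p))) := by
  have hlt : ∀ x < M, flipBit P (π x) < M := fun x hx => flipBit_lt hP hM (h.lt x hx)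
  refine ⟨fun x hx => h.lt' _ (hlt x hx), fun x hx => ?_, fun x hx e => ?_⟩
  · rw [h.right _ (hlt x hx), flipBit_flipBit hP, h.left x hx]
  · apply flipBit_ne (p := π x) hP
    rw [← h.right _ (hlt x hx), e]

/-- Two positions that collide after replacing the bit are equal or flips of each other, and flips
have different colours. -/
theorem IsSplit.inj_left (hc : IsSplit M P π π' c) (hP : 0 < P) {p q : ℕ} (hp : p < M)
    (hq : q < M) (h : setBit P p (c p) = setBit P q (c q)) : p = q := by
  rcases eq_or_eq_flipBit hP (hc.lt p hp) (hc.lt q hq) h with h' | h'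
  · exact h'
  · have h1 := setBit_left_inj hP (hc.lt p hp) (hc.lt q hq) h
    have h2 := hc.left q hq
    rw [← h'] at h2
    omega

theorem IsSplit.inj_right (hc : IsSplit M P π π' c) (hπ : IsPerm M π π') (hP : 0 < P) {p q : ℕ}
    (hp : p < M) (hq : q < M) (h : setBit P (π p) (c p) = setBit P (π q) (c q)) : p = q := by
  rcases eq_or_eq_flipBit hP (hc.lt p hp) (hc.lt q hq) h with h' | h'
  · rw [← hπ.left p hp, h', hπ.left q hq]
  · have h1 := setBit_left_inj hP (hc.lt p hp) (hc.lt q hq) h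
    have h2 := hc.right q hq
    rw [← h', hπ.left p hp] at h2
    omega

theorem IsSplit.isPerm (hc : IsSplit M P π π' c) (hπ : IsPerm M π π') (hP : 0 < P)
    (hM : P * 2 ∣ M) {ρ ρ' : ℕ → ℕ}
    (hρ : ∀ p < M, ρ (setBit P p (c p)) = setBit P (π p) (c p))
    (hρ' : ∀ p < M, ρ' (setBit P (π p) (c p)) = setBit P p (c p)) : IsPerm M ρ ρ' := by
  have h1 : ∀ p < M, setBit P p (c p) < M := fun p hp => setBit_lt hP hM (hc.lt p hp) hp
  have h2 : ∀ p < M, setBit P (π p) (c p) < M := fun p hp =>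
    setBit_lt hP hM (hc.lt p hp) (hπ.lt p hp)
  have s1 := exists_lt_eq_of_inj h1 (fun x hx y hy => hc.inj_left hP hx hy)
  have s2 := exists_lt_eq_of_inj h2 (fun x hx y hy => hc.inj_right hπ hP hx hy)
  constructor
  · intro p hp
    obtain ⟨x, hx, rfl⟩ := s1 p hp
    rw [hρ x hx]; exact h2 x hx
  · intro p hp
    obtain ⟨x, hx, rfl⟩ := s2 p hp
    rw [hρ' x hx]; exact h1 x hx
  · intro p hp
    obtain ⟨x, hx, rfl⟩ := s1 p hp
    rw [hρ x hx, hρ' x hx]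
  · intro p hp
    obtain ⟨x, hx, rfl⟩ := s2 p hp
    rw [hρ' x hx, hρ x hx]

/-- The layers that have been routed after `l` levels. -/
def Routed (L l t : ℕ) : Prop := t < l ∨ (L * 2 - l ≤ t ∧ t < L * 2)

/-- The routes after `l` levels: in the layers up to `l` and from `2 * L - l` on they are known,
and `π` remains to be routed. -/
structure PartialRouting (L : ℕ) (rank : ℕ → ℕ) (l : ℕ) (π π' : ℕ → ℕ) (pos : ℕ → ℕ → ℕ) :
    Prop where
  perm : IsPerm (2 ^ L) π π'
  mod : ∀ p < 2 ^ L, π p % 2 ^ l = p % 2 ^ l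
  lt : ∀ t e, t ≤ l ∨ (L * 2 - l ≤ t ∧ t ≤ L * 2) → e < 2 ^ L → pos t e < 2 ^ L
  inj : ∀ t e e', t ≤ l ∨ (L * 2 - l ≤ t ∧ t ≤ L * 2) → e < 2 ^ L → e' < 2 ^ L →
    pos t e = pos t e' → e = e'
  zero : ∀ e, e < 2 ^ L → pos 0 e = e
  last : ∀ e, e < 2 ^ L → pos (L * 2) e = rank e
  step : ∀ t e, Routed L l t → e < 2 ^ L → pos (t + 1) e =
    setBit (2 ^ layerBit L t) (pos t e) (bitAt (2 ^ layerBit L t) (pos (t + 1) e))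
  link : ∀ e, e < 2 ^ L → π (pos l e) = pos (L * 2 - l) e

variable {L l : ℕ} {rank : ℕ → ℕ} {pos : ℕ → ℕ → ℕ}

theorem PartialRouting.init (hL : 0 < L) {rank' : ℕ → ℕ} (h : IsPerm (2 ^ L) rank rank') :
    PartialRouting L rank 0 rank rank' (fun t e => if t = 0 then e else rank e) where
  perm := h
  mod := by simp [Nat.mod_one]
  lt := by
    intro t e _ he
    split_ifs
    exacts [he, h.lt e he]
  inj := by
    intro t e e' _ he he' hee
    split_ifs at hee
    · exact hee
    · rw [← h.left e he, hee, h.left e' he']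
  zero := by simp
  last := by
    intro e he
    rw [if_neg (by omega)]
  step := by
    rintro t e (h | h) <;> omega
  link := by
    intro e he
    simp [hL.ne']

/-- After `L` levels the known layers from both sides meet in the middle and cover everything. -/
theorem PartialRouting.routing (h : PartialRouting L rank L π π' pos) : Routing L rank pos where
  lt := fun t e ht he => h.lt t e (by omega) he
  inj := fun t e e' ht he he' => h.inj t e e' (by omega) he he'
  zero := h.zero
  last := h.last
  step := fun t e ht he => h.step t e (by unfold Routed; omega) he

/-- The routes after another level. -/
def extendPos (L l : ℕ) (pos : ℕ → ℕ → ℕ) (c : ℕ → ℕ) (t e : ℕ) : ℕ :=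
  if t = l + 1 then setBit (2 ^ l) (pos l e) (c (pos l e))
  else if t = L * 2 - (l + 1) then setBit (2 ^ l) (pos (L * 2 - l) e) (c (pos l e))
  else pos t e

theorem extendPos_of_le (hl : l < L) {t e : ℕ} (ht : t ≤ l) :
    extendPos L l pos c t e = pos t e := by
  rw [extendPos, if_neg (by omega), if_neg (by omega)]

theorem extendPos_of_ge (hl : l < L) {t e : ℕ} (ht : L * 2 - l ≤ t) :
    extendPos L l pos c t e = pos t e := by
  rw [extendPos, if_neg (by omega), if_neg (by omega)]

theorem extendPos_left {e : ℕ} :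
    extendPos L l pos c (l + 1) e = setBit (2 ^ l) (pos l e) (c (pos l e)) := if_pos rfl

/-- The switches on both sides write the same colour into bit `l`, so the remaining permutation also
preserves this bit. After all levels it is the identity, which is what lets both halves of the
routes fit together. -/
theorem PartialRouting.mod_succ (h : PartialRouting L rank l π π' pos) (hl : l < L)
    (hc : IsSplit (2 ^ L) (2 ^ l) π π' c) {ρ : ℕ → ℕ}
    (hρ : ∀ p < 2 ^ L, ρ (setBit (2 ^ l) p (c p)) = setBit (2 ^ l) (π p) (c p)) :
    ∀ p < 2 ^ L, ρ p % 2 ^ (l + 1) = p % 2 ^ (l + 1) := by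
  have hP : 0 < 2 ^ l := by positivity
  have hM : 2 ^ l * 2 ∣ 2 ^ L := by rw [← pow_succ]; exact Nat.pow_dvd_pow _ hl
  intro p hp
  obtain ⟨x, hx, rfl⟩ := exists_lt_eq_of_inj (fun p hp => setBit_lt hP hM (hc.lt p hp) hp)
    (fun x hx y hy => hc.inj_left hP hx hy) p hp
  rw [hρ x hx, pow_succ, setBit_mod_two_mul hP (hc.lt x hx), setBit_mod_two_mul hP (hc.lt x hx),
    h.mod x hx]

/-- On the last level the layers `l + 1` and `L * 2 - (l + 1)` coincide and `extendPos` uses its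
first clause. Both clauses agree there: the lower bits by `mod`, the top bit because it is the
colour. -/
theorem PartialRouting.extendPos_right (h : PartialRouting L rank l π π' pos) (hl : l < L)
    (hc : IsSplit (2 ^ L) (2 ^ l) π π' c) {e : ℕ} (he : e < 2 ^ L) :
    extendPos L l pos c (L * 2 - (l + 1)) e =
      setBit (2 ^ l) (pos (L * 2 - l) e) (c (pos l e)) := by
  by_cases h1 : L * 2 - (l + 1) = l + 1
  · rw [extendPos, if_pos h1]
    have hP : 0 < 2 ^ l := by positivity
    have hM : 2 ^ l * 2 = 2 ^ L := by rw [← pow_succ]; congr 1; omega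
    have hp := h.lt l e (by omega) he
    have hb := hc.lt _ hp
    have hq := h.perm.lt _ hp
    rw [← h.link e he, ← Nat.mod_eq_of_lt (setBit_lt hP hM.dvd hb hp),
      ← Nat.mod_eq_of_lt (setBit_lt hP hM.dvd hb hq), ← hM, setBit_mod_two_mul hP hb,
      setBit_mod_two_mul hP hb, h.mod _ hp]
  · rw [extendPos, if_neg h1, if_pos rfl]

/-- One level of the looping algorithm: the two outermost layers still open replace bit `l` by the
colour and, on the far side, restore the bit demanded by `π`. Injectivity in the new layers is the
defining property of the colouring. -/
theorem PartialRouting.succ (h : PartialRouting L rank l π π' pos) (hl : l < L)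
    (hc : IsSplit (2 ^ L) (2 ^ l) π π' c) {ρ ρ' : ℕ → ℕ}
    (hρ : ∀ p < 2 ^ L, ρ (setBit (2 ^ l) p (c p)) = setBit (2 ^ l) (π p) (c p))
    (hρ' : ∀ p < 2 ^ L, ρ' (setBit (2 ^ l) (π p) (c p)) = setBit (2 ^ l) p (c p)) :
    PartialRouting L rank (l + 1) ρ ρ' (extendPos L l pos c) := by
  have hP : 0 < 2 ^ l := by positivity
  have hM : 2 ^ l * 2 ∣ 2 ^ L := by rw [← pow_succ]; exact Nat.pow_dvd_pow _ hl
  have hperm := hc.isPerm h.perm hP hM hρ hρ'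
  have hlt1 : ∀ e < 2 ^ L, extendPos L l pos c (l + 1) e < 2 ^ L := by
    intro e he
    have hp := h.lt l e (by omega) he
    rw [extendPos_left]
    exact setBit_lt hP hM (hc.lt _ hp) hp
  have hlink : ∀ e < 2 ^ L, ρ (extendPos L l pos c (l + 1) e) =
      extendPos L l pos c (L * 2 - (l + 1)) e := by
    intro e he
    have hp := h.lt l e (by omega) he
    rw [extendPos_left, hρ _ hp, h.extendPos_right hl hc he, h.link e he]
  have hinj1 : ∀ e < 2 ^ L, ∀ e' < 2 ^ L,
      extendPos L l pos c (l + 1) e = extendPos L l pos c (l + 1) e' → e = e' := by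
    intro e he e' he' hee
    rw [extendPos_left, extendPos_left] at hee
    have hp := h.lt l e (by omega) he
    have hp' := h.lt l e' (by omega) he'
    exact h.inj l e e' (by omega) he he' (hc.inj_left hP hp hp' hee)
  refine ⟨hperm, h.mod_succ hl hc hρ, ?_, ?_, ?_, ?_, ?_, hlink⟩
  · intro t e ht he
    rcases (show t = l + 1 ∨ t = L * 2 - (l + 1) ∨ t ≤ l ∨ (L * 2 - l ≤ t ∧ t ≤ L * 2) by omega)
      with rfl | rfl | ht | ht
    · exact hlt1 e he
    · rw [← hlink e he]
      exact hperm.lt _ (hlt1 e he)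
    · rw [extendPos_of_le hl ht]
      exact h.lt t e (Or.inl ht) he
    · rw [extendPos_of_ge hl ht.1]
      exact h.lt t e (Or.inr ht) he
  · intro t e e' ht he he' hee
    rcases (show t = l + 1 ∨ t = L * 2 - (l + 1) ∨ t ≤ l ∨ (L * 2 - l ≤ t ∧ t ≤ L * 2) by omega)
      with rfl | rfl | ht | ht
    · exact hinj1 e he e' he' hee
    · rw [← hlink e he, ← hlink e' he'] at hee
      apply hinj1 e he e' he'
      rw [← hperm.left _ (hlt1 e he), hee, hperm.left _ (hlt1 e' he')]
    · rw [extendPos_of_le hl ht, extendPos_of_le hl ht] at hee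
      exact h.inj t e e' (Or.inl ht) he he' hee
    · rw [extendPos_of_ge hl ht.1, extendPos_of_ge hl ht.1] at hee
      exact h.inj t e e' (Or.inr ht) he he' hee
  · intro e he
    rw [extendPos_of_le hl (Nat.zero_le _), h.zero e he]
  · intro e he
    rw [extendPos_of_ge hl (by omega), h.last e he]
  · intro t e ht he
    have hb := hc.lt _ (h.lt l e (by omega) he)
    unfold Routed at ht
    rcases (show t = l ∨ t = L * 2 - (l + 1) ∨ t < l ∨ (L * 2 - l ≤ t ∧ t < L * 2) by omega)
      with rfl | rfl | ht | ht
    · rw [extendPos_left, extendPos_of_le hl le_rfl, layerBit, if_pos hl, bitAt_setBit hP hb]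
    · rw [h.extendPos_right hl hc he, show L * 2 - (l + 1) + 1 = L * 2 - l by omega,
        extendPos_of_ge hl le_rfl, layerBit, if_neg (by omega),
        show 2 * L - 1 - (L * 2 - (l + 1)) = l by omega, setBit_setBit hP hb, setBit_bitAt]
    · rw [extendPos_of_le hl ht.le, extendPos_of_le hl ht]
      exact h.step t e (Or.inl ht) he
    · rw [extendPos_of_ge hl ht.1, extendPos_of_ge hl (by omega)]
      exact h.step t e (Or.inr ht) he

end Level

end TwoTokens

/-! ### Routing a permutation on the machine -/

namespace TwoTokens

/-- The expression for `flipBit`. -/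
def flipExpr (P p : Expr) : Expr := setBitExpr P p (1 - bitExpr P p)

section Cells

variable {L l : ℕ} {rank : ℕ → ℕ} {pos : ℕ → ℕ → ℕ} {π π' c : ℕ → ℕ} {R a : ℕ}

/-- The cells of the vertices on the routes after `l` levels, in a table that starts in `R`. -/
def RouteCells (L l : ℕ) (pos : ℕ → ℕ → ℕ) (R a : ℕ) : Prop :=
  ∃ t e, Routed L l t ∧ e < 2 ^ L ∧ (a = R + node (2 ^ L) t (pos t e) (direction L pos t e) ∨
    a = R + node (2 ^ L) t (pos t e) (direction L pos t e) + half L (2 ^ L))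

/-- A level adds two layers in each copy of the network. On the near side the outgoing direction is
the colour; on the far side it is the original bit of `π p`, since that layer leads to the final
value of the bit. -/
theorem PartialRouting.routeCells_succ (h : PartialRouting L rank l π π' pos) (hl : l < L)
    (hc : IsSplit (2 ^ L) (2 ^ l) π π' c) :
    RouteCells L (l + 1) (extendPos L l pos c) R a ↔ RouteCells L l pos R a ∨
      ∃ p < 2 ^ L, a = R + node (2 ^ L) l p (c p) ∨ a = R + node (2 ^ L) l p (c p) + half L (2 ^ L) ∨
        a = R + node (2 ^ L) (L * 2 - 1 - l) (setBit (2 ^ l) (π p) (c p)) (bitAt (2 ^ l) (π p)) ∨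
        a = R + node (2 ^ L) (L * 2 - 1 - l) (setBit (2 ^ l) (π p) (c p)) (bitAt (2 ^ l) (π p)) +
          half L (2 ^ L) := by
  have hP : 0 < 2 ^ l := by positivity
  have hold : ∀ t e, Routed L l t → extendPos L l pos c t e = pos t e ∧
      direction L (extendPos L l pos c) t e = direction L pos t e := by
    intro t e ht
    unfold direction
    rcases ht with ht | ht
    · rw [extendPos_of_le hl ht.le, extendPos_of_le hl ht]
      exact ⟨rfl, rfl⟩
    · rw [extendPos_of_ge hl ht.1, extendPos_of_ge hl (by omega)]
      exact ⟨rfl, rfl⟩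
  have hleft : ∀ e < 2 ^ L, extendPos L l pos c l e = pos l e ∧
      direction L (extendPos L l pos c) l e = c (pos l e) := by
    intro e he
    rw [direction, if_pos (by omega), extendPos_left, extendPos_of_le hl le_rfl, layerBit,
      if_pos hl, bitAt_setBit hP (hc.lt _ (h.lt l e (by omega) he))]
    exact ⟨rfl, rfl⟩
  have hright : ∀ e < 2 ^ L, extendPos L l pos c (L * 2 - 1 - l) e =
        setBit (2 ^ l) (π (pos l e)) (c (pos l e)) ∧
      direction L (extendPos L l pos c) (L * 2 - 1 - l) e = bitAt (2 ^ l) (π (pos l e)) := by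
    intro e he
    rw [show L * 2 - 1 - l = L * 2 - (l + 1) by omega, h.extendPos_right hl hc he, h.link e he,
      direction, if_pos (by omega), show L * 2 - (l + 1) + 1 = L * 2 - l by omega,
      extendPos_of_ge hl le_rfl, layerBit, if_neg (by omega),
      show 2 * L - 1 - (L * 2 - (l + 1)) = l by omega]
    exact ⟨rfl, rfl⟩
  constructor
  · rintro ⟨t, e, ht, he, ha⟩
    have hp := h.lt l e (by omega) he
    rcases (show t = l ∨ t = L * 2 - 1 - l ∨ Routed L l t by unfold Routed at *; omega)
      with rfl | rfl | ht
    · rw [(hleft e he).1, (hleft e he).2] at ha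
      exact Or.inr ⟨_, hp, by tauto⟩
    · rw [(hright e he).1, (hright e he).2] at ha
      exact Or.inr ⟨_, hp, by tauto⟩
    · rw [(hold t e ht).1, (hold t e ht).2] at ha
      exact Or.inl ⟨t, e, ht, he, ha⟩
  · rintro (⟨t, e, ht, he, ha⟩ | ⟨p, hp, ha⟩)
    · refine ⟨t, e, by unfold Routed at *; omega, he, ?_⟩
      rwa [(hold t e ht).1, (hold t e ht).2]
    · obtain ⟨e, he, rfl⟩ := exists_lt_eq_of_inj (fun e he => h.lt l e (by omega) he)
        (fun x hx y hy => h.inj l x y (by omega) hx hy) p hp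
      rcases ha with ha | ha | ha | ha
      · refine ⟨l, e, by unfold Routed; omega, he, Or.inl ?_⟩
        rwa [(hleft e he).1, (hleft e he).2]
      · refine ⟨l, e, by unfold Routed; omega, he, Or.inr ?_⟩
        rwa [(hleft e he).1, (hleft e he).2]
      · refine ⟨L * 2 - 1 - l, e, by unfold Routed; omega, he, Or.inl ?_⟩
        rwa [(hright e he).1, (hright e he).2]
      · refine ⟨L * 2 - 1 - l, e, by unfold Routed; omega, he, Or.inr ?_⟩
        rwa [(hright e he).1, (hright e he).2]

end Cells

/-- The number of missing colours. -/
def missing (M : ℕ) (col : ℕ → ℕ) : ℕ := ((Finset.range M).filter fun x => col x = 2).card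

theorem missing_le {M : ℕ} {col : ℕ → ℕ} : missing M col ≤ M :=
  (Finset.card_filter_le _ _).trans (by simp)

/-- Termination and linear time of the colouring: each step of a walk uses up an uncoloured vertex.
-/
theorem missing_update_lt {M p q a b : ℕ} {col : ℕ → ℕ} (hp : p < M) (h : col p = 2) (ha : a ≠ 2)
    (hb : b ≠ 2) :
    missing M (Function.update (Function.update col p a) q b) < missing M col := by
  refine Finset.card_lt_card ((Finset.ssubset_iff_of_subset ?_).2 ⟨p, by simp [hp, h], ?_⟩)
  · intro x hx
    simp only [Finset.mem_filter, Function.update_apply] at hx ⊢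
    refine ⟨hx.1, ?_⟩
    have h2 := hx.2
    split_ifs at h2
    exacts [absurd h2 hb, absurd h2 ha, h2]
  · simp only [Finset.mem_filter, Function.update_apply, not_and]
    intro _
    split_ifs <;> assumption

section Programs

variable {K : Type*} [LinearOrder K] {Z : ℕ} {keys : ℕ → K} {n m L H : ℕ} {s : Memory}

theorem eval_flipExpr (P p : Expr) : (flipExpr P p).eval keys s =
    flipBit (P.eval keys s) (p.eval keys s) := by
  rw [flipExpr, eval_setBitExpr, Expr.eval_sub, eval_bitExpr, Expr.eval_one, flipBit]

/-- Two-colours the positions, for the permutation in array 18 with inverse in array 17 and the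
bit whose weight is in register 15; the colours go to array 19. -/
def colourProg : Prog :=
  forUp 13 (.reg 6) (.store 19 (.reg 13) 2) ;;
  .assign 20 0 ;; .assign 19 0 ;;
  .loop (.reg 6 - .reg 20)
    (.ite (.cell 19 (.reg 19) - 1)
      (.store 19 (.reg 19) 0 ;; .assign 21 (flipExpr (.reg 15) (.reg 19)) ;;
        .store 19 (.reg 21) 1 ;; .assign 22 (.cell 18 (.reg 21)) ;;
        .assign 19 (.cell 17 (flipExpr (.reg 15) (.reg 22))))
      (.assign 20 (.reg 20 + 1) ;; .assign 19 (.reg 20)))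

theorem runs_colourProg {P : ℕ} (hb : Bounds n m L H Z) (h : Env n m L H s) (hP : 0 < P)
    (hM : P * 2 ∣ 2 ^ L) (h15 : s.reg 15 = P) (hπ : IsPerm (2 ^ L) (s.arr 18) (s.arr 17)) :
    Runs Z keys colourProg s (2 ^ L * 300 + 50) (fun s' =>
      IsSplit (2 ^ L) P (s.arr 18) (s.arr 17) (s'.arr 19)) := by
  have hlit := hb.lit
  have hsz := hb.size_lt
  refine Runs.seq (2 ^ L * 14 + 20) (2 ^ L * 256 + 30) (Q₁ := fun s' => ∀ x < 2 ^ L, s'.arr 19 x = 2)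
    (Runs.forUp (2 ^ L) 5 (fun j s' => ∀ x < j, s'.arr 19 x = 2)
      rfl rfl (by omega) (by simp [Expr.cost]) (fun s' hf => ?_) (by simp) ?_
      (fun s' _ _ h => h)) ?_ (by omega)
  · simp [hf.reg 6 rfl, h.r6]
  · rintro j s' hj - hf hx hI
    refine Runs.store (i := j) (v := 2) rfl rfl (by simp [hx]) (by simp) (by omega) (by decide) ?_
    intro x hx'
    by_cases hxj : x = j
    · simp [hxj]
    · simpa [hxj] using hI x (by omega)
  intro s₀ hs₀ hf₀ hI₀
  refine Runs.assign_seq (v := 0) rfl (by simp) (by omega) (by simp [Expr.cost]) ?_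
  refine Runs.assign_seq (v := 0) rfl (by simp) (by omega) (by simp [Expr.cost]) ?_
  have hcost : (Expr.reg 6 - Expr.reg 20).cost = 3 := rfl
  have hf := isPairing_flipBit hP hM
  have hg := hπ.isPairing hP hM
  -- An iteration either advances the start `p₀` or reduces the missing colours, so `128` steps are
  -- reserved for each possible event of either kind; test and body take at most `104`.
  refine Runs.loop rfl (fun s' => ColourState (2 ^ L) (flipBit P)
      (fun p => s.arr 17 (flipBit P (s.arr 18 p))) (s'.arr 19) (s'.reg 19) (s'.reg 20))
    (fun s' => (2 ^ L - s'.reg 20) * 128 +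
      missing (2 ^ L) (s'.arr 19) * 128 + 10) 100 ?_ ?_ ?_ ?_
  · refine ⟨by simp, fun x hx => by simp at hx, fun x hx hx2 => ?_, Or.inl ⟨by simp, fun x hx hx2 => ?_⟩⟩
    · exact absurd (hI₀ x hx) hx2
    · exact absurd (hI₀ x hx) hx2
  · have := missing_le (M := 2 ^ L) (col := s₀.arr 19)
    simp [Expr.cost]
    omega
  · intro s' hs' hf' hC he
    have h6 : s'.reg 6 = 2 ^ L := by simp [hf'.reg 6 rfl, hf₀.reg 6 rfl, h.r6]
    simp only [Expr.eval_sub, Expr.eval_reg, h6] at he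
    have hp₀ : s'.reg 20 = 2 ^ L := le_antisymm hC.le (by omega)
    refine ⟨by omega, ?_⟩
    have hne : ∀ x < 2 ^ L, s'.arr 19 x ≠ 2 := fun x hx => hC.done x (by omega)
    have hr : OppositeOn (2 ^ L) (fun p => s.arr 17 (flipBit P (s.arr 18 p))) (s'.arr 19) := by
      rcases hC.right with ⟨-, h⟩ | ⟨-, h, -⟩
      · exact h
      · omega
    refine ⟨fun p hp => ?_, fun p hp => hC.left p hp (hne p hp), fun p hp => hr p hp (hne p hp)⟩
    have := hC.left p hp (hne p hp)
    omega
  · intro s' hs' hf' hC he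
    have h6 : s'.reg 6 = 2 ^ L := by simp [hf'.reg 6 rfl, hf₀.reg 6 rfl, h.r6]
    have h15' : s'.reg 15 = P := by simp [hf'.reg 15 rfl, hf₀.reg 15 rfl, h15]
    have h18 : s'.arr 18 = s.arr 18 := by rw [hf'.arr 18 rfl]; simp [hf₀.arr 18 rfl]
    have h17 : s'.arr 17 = s.arr 17 := by rw [hf'.arr 17 rfl]; simp [hf₀.arr 17 rfl]
    simp only [Expr.eval_sub, Expr.eval_reg, h6] at he
    have hp₀ : s'.reg 20 < 2 ^ L := by omega
    have hpM := hC.lt hp₀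
    refine Runs.ite rfl (by decide) (fun hc => ?_) (fun hc => ?_)
    · simp only [Expr.eval_sub, Expr.eval_cell, Expr.eval_reg, Expr.eval_one] at hc
      -- An assigned colour is at most `1` by `OppositeOn`, so truncated subtraction of `1` detects
      -- the value `2`.
      have hp2 : s'.arr 19 (s'.reg 19) = 2 := by
        by_contra hne
        have := hC.left _ hpM hne
        omega
      have hfp := hf.lt _ hpM
      have hgfp := hg.lt _ hfp
      refine Runs.store_seq (i := s'.reg 19) (v := 0) rfl rfl (by simp) (by simp) (by omega)
        (by decide) ?_
      refine Runs.assign_seq (v := flipBit P (s'.reg 19)) rfl (by simp [eval_flipExpr, h15'])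
        (by omega) (by decide) ?_
      refine Runs.store_seq (i := flipBit P (s'.reg 19)) (v := 1) rfl rfl (by simp) (by simp)
        (by omega) (by decide) ?_
      refine Runs.assign_seq (v := s.arr 18 (flipBit P (s'.reg 19))) rfl (by simp [h18])
        (by rw [← h18]; exact hs'.arr _ _) (by decide) ?_
      refine Runs.assign (v := s.arr 17 (flipBit P (s.arr 18 (flipBit P (s'.reg 19))))) rfl
        (by simp [h17, eval_flipExpr, h15']) (by omega) (by decide) ?_
      have hstep := hC.step hf hg hp₀ hp2
      refine ⟨by simpa using hstep, ?_⟩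
      have hlt := missing_update_lt (q := flipBit P (s'.reg 19)) hpM hp2
        (show 0 ≠ 2 by norm_num) (show 1 ≠ 2 by norm_num)
      simp only [Memory.setReg_reg, Memory.setReg_arr, Memory.setCell_reg, Memory.setCell_arr,
        Nat.reduceEqDiff, if_false, if_true]
      omega
    · simp only [Expr.eval_sub, Expr.eval_cell, Expr.eval_reg, Expr.eval_one] at hc
      refine Runs.assign_seq (v := s'.reg 20 + 1) rfl (by simp) (by omega) (by decide) ?_
      refine Runs.assign (v := s'.reg 20 + 1) rfl (by simp) (by omega) (by decide) ?_
      refine ⟨by simpa using hC.next hp₀ (by omega), ?_⟩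
      simp only [Memory.setReg_reg, Memory.setReg_arr, Nat.reduceEqDiff, if_false, if_true]
      omega

/-- Moves to the next level, according to the colours in array 19, and marks the vertices on the
routes. -/
def updateProg : Prog :=
  forUp 13 (.reg 6)
    (.assign 16 (.cell 18 (.reg 13)) ;; .assign 17 (.cell 19 (.reg 13)) ;;
      .assign 18 (setBitExpr (.reg 15) (.reg 13) (.reg 17)) ;;
      .assign 19 (setBitExpr (.reg 15) (.reg 16) (.reg 17)) ;;
      .store 20 (.reg 18) (.reg 19) ;; .store 21 (.reg 19) (.reg 18) ;;
      .assign 21 (.reg 12 + ((.reg 14 * .reg 6 + .reg 13) * 2 + .reg 17)) ;;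
      .assign 22 (.reg 12 + (((.reg 8 - 1 - .reg 14) * .reg 6 + .reg 19) * 2 +
        bitExpr (.reg 15) (.reg 16))) ;;
      .store 5 (.reg 21) 0 ;; .store 5 (.reg 21 + .reg 9) 0 ;;
      .store 5 (.reg 22) 0 ;; .store 5 (.reg 22 + .reg 9) 0)

theorem runs_updateProg {l R : ℕ} {π π' c : ℕ → ℕ} (hb : Bounds n m L H Z) (h : Env n m L H s)
    (hl : l < L) (h14 : s.reg 14 = l) (h15 : s.reg 15 = 2 ^ l) (h12 : s.reg 12 = R)
    (hR : R + half L (2 ^ L) * 2 < Z) (hπ : IsPerm (2 ^ L) π π')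
    (hc : IsSplit (2 ^ L) (2 ^ l) π π' c) (h18 : s.arr 18 = π) (h19 : s.arr 19 = c) :
    Runs Z keys updateProg s (2 ^ L * 160 + 20) (fun s' =>
      (∀ p < 2 ^ L, s'.arr 20 (setBit (2 ^ l) p (c p)) = setBit (2 ^ l) (π p) (c p)) ∧
      (∀ p < 2 ^ L, s'.arr 21 (setBit (2 ^ l) (π p) (c p)) = setBit (2 ^ l) p (c p)) ∧
      ∀ a, s'.arr 5 a = 0 ↔ s.arr 5 a = 0 ∨
        ∃ p < 2 ^ L, a = R + node (2 ^ L) l p (c p) ∨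
          a = R + node (2 ^ L) l p (c p) + half L (2 ^ L) ∨
          a = R + node (2 ^ L) (L * 2 - 1 - l) (setBit (2 ^ l) (π p) (c p)) (bitAt (2 ^ l) (π p)) ∨
          a = R + node (2 ^ L) (L * 2 - 1 - l) (setBit (2 ^ l) (π p) (c p))
            (bitAt (2 ^ l) (π p)) + half L (2 ^ L)) := by
  have hsz := hb.size_lt
  have hlit := hb.lit
  have hP : 0 < 2 ^ l := by positivity
  have hM : 2 ^ l * 2 ∣ 2 ^ L := by rw [← pow_succ]; exact Nat.pow_dvd_pow _ hl
  refine Runs.forUp (2 ^ L) 150 (fun j s' =>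
      (∀ p < j, s'.arr 20 (setBit (2 ^ l) p (c p)) = setBit (2 ^ l) (π p) (c p)) ∧
      (∀ p < j, s'.arr 21 (setBit (2 ^ l) (π p) (c p)) = setBit (2 ^ l) p (c p)) ∧
      ∀ a, s'.arr 5 a = 0 ↔ s.arr 5 a = 0 ∨
        ∃ p < j, a = R + node (2 ^ L) l p (c p) ∨
          a = R + node (2 ^ L) l p (c p) + half L (2 ^ L) ∨
          a = R + node (2 ^ L) (L * 2 - 1 - l) (setBit (2 ^ l) (π p) (c p)) (bitAt (2 ^ l) (π p)) ∨
          a = R + node (2 ^ L) (L * 2 - 1 - l) (setBit (2 ^ l) (π p) (c p))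
            (bitAt (2 ^ l) (π p)) + half L (2 ^ L))
    rfl rfl (by omega) (by simp [Expr.cost]; omega) (fun s' hf => ?_) (by simp) ?_
    (fun s' _ _ h => h)
  · simp [hf.reg 6 rfl, h.r6]
  rintro j s' hj hs' hf hx ⟨hI1, hI2, hI3⟩
  have h6 : s'.reg 6 = 2 ^ L := (hf.reg 6 rfl).trans h.r6
  have h8 : s'.reg 8 = L * 2 := (hf.reg 8 rfl).trans h.r8
  have h9 : s'.reg 9 = half L (2 ^ L) := (hf.reg 9 rfl).trans h.r9
  have h12' : s'.reg 12 = R := (hf.reg 12 rfl).trans h12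
  have h14' : s'.reg 14 = l := (hf.reg 14 rfl).trans h14
  have h15' : s'.reg 15 = 2 ^ l := (hf.reg 15 rfl).trans h15
  have h18' : s'.arr 18 = π := (hf.arr 18 rfl).trans h18
  have h19' : s'.arr 19 = c := (hf.arr 19 rfl).trans h19
  have hcj := hc.lt j hj
  have hπj := hπ.lt j hj
  have hι := setBit_lt hP hM hcj hj
  have ho := setBit_lt hP hM hcj hπj
  have hn1 : node (2 ^ L) l j (c j) < half L (2 ^ L) := node_lt_half (by omega) hj hcj
  have hn2 : node (2 ^ L) (L * 2 - 1 - l) (setBit (2 ^ l) (π j) (c j)) (bitAt (2 ^ l) (π j)) <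
    half L (2 ^ L) := node_lt_half (by omega) ho bitAt_lt_two
  refine Runs.assign_seq (v := π j) rfl (by simp [hx, h18']) (by omega) (by decide) ?_
  refine Runs.assign_seq (v := c j) rfl (by simp [hx, h19']) (by omega) (by decide) ?_
  refine Runs.assign_seq (v := setBit (2 ^ l) j (c j)) rfl (by simp [eval_setBitExpr, hx, h15'])
    (by omega) (by decide) ?_
  refine Runs.assign_seq (v := setBit (2 ^ l) (π j) (c j)) rfl (by simp [eval_setBitExpr, h15'])
    (by omega) (by decide) ?_
  refine Runs.store_seq (i := setBit (2 ^ l) j (c j)) (v := setBit (2 ^ l) (π j) (c j)) rfl rfl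
    (by simp) (by simp) (by omega) (by decide) ?_
  refine Runs.store_seq (i := setBit (2 ^ l) (π j) (c j)) (v := setBit (2 ^ l) j (c j)) rfl rfl
    (by simp) (by simp) (by omega) (by decide) ?_
  refine Runs.assign_seq (v := R + node (2 ^ L) l j (c j)) rfl
    (by simp [h12', h14', h6, hx, node]) (by omega) (by decide) ?_
  refine Runs.assign_seq (v := R + node (2 ^ L) (L * 2 - 1 - l) (setBit (2 ^ l) (π j) (c j))
    (bitAt (2 ^ l) (π j))) rfl
    (by simp [h12', h14', h6, h8, h15', node, eval_bitExpr]) (by omega) (by decide) ?_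
  refine Runs.store_seq (i := R + node (2 ^ L) l j (c j)) (v := 0) rfl rfl
    (by simp) (by simp) (by omega) (by decide) ?_
  refine Runs.store_seq (i := R + node (2 ^ L) l j (c j) + half L (2 ^ L)) (v := 0) rfl rfl
    (by simp [h9]) (by simp) (by omega) (by decide) ?_
  refine Runs.store_seq (i := R + node (2 ^ L) (L * 2 - 1 - l) (setBit (2 ^ l) (π j) (c j))
    (bitAt (2 ^ l) (π j))) (v := 0) rfl rfl
    (by simp) (by simp) (by omega) (by decide) ?_
  refine Runs.store (i := R + node (2 ^ L) (L * 2 - 1 - l) (setBit (2 ^ l) (π j) (c j))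
    (bitAt (2 ^ l) (π j)) + half L (2 ^ L)) (v := 0) rfl rfl
    (by simp [h9]) (by simp) (by omega) (by decide) ?_
  refine ⟨?_, ?_, ?_⟩
  · intro p hp
    by_cases hpj : p = j
    · simp [hpj]
    -- Later rounds do not overwrite earlier entries, because the colours separate the positions.
    · have hne : setBit (2 ^ l) p (c p) ≠ setBit (2 ^ l) j (c j) := fun e =>
        hpj (hc.inj_left hP (by omega) hj e)
      simpa [hne] using hI1 p (by omega)
  · intro p hp
    by_cases hpj : p = j
    · simp [hpj]
    · have hne : setBit (2 ^ l) (π p) (c p) ≠ setBit (2 ^ l) (π j) (c j) := fun e =>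
        hpj (hc.inj_right hπ hP (by omega) hj e)
      simpa [hne] using hI2 p (by omega)
  · intro a
    rw [Nat.exists_lt_succ_right, ← or_assoc, ← hI3]
    simp only [Memory.setReg_arr, Memory.setCell_arr, Nat.reduceEqDiff, if_false, if_true,
      Function.update_apply]
    split_ifs <;> simp_all

/-- Routes one level. -/
def levelProg : Prog :=
  .assign 15 (.cell 15 (.reg 14)) ;; colourProg ;; updateProg ;; copyProg 20 18 ;; copyProg 21 17

/-- Routes the permutation in array 18, with inverse in array 17, and marks the vertices on the
routes in the table that starts in the cell given by register 12. -/
def routeProg : Prog := forUp 14 (.reg 5) levelProg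

/-- The routes themselves are never stored: `pos` exists only in the proof, while the memory holds
the remaining permutation with its inverse and the marks of the visited vertices. A zero in array 5
marks a live vertex, as this table lists Alice's final configurations. -/
theorem runs_routeProg {R : ℕ} {rank rank' : ℕ → ℕ} (hb : Bounds n m L H Z) (h : Env n m L H s)
    (hp : PowTable L s) (h12 : s.reg 12 = R) (hR : R + half L (2 ^ L) * 2 < Z)
    (hr : IsPerm (2 ^ L) rank rank') (h18 : s.arr 18 = rank) (h17 : s.arr 17 = rank') :
    Runs Z keys routeProg s (L * (2 ^ L * 500 + 200) + 20) (fun s' =>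
      ∃ pos, Routing L rank pos ∧
        ∀ a, s'.arr 5 a = 0 ↔ s.arr 5 a = 0 ∨ RouteCells L L pos R a) := by
  have hlit := hb.lit
  have hlv := hb.levels_lt
  have hsz := hb.size_lt
  refine Runs.forUp L (2 ^ L * 500 + 150) (fun l s' => ∃ pos,
      PartialRouting L rank l (s'.arr 18) (s'.arr 17) pos ∧
        ∀ a, s'.arr 5 a = 0 ↔ s.arr 5 a = 0 ∨ RouteCells L l pos R a)
    rfl rfl (by omega) (by simp [Expr.cost]; ring_nf; omega) (fun s' hf => ?_) ?_ ?_ ?_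
  · simp [hf.reg 5 rfl, h.r5]
  · refine ⟨fun t e => if t = 0 then e else rank e, ?_, fun a => ?_⟩
    · simpa only [Memory.setReg_arr, h18, h17] using PartialRouting.init hb.pos hr
    · simp only [Memory.setReg_arr, RouteCells, Routed]
      refine ⟨Or.inl, fun h' => h'.resolve_right ?_⟩
      rintro ⟨t, e, h1, -⟩
      omega
  · rintro l s' hl hs' hf hx ⟨pos, hI, hI5⟩
    have hE := h.frame hf rfl
    have hpw : s'.arr 15 l = 2 ^ l := by
      rw [hp.frame hf rfl l (by omega), layerBit, if_pos hl]
    have hP : 0 < 2 ^ l := by positivity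
    have hM : 2 ^ l * 2 ∣ 2 ^ L := by rw [← pow_succ]; exact Nat.pow_dvd_pow _ hl
    have h12' : s'.reg 12 = R := (hf.reg 12 rfl).trans h12
    refine Runs.assign_seq (v := 2 ^ l) rfl (by simp [hx, hpw]) (by rw [← hpw]; exact hs'.arr _ _)
      (by simp [Expr.cost]) ?_
    refine Runs.seq (2 ^ L * 300 + 50) (2 ^ L * 190 + 60) (runs_colourProg hb
      (h.frame (s' := s'.setReg 15 (2 ^ l))
        ⟨fun x hx => ?_, fun a ha => by simpa using hf.arr a ha⟩ (p := routeProg) rfl)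
      hP hM (by simp) hI.perm) ?_ (by simp [Expr.cost]; omega)
    · have hx15 : x ≠ 15 := by rintro rfl; exact absurd hx (by decide)
      simpa [hx15] using hf.reg x hx
    intro s₁ hs₁ hf₁ hI₁
    simp only [Memory.setReg_arr] at hI₁
    have hE₁ : Env n m L H s₁ := by
      have : Env n m L H (s'.setReg 15 (2 ^ l)) := by
        constructor <;> simp [hE.r0, hE.r1, hE.r2, hE.r5, hE.r6, hE.r7, hE.r8, hE.r9]
      exact this.frame hf₁ rfl
    refine Runs.seq (2 ^ L * 160 + 20) (2 ^ L * 30 + 40) (runs_updateProg hb hE₁ hl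
      (by simp [hf₁.reg 14 rfl, hx]) (by simp [hf₁.reg 15 rfl]) (by simp [hf₁.reg 12 rfl, h12'])
      hR hI.perm hI₁ (by simp [hf₁.arr 18 rfl]) rfl) ?_ (by omega)
    rintro s₂ hs₂ hf₂ ⟨h20, h21, h5⟩
    have hE₂ := hE₁.frame hf₂ rfl
    refine Runs.seq (2 ^ L * 15 + 20) (2 ^ L * 15 + 20) (runs_copyProg hb hE₂ (by norm_num)) ?_
      (by omega)
    intro s₃ hs₃ hf₃ hc₃
    have hE₃ := hE₂.frame hf₃ rfl
    refine Runs.weaken (runs_copyProg hb hE₃ (by norm_num)) le_rfl ?_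
    intro s₄ hs₄ hf₄ hc₄
    refine ⟨extendPos L l pos (s₁.arr 19), ?_, fun a => ?_⟩
    · refine hI.succ hl hI₁ (fun p hp => ?_) (fun p hp => ?_)
      · have hlt := setBit_lt hP hM (hI₁.lt p hp) hp
        simp only [Memory.setReg_arr]
        rw [hf₄.arr 18 rfl, hc₃ _ hlt, h20 p hp]
      · have hlt := setBit_lt hP hM (hI₁.lt p hp) (hI.perm.lt p hp)
        simp only [Memory.setReg_arr]
        rw [hc₄ _ hlt, hf₃.arr 21 rfl, h21 p hp]
    · rw [hI.routeCells_succ hl hI₁, ← or_assoc, ← hI5]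
      simp only [Memory.setReg_arr]
      rw [hf₄.arr 5 rfl, hf₃.arr 5 rfl, h5, hf₁.arr 5 rfl]
      rfl
  · rintro s' - - ⟨pos, hI, hI5⟩
    exact ⟨pos, hI.routing, hI5⟩

end Programs

end TwoTokens

namespace TwoTokens

/-! ## One row of the matrices -/

/-- The address of the key of element `e` in row `i`. -/
def rowAddr (n m H i e : ℕ) : ℕ := if e < H then i * m + e else n * m + i * m + (e - H)

/-- The entry of `C` with index `e - H` is `-∞` or occurs among the entries of `A` that the boolean
matrix `b` selects. -/
def Attained {K : Type*} [LinearOrder K] (m H : ℕ) (κ : ℕ → K) (bot : K) (b : ℕ → ℕ) (e : ℕ) :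
    Prop :=
  κ e ≤ bot ∨ ∃ k < m, κ k = κ e ∧ b (e - H + m * k) ≠ 0

section Rank

variable {K : Type*} [LinearOrder K] {κ : ℕ → K} {M m H : ℕ} {ord rank : ℕ → ℕ}

theorem SortedBlocks.lt (h : SortedBlocks κ M M ord) {q : ℕ} (hq : q < M) : ord q < M := by
  have h1 := h.block q hq
  rw [Nat.div_eq_of_lt hq] at h1
  exact (Nat.div_eq_zero_iff_lt (by omega)).1 h1

theorem SortedBlocks.before (h : SortedBlocks κ M M ord) {q q' : ℕ} (hq : q < q') (hq' : q' < M) :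
    Before κ (ord q) (ord q') :=
  h.sorted q q' hq hq' (by rw [Nat.div_eq_of_lt hq', Nat.div_eq_of_lt (hq.trans hq')])

theorem SortedBlocks.inj (h : SortedBlocks κ M M ord) {q q' : ℕ} (hq : q < M) (hq' : q' < M)
    (he : ord q = ord q') : q = q' := by
  rcases lt_trichotomy q q' with hlt | hlt | hlt
  · exact absurd (he ▸ h.before hlt hq') Before.irrefl
  · exact hlt
  · exact absurd (he ▸ h.before hlt hq) Before.irrefl

theorem SortedBlocks.surj (h : SortedBlocks κ M M ord) {e : ℕ} (he : e < M) :
    ∃ q < M, ord q = e :=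
  exists_lt_eq_of_inj (fun _ hq => h.lt hq) (fun _ hx _ hy => h.inj hx hy) e he

theorem SortedBlocks.isPerm (h : SortedBlocks κ M M ord) (hr : ∀ q < M, rank (ord q) = q) :
    IsPerm M rank ord := by
  refine ⟨fun e he => ?_, fun q hq => h.lt hq, fun e he => ?_, hr⟩
  · obtain ⟨q, hq, rfl⟩ := h.surj he
    rwa [hr q hq]
  · obtain ⟨q, hq, rfl⟩ := h.surj he
    rw [hr q hq]

/-- `Before` is a strict order, so sortedness can be reversed. -/
theorem SortedBlocks.lt_of_before (h : SortedBlocks κ M M ord) {q q' : ℕ}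
    (hq : q < M) (hb : Before κ (ord q) (ord q')) : q < q' := by
  rcases lt_trichotomy q q' with hlt | rfl | hlt
  · exact hlt
  · exact absurd hb Before.irrefl
  · exact absurd (hb.trans (h.before hlt hq)) Before.irrefl

theorem Before.le {e f : ℕ} (h : Before κ e f) : κ e ≤ κ f := by
  rcases h with h | ⟨h, -⟩
  exacts [h.le, h.le]

/-- `k` is the last element below `m` among the first `j` entries of `ord`, if there is one. -/
def IsLast (m : ℕ) (ord : ℕ → ℕ) (j k : ℕ) : Prop :=
  (m ≤ k ∧ ∀ q < j, m ≤ ord q) ∨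
    (k < m ∧ ∃ q < j, ord q = k ∧ ∀ q', q < q' → q' < j → m ≤ ord q')

theorem IsLast.succ {j k : ℕ} (h : IsLast m ord j k) (hj : m ≤ ord j) :
    IsLast m ord (j + 1) k := by
  rcases h with ⟨h, h'⟩ | ⟨h, q, hq, hqk, h'⟩
  · refine Or.inl ⟨h, fun q hq => ?_⟩
    rcases Nat.lt_succ_iff_lt_or_eq.1 hq with hq | rfl
    exacts [h' q hq, hj]
  · refine Or.inr ⟨h, q, by omega, hqk, fun q' h1 h2 => ?_⟩
    rcases Nat.lt_succ_iff_lt_or_eq.1 h2 with h2 | rfl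
    exacts [h' q' h1 h2, hj]

theorem IsLast.new {j : ℕ} (hj : ord j < m) : IsLast m ord (j + 1) (ord j) :=
  Or.inr ⟨hj, j, by omega, rfl, fun q' h1 h2 => by omega⟩

/-- An entry of `A` equal to the key of `ord j` comes before `ord j`, because its index is smaller.
The last entry `k` of `A` before `ord j` lies between the two in key, so it has the same key and is
the same entry by distinctness. This reduces a search to one comparison. -/
theorem IsLast.attained_iff (h : SortedBlocks κ M M ord) (hmH : m ≤ H)
    (hinj : ∀ k < m, ∀ k' < m, κ k = κ k' → k = k') {bot : K} {b : ℕ → ℕ} {j k : ℕ}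
    (hl : IsLast m ord j k) (hj : j < M) (hHj : H ≤ ord j) :
    Attained m H κ bot b (ord j) ↔ κ (ord j) ≤ bot ∨
      k < m ∧ κ (ord j) ≤ κ k ∧ b (ord j - H + m * k) ≠ 0 := by
  refine or_congr Iff.rfl ⟨?_, ?_⟩
  · rintro ⟨k', hk', he, hb⟩
    have hlt := h.lt hj
    obtain ⟨q', hq', rfl⟩ := h.surj (show k' < M by omega)
    have hq'j := h.lt_of_before hq' (before_of_le he.le (by omega))
    rcases hl with ⟨-, hl⟩ | ⟨hkm, q, hq, rfl, hl⟩
    · have := hl q' hq'j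
      omega
    · have hqq' : q' ≤ q := by
        by_contra hcon
        have := hl q' (by omega) hq'j
        omega
      have hk : ord q = ord q' := by
        rcases hqq'.lt_or_eq with hlt' | rfl
        · refine hinj _ hkm _ hk' (le_antisymm ?_ (h.before hlt' (by omega)).le)
          rw [he]
          exact (h.before hq hj).le
        · rfl
      rw [hk]
      exact ⟨hk', he.ge, hb⟩
  · rintro ⟨hk, hle, hb⟩
    refine ⟨k, hk, le_antisymm ?_ hle, hb⟩
    rcases hl with ⟨h', -⟩ | ⟨-, q, hq, rfl, -⟩
    · omega
    · exact (h.before hq hj).le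

end Rank

/-! ### Processing the rows on the machine -/

section Programs

variable {K : Type*} [LinearOrder K] {Z : ℕ} {keys : ℕ → K} {n m L H : ℕ} {s : Memory}

/-- Lists the elements of the row in register 11 and the addresses of their keys. -/
def initProg : Prog :=
  forUp 13 (.reg 6)
    (.store 17 (.reg 13) (.reg 13) ;;
      .ite (.reg 7 - .reg 13) (.store 16 (.reg 13) (.reg 11 * .reg 1 + .reg 13))
        (.store 16 (.reg 13) (.reg 0 * .reg 1 + .reg 11 * .reg 1 + (.reg 13 - .reg 7))))

theorem runs_initProg {i : ℕ} (hb : Bounds n m L H Z) (h : Env n m L H s) (hi : i < n)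
    (h11 : s.reg 11 = i) :
    Runs Z keys initProg s (2 ^ L * 40 + 20) (fun s' =>
      (∀ x < 2 ^ L, s'.arr 17 x = x) ∧ ∀ x < 2 ^ L, s'.arr 16 x = rowAddr n m H i x) := by
  have hsz := hb.size_lt
  have hk := hb.keys
  have h2 := hb.two
  have him : i * m ≤ n * m := Nat.mul_le_mul_right _ hi.le
  refine Runs.forUp (2 ^ L) 30 (fun j s' => (∀ x < j, s'.arr 17 x = x) ∧
      ∀ x < j, s'.arr 16 x = rowAddr n m H i x)
    rfl rfl (by omega) (by simp [Expr.cost]; omega) (fun s' hf => ?_) (by simp) ?_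
    (fun s' _ _ h => h)
  · simp [hf.reg 6 rfl, h.r6]
  rintro j s' hj hs' hf hx ⟨hI1, hI2⟩
  have h0 : s'.reg 0 = n := (hf.reg 0 rfl).trans h.r0
  have h1 : s'.reg 1 = m := (hf.reg 1 rfl).trans h.r1
  have h7 : s'.reg 7 = H := (hf.reg 7 rfl).trans h.r7
  have h11' : s'.reg 11 = i := (hf.reg 11 rfl).trans h11
  have hZ : rowAddr n m H i j < Z := by unfold rowAddr; split_ifs <;> omega
  refine Runs.store_seq (i := j) (v := j) rfl rfl (by simp [hx]) (by simp [hx]) (by omega)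
    (by decide) ?_
  have hpost : (∀ x < j + 1, ((((s'.setCell 17 j j).setCell 16 j (rowAddr n m H i j)).setReg 13
      (j + 1)).arr 17 x = x)) ∧ ∀ x < j + 1, ((((s'.setCell 17 j j).setCell 16 j
        (rowAddr n m H i j)).setReg 13 (j + 1)).arr 16 x = rowAddr n m H i x) := by
    refine ⟨fun x hx' => ?_, fun x hx' => ?_⟩
    · by_cases hxj : x = j
      · simp [hxj]
      · simpa [hxj] using hI1 x (by omega)
    · by_cases hxj : x = j
      · simp [hxj]
      · simpa [hxj] using hI2 x (by omega)
  refine Runs.ite rfl (by decide) (fun hc => ?_) (fun hc => ?_)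
  · refine Runs.store (i := j) (v := rowAddr n m H i j) rfl rfl (by simp [hx]) ?_ hZ (by decide)
      hpost
    simp only [Expr.eval_sub, Expr.eval_reg, Memory.setCell_reg, h7, hx] at hc
    rw [rowAddr, if_pos (by omega)]
    simp [hx, h11', h1]
  · refine Runs.store (i := j) (v := rowAddr n m H i j) rfl rfl (by simp [hx]) ?_ hZ (by decide)
      hpost
    simp only [Expr.eval_sub, Expr.eval_reg, Memory.setCell_reg, h7, hx] at hc
    rw [rowAddr, if_neg (by omega)]
    simp [hx, h11', h1, h0, h7]

/-- Inverts the sorted list in array 17, marks the last layer of the network, and checks that the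
entries of `C` are attained. -/
def scanProg : Prog :=
  .assign 19 (.reg 6) ;;
  forUp 13 (.reg 6)
    (.assign 16 (.cell 17 (.reg 13)) ;; .store 18 (.reg 16) (.reg 13) ;;
      .assign 21 (.reg 12 + (.reg 8 * .reg 6 + .reg 13) * 2) ;;
      .store 5 (.reg 21) 0 ;; .store 5 (.reg 21 + .reg 9) 0 ;;
      .ite (.reg 7 - .reg 16) (.ite (.reg 1 - .reg 16) (.assign 19 (.reg 16)) .skip)
        (.ite (.reg 7 + .reg 1 - .reg 16)
          (.ite (.keyLe (.cell 16 (.reg 16)) (.reg 0 * .reg 1 * 2) +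
              (.reg 1 - .reg 19) * .keyLe (.cell 16 (.reg 16)) (.cell 16 (.reg 19)) *
                .cell 0 (.reg 16 - .reg 7 + .reg 1 * .reg 19))
            .skip (.store 9 (.reg 12) 0))
          .skip))

theorem runs_scanProg {R : ℕ} {κ : ℕ → K} {ord : ℕ → ℕ} (hb : Bounds n m L H Z)
    (h : Env n m L H s) (h12 : s.reg 12 = R) (hR : R + half L (2 ^ L) * 2 < Z)
    (hκ : ∀ e, κ e = keys (s.arr 16 e)) (h17 : s.arr 17 = ord)
    (hs : SortedBlocks κ (2 ^ L) (2 ^ L) ord)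
    (hinj : ∀ k < m, ∀ k' < m, κ k = κ k' → k = k') :
    Runs Z keys scanProg s (2 ^ L * 120 + 20) (fun s' =>
      (∀ q < 2 ^ L, s'.arr 18 (ord q) = q) ∧
      (∀ a, s'.arr 5 a = 0 ↔ s.arr 5 a = 0 ∨ ∃ q < 2 ^ L,
        a = R + node (2 ^ L) (L * 2) q 0 ∨ a = R + node (2 ^ L) (L * 2) q 0 + half L (2 ^ L)) ∧
      ∀ a, s'.arr 9 a = 0 ↔ s.arr 9 a = 0 ∨ a = R ∧ ∃ q < 2 ^ L, H ≤ ord q ∧ ord q < H + m ∧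
        ¬ Attained m H κ (keys (n * m * 2)) (s.arr 0) (ord q)) := by
  have hlit := hb.lit
  have hsz := hb.size_lt
  have hlt := hb.lt
  have h2 := hb.two
  -- The value `2 ^ L` is at least `m` and stands for the absence of an entry of `A` so far.
  refine Runs.assign_seq (v := 2 ^ L) rfl (by simp [h.r6]) (by omega) (by simp [Expr.cost]) ?_
  refine Runs.forUp (2 ^ L) 105 (fun j s' => (∀ q < j, s'.arr 18 (ord q) = q) ∧
      (∀ a, s'.arr 5 a = 0 ↔ s.arr 5 a = 0 ∨ ∃ q < j,
        a = R + node (2 ^ L) (L * 2) q 0 ∨ a = R + node (2 ^ L) (L * 2) q 0 + half L (2 ^ L)) ∧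
      (∀ a, s'.arr 9 a = 0 ↔ s.arr 9 a = 0 ∨ a = R ∧ ∃ q < j, H ≤ ord q ∧ ord q < H + m ∧
        ¬ Attained m H κ (keys (n * m * 2)) (s.arr 0) (ord q)) ∧ IsLast m ord j (s'.reg 19))
    rfl rfl (by omega) (by simp [Expr.cost]; omega) (fun s' hf => ?_) ?_ ?_
    (fun s' _ _ h => ⟨h.1, h.2.1, h.2.2.1⟩)
  · simp [hf.reg 6 rfl, h.r6]
  · refine ⟨by simp, by simp, by simp, Or.inl ⟨?_, by simp⟩⟩
    simp only [Memory.setReg_reg, Nat.reduceEqDiff, if_false, if_true]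
    omega
  rintro j s' hj hs' hf hx ⟨hI1, hI2, hI3, hI4⟩
  have h0 : s'.reg 0 = n := by simp [hf.reg 0 rfl, h.r0]
  have h1 : s'.reg 1 = m := by simp [hf.reg 1 rfl, h.r1]
  have h6 : s'.reg 6 = 2 ^ L := by simp [hf.reg 6 rfl, h.r6]
  have h7 : s'.reg 7 = H := by simp [hf.reg 7 rfl, h.r7]
  have h8 : s'.reg 8 = L * 2 := by simp [hf.reg 8 rfl, h.r8]
  have h9 : s'.reg 9 = half L (2 ^ L) := by simp [hf.reg 9 rfl, h.r9]
  have h12' : s'.reg 12 = R := by simp [hf.reg 12 rfl, h12]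
  have ha0 : s'.arr 0 = s.arr 0 := hf.arr 0 rfl
  have ha16 : s'.arr 16 = s.arr 16 := hf.arr 16 rfl
  have ha17 : s'.arr 17 = ord := (hf.arr 17 rfl).trans h17
  have hordlt := hs.lt hj
  have hnode : node (2 ^ L) (L * 2) j 0 < half L (2 ^ L) := node_lt_half le_rfl hj (by norm_num)
  refine Runs.assign_seq (v := ord j) rfl (by simp [hx, ha17]) (by omega) (by decide) ?_
  refine Runs.store_seq (i := ord j) (v := j) rfl rfl (by simp) (by simp [hx]) (by omega)
    (by decide) ?_
  refine Runs.assign_seq (v := R + node (2 ^ L) (L * 2) j 0) rfl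
    (by simp [hx, h12', h8, h6, node]) (by omega) (by decide) ?_
  refine Runs.store_seq (i := R + node (2 ^ L) (L * 2) j 0) (v := 0) rfl rfl (by simp) (by simp)
    (by omega) (by decide) ?_
  refine Runs.store_seq (i := R + node (2 ^ L) (L * 2) j 0 + half L (2 ^ L)) (v := 0) rfl rfl
    (by simp [h9]) (by simp) (by omega) (by decide) ?_
  -- All branches below start in this memory. The facts needed about it are collected before
  -- splitting.
  generalize hs₁ : Memory.setCell _ 5 (R + node (2 ^ L) (L * 2) j 0 + half L (2 ^ L)) 0 = s₁
  have g0 : s₁.reg 0 = n := by simp [← hs₁, h0]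
  have g1 : s₁.reg 1 = m := by simp [← hs₁, h1]
  have g7 : s₁.reg 7 = H := by simp [← hs₁, h7]
  have g12 : s₁.reg 12 = R := by simp [← hs₁, h12']
  have g16 : s₁.reg 16 = ord j := by simp [← hs₁]
  have g19 : s₁.reg 19 = s'.reg 19 := by simp [← hs₁]
  have ga0 : s₁.arr 0 = s.arr 0 := by simp [← hs₁, ha0]
  have ga16 : s₁.arr 16 = s.arr 16 := by simp [← hs₁, ha16]
  have ga9 : s₁.arr 9 = s'.arr 9 := by simp [← hs₁]
  have p1 : ∀ q < j + 1, s₁.arr 18 (ord q) = q := by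
    intro q hq
    by_cases hqj : q = j
    · simp [← hs₁, hqj]
    · have hne : ord q ≠ ord j := fun e => hqj (hs.inj (by omega) hj e)
      simpa [← hs₁, hne] using hI1 q (by omega)
  have p2 : ∀ a, s₁.arr 5 a = 0 ↔ s.arr 5 a = 0 ∨ ∃ q < j + 1,
      a = R + node (2 ^ L) (L * 2) q 0 ∨ a = R + node (2 ^ L) (L * 2) q 0 + half L (2 ^ L) := by
    intro a
    rw [Nat.exists_lt_succ_right, ← or_assoc, ← hI2]
    simp only [← hs₁, Memory.setReg_arr, Memory.setCell_arr, Nat.reduceEqDiff, if_false, if_true,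
      Function.update_apply]
    split_ifs <;> simp_all
  have p3 : (H ≤ ord j → ord j < H + m →
        Attained m H κ (keys (n * m * 2)) (s.arr 0) (ord j)) →
      ∀ a, s₁.arr 9 a = 0 ↔ s.arr 9 a = 0 ∨ a = R ∧ ∃ q < j + 1, H ≤ ord q ∧ ord q < H + m ∧
        ¬ Attained m H κ (keys (n * m * 2)) (s.arr 0) (ord q) := by
    intro hatt a
    rw [Nat.exists_lt_succ_right, ga9, hI3]
    have : ¬ (H ≤ ord j ∧ ord j < H + m ∧
        ¬ Attained m H κ (keys (n * m * 2)) (s.arr 0) (ord j)) := by tauto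
    simp only [this, or_false]
  refine Runs.ite rfl (by decide) (fun hc => ?_) (fun hc => ?_)
  · simp only [Expr.eval_sub, Expr.eval_reg, g7, g16] at hc
    refine Runs.ite rfl (by decide) (fun hc' => ?_) (fun hc' => ?_)
    · simp only [Expr.eval_sub, Expr.eval_reg, g1, g16] at hc'
      refine Runs.assign (v := ord j) rfl (by simp [g16]) (by omega) (by decide) ?_
      refine ⟨by simpa using p1, by simpa using p2, by simpa using p3 (fun _ => by omega), ?_⟩
      simpa using IsLast.new (m := m) (show ord j < m by omega)
    · simp only [Expr.eval_sub, Expr.eval_reg, g1, g16] at hc'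
      refine Runs.skip (by decide) ⟨by simpa using p1, by simpa using p2,
        by simpa using p3 (fun _ => by omega), ?_⟩
      simpa [g19] using hI4.succ (by omega)
  · simp only [Expr.eval_sub, Expr.eval_reg, g7, g16] at hc
    have hHj : H ≤ ord j := by omega
    have hlast : IsLast m ord (j + 1) (s'.reg 19) := hI4.succ (by omega)
    -- The tested expression is the right-hand side of this equivalence, with a sum for the
    -- disjunction and products for the conjunctions.
    have hiff := hI4.attained_iff hs hlt.le hinj (bot := keys (n * m * 2)) (b := s.arr 0) hj hHj
    refine Runs.ite rfl (by decide) (fun hc' => ?_) (fun hc' => ?_)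
    · simp only [Expr.eval_sub, Expr.eval_add, Expr.eval_reg, g7, g1, g16] at hc'
      refine Runs.ite rfl (by decide) (fun hc'' => ?_) (fun hc'' => ?_)
      · have hatt : Attained m H κ (keys (n * m * 2)) (s.arr 0) (ord j) := by
          rw [hiff]
          simp only [Expr.eval_sub, Expr.eval_add, Expr.eval_mul, Expr.eval_keyLe, Expr.eval_cell,
            Expr.eval_reg, Expr.eval_ofNat, g7, g1, g0, g16, g19, ga0, ga16, ← hκ] at hc''
          by_cases h3 : κ (ord j) ≤ keys (n * m * 2)
          · exact Or.inl h3
          · rw [if_neg h3, zero_add] at hc''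
            have hb := right_ne_zero_of_mul hc''
            have ha := left_ne_zero_of_mul (left_ne_zero_of_mul hc'')
            have hk := right_ne_zero_of_mul (left_ne_zero_of_mul hc'')
            refine Or.inr ⟨by omega, ?_, hb⟩
            by_contra hcon
            exact hk (if_neg hcon)
        exact Runs.skip (by decide) ⟨by simpa using p1, by simpa using p2,
          by simpa using p3 (fun _ _ => hatt), by simpa [g19] using hlast⟩
      · simp only [Expr.eval_sub, Expr.eval_add, Expr.eval_mul, Expr.eval_keyLe, Expr.eval_cell,
          Expr.eval_reg, Expr.eval_ofNat, g7, g1, g0, g16, g19, ga0, ga16, ← hκ,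
          Nat.add_eq_zero_iff, mul_eq_zero] at hc''
        have hnot : ¬ Attained m H κ (keys (n * m * 2)) (s.arr 0) (ord j) := by
          rw [hiff]
          rintro (h3 | ⟨h3, h4, h5⟩)
          · simp [h3] at hc''
          · rcases hc''.2 with (h6 | h6) | h6
            · omega
            · simp [h4] at h6
            · exact h5 h6
        refine Runs.store (i := R) (v := 0) rfl rfl (by simp [g12]) (by simp) (by omega)
          (by decide) ⟨by simpa using p1, by simpa using p2, ?_, by simpa [g19] using hlast⟩
        intro a
        rw [Nat.exists_lt_succ_right]
        simp only [Memory.setReg_arr, Memory.setCell_arr, if_true, Function.update_apply, ga9]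
        by_cases ha : a = R
        · simp only [ha, if_true, true_and, true_iff]
          exact Or.inr (Or.inr ⟨hHj, by omega, hnot⟩)
        · simp [ha, hI3]
    · simp only [Expr.eval_sub, Expr.eval_add, Expr.eval_reg, g7, g1, g16] at hc'
      refine Runs.skip (by decide) ⟨by simpa using p1, by simpa using p2,
        by simpa using p3 (fun _ => by omega), ?_⟩
      simpa [g19] using hlast

/-- The tables contain the routes of an order of the elements of row `i`. -/
def RowRouted (L : ℕ) (κ : ℕ → K) (live : ℕ → Prop) : Prop :=
  ∃ rank pos, Routing L rank pos ∧ (∀ e < 2 ^ L, ∀ f < 2 ^ L, Before κ e f → rank e < rank f) ∧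
    (∀ q < 2 ^ L, ∃ e < 2 ^ L, rank e = q) ∧ ∀ v, live v ↔ Live L pos v

/-- Treats the row in register 11. -/
def rowProg : Prog :=
  .assign 12 (.reg 11 * .reg 2) ;; initProg ;; sortProg ;; scanProg ;; routeProg

theorem Before.congr {κ κ' : ℕ → K} {e f : ℕ} (h : Before κ e f) (he : κ' e = κ e)
    (hf : κ' f = κ f) : Before κ' e f := by
  rwa [Before, he, hf]

/-- Padding elements may read keys from other rows or from the end of the store. This is harmless:
they only occupy ranks, and no matrix edge touches them. -/
theorem runs_rowProg {i : ℕ} (hb : Bounds n m L H Z) (h : Env n m L H s) (hp : PowTable L s)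
    (hi : i < n) (h11 : s.reg 11 = i)
    (hinj : ∀ k < m, ∀ k' < m, keys (i * m + k) = keys (i * m + k') → k = k') :
    Runs Z keys rowProg s (L * 2 ^ L * 1200 + 200) (fun s' =>
      (∃ live, RowRouted L (fun e => keys (rowAddr n m H i e)) live ∧
        ∀ a, s'.arr 5 a = 0 ↔ s.arr 5 a = 0 ∨
          ∃ v, live v ∧ a = v + (half L (2 ^ L) * 2 + 1) * i) ∧
      ∀ a, s'.arr 9 a = 0 ↔ s.arr 9 a = 0 ∨ a = (half L (2 ^ L) * 2 + 1) * i ∧ ∃ j < m,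
        ¬ Attained m H (fun e => keys (rowAddr n m H i e)) (keys (n * m * 2)) (s.arr 0)
          (H + j)) := by
  have hlit := hb.lit
  have hlt := hb.lt
  have h2 := hb.two
  have hL := hb.pos
  have hcells := hb.cells
  have hR : (half L (2 ^ L) * 2 + 1) * i + half L (2 ^ L) * 2 < Z := by
    have : (half L (2 ^ L) * 2 + 1) * (i + 1) ≤ (half L (2 ^ L) * 2 + 1) * (n + 1) :=
      Nat.mul_le_mul_left _ (by omega)
    rw [Nat.mul_succ] at this
    rw [mul_comm (n + 1)] at hcells
    omega
  have t1 : L * (2 ^ L * 105 + 60) = L * 2 ^ L * 105 + L * 60 := by ring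
  have t2 : L * (2 ^ L * 500 + 200) = L * 2 ^ L * 500 + L * 200 := by ring
  have t3 : L ≤ L * 2 ^ L := Nat.le_mul_of_pos_right _ (by positivity)
  have t4 : 2 ^ L ≤ L * 2 ^ L := Nat.le_mul_of_pos_left _ hL
  generalize hRdef : (half L (2 ^ L) * 2 + 1) * i = R at hR ⊢
  refine Runs.assign_seq (v := R) rfl (by simp [h11, h.r2, ← hRdef, mul_comm]) (by omega)
    (by simp [Expr.cost]) ?_
  have hE : Env n m L H (s.setReg 12 R) := by
    constructor <;> simp [h.r0, h.r1, h.r2, h.r5, h.r6, h.r7, h.r8, h.r9]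
  refine Runs.seq (2 ^ L * 40 + 20) (L * 2 ^ L * 1160 + 170) (runs_initProg hb hE hi (by simp [h11]))
    ?_ (by simp [Expr.cost]; omega)
  rintro s₁ hs₁ hf₁ ⟨h17, h16⟩
  have hE₁ := hE.frame hf₁ rfl
  refine Runs.seq (L * (2 ^ L * 105 + 60) + 20) (L * 2 ^ L * 820 + 100)
    (runs_sortProg (κ := fun e => keys (s₁.arr 16 e)) hb hE₁ (fun _ => rfl) h17) ?_ (by omega)
  intro s₂ hs₂ hf₂ hS
  have hE₂ := hE₁.frame hf₂ rfl
  have h12 : s₂.reg 12 = R := by simp [hf₂.reg 12 rfl, hf₁.reg 12 rfl]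
  have hkey : ∀ e < 2 ^ L, keys (s₁.arr 16 e) = keys (rowAddr n m H i e) := fun e he => by
    rw [h16 e he]
  have haddr : ∀ k < m, rowAddr n m H i k = i * m + k := fun k hk => if_pos (by omega)
  refine Runs.seq (2 ^ L * 120 + 20) (L * (2 ^ L * 500 + 200) + 20)
    (runs_scanProg (κ := fun e => keys (s₁.arr 16 e)) hb hE₂ h12 hR
      (fun e => by rw [hf₂.arr 16 rfl]) rfl hS ?_) ?_ (by omega)
  · intro k hk k' hk' he
    simp only [hkey k (by omega), hkey k' (by omega), haddr k hk, haddr k' hk'] at he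
    exact hinj k hk k' hk' he
  rintro s₃ hs₃ hf₃ ⟨h18, h5, h9⟩
  have hE₃ := hE₂.frame hf₃ rfl
  have hperm := hS.isPerm h18
  have hp₃ : PowTable L s₃ :=
    (((show PowTable L (s.setReg 12 R) from hp).frame hf₁ rfl).frame hf₂ rfl).frame hf₃ rfl
  refine Runs.weaken (runs_routeProg hb hE₃ hp₃ (by rw [hf₃.reg 12 rfl, h12]) hR hperm rfl
    (hf₃.arr 17 rfl)) le_rfl ?_
  rintro s₄ hs₄ hf₄ ⟨pos, hpos, h5'⟩
  refine ⟨⟨Live L pos, ⟨s₃.arr 18, pos, hpos, ?_, ?_, fun _ => Iff.rfl⟩, ?_⟩, ?_⟩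
  · intro e he f hf hbe
    obtain ⟨q, hq, rfl⟩ := hS.surj he
    obtain ⟨q', hq', rfl⟩ := hS.surj hf
    rw [h18 q hq, h18 q' hq']
    exact hS.lt_of_before hq (hbe.congr (hkey _ he) (hkey _ hf))
  · exact fun q hq => ⟨s₂.arr 17 q, hS.lt hq, h18 q hq⟩
  · intro a
    rw [h5', h5, hf₂.arr 5 rfl, hf₁.arr 5 rfl, or_assoc]
    refine or_congr Iff.rfl ⟨?_, ?_⟩
    -- The last layer contains no switch and every position in it is live with direction `0`; it was
    -- marked during the scan, the other layers during the routing.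
    · rintro (⟨q, hq, ha⟩ | ⟨t, e, ht, he, ha⟩)
      · have hl := hpos.last _ (hS.lt hq)
        rw [h18 q hq] at hl
        have hd : direction L pos (L * 2) (s₂.arr 17 q) = 0 := if_neg (lt_irrefl _)
        rcases ha with rfl | rfl
        · exact ⟨_, ⟨L * 2, _, le_rfl, hS.lt hq, Or.inl rfl⟩, by rw [hl, hd]; omega⟩
        · exact ⟨_, ⟨L * 2, _, le_rfl, hS.lt hq, Or.inr rfl⟩, by rw [hl, hd]; omega⟩
      · have ht' : t ≤ L * 2 := by unfold Routed at ht; omega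
        rcases ha with rfl | rfl
        · exact ⟨_, ⟨t, e, ht', he, Or.inl rfl⟩, by omega⟩
        · exact ⟨_, ⟨t, e, ht', he, Or.inr rfl⟩, by omega⟩
    · rintro ⟨v, ⟨t, e, ht, he, hv⟩, rfl⟩
      rcases ht.lt_or_eq with hlt | rfl
      · refine Or.inr ⟨t, e, by unfold Routed; omega, he, ?_⟩
        omega
      · have hd : direction L pos (L * 2) e = 0 := if_neg (lt_irrefl _)
        refine Or.inl ⟨pos (L * 2) e, hpos.lt _ _ le_rfl he, ?_⟩
        rw [hd] at hv
        omega
  · intro a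
    rw [hf₄.arr 9 rfl, h9, hf₂.arr 9 rfl, hf₁.arr 9 rfl, hf₂.arr 0 rfl, hf₁.arr 0 rfl]
    have hatt : ∀ e, H ≤ e → e < H + m →
        (Attained m H (fun e => keys (s₁.arr 16 e)) (keys (n * m * 2)) ((s.setReg 12 R).arr 0) e ↔
        Attained m H (fun e => keys (rowAddr n m H i e)) (keys (n * m * 2)) (s.arr 0) e) := by
      intro e h1 h2
      unfold Attained
      simp only [hkey e (by omega), Memory.setReg_arr]
      refine or_congr Iff.rfl (exists_congr fun k => and_congr_right fun hk => ?_)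
      rw [hkey k (by omega)]
    refine or_congr Iff.rfl (and_congr_right fun _ => ⟨?_, ?_⟩)
    · rintro ⟨q, hq, h1, h2, h3⟩
      refine ⟨s₂.arr 17 q - H, by omega, ?_⟩
      rw [Nat.add_sub_cancel' h1]
      rwa [hatt _ h1 h2] at h3
    · rintro ⟨j, hj, h3⟩
      obtain ⟨q, hq, hqe⟩ := hS.surj (show H + j < 2 ^ L by omega)
      refine ⟨q, hq, by omega, by omega, ?_⟩
      rwa [hqe, hatt _ (by omega) (by omega)]

/-- Treats all rows. -/
def rowsProg : Prog := forUp 11 (.reg 0) rowProg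

theorem runs_rowsProg (hb : Bounds n m L H Z) (h : Env n m L H s) (hp : PowTable L s)
    (hinj : ∀ i < n, ∀ k < m, ∀ k' < m, keys (i * m + k) = keys (i * m + k') → k = k')
    (h5 : ∀ a < n * (half L (2 ^ L) * 2 + 1), s.arr 5 a = 1)
    (h9 : ∀ a < n * (half L (2 ^ L) * 2 + 1), s.arr 9 a = 1) :
    Runs Z keys rowsProg s (n * (L * 2 ^ L * 1200 + 220) + 20) (fun s' =>
      (∀ i < n, ∃ live, RowRouted L (fun e => keys (rowAddr n m H i e)) live ∧
        ∀ v < half L (2 ^ L) * 2 + 1, s'.arr 5 (v + (half L (2 ^ L) * 2 + 1) * i) = 0 ↔ live v) ∧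
      ∀ a < n * (half L (2 ^ L) * 2 + 1), s'.arr 9 a = 0 ↔
        ∃ i < n, a = (half L (2 ^ L) * 2 + 1) * i ∧ ∃ j < m,
        ¬ Attained m H (fun e => keys (rowAddr n m H i e)) (keys (n * m * 2)) (s.arr 0)
          (H + j)) := by
  have hlit := hb.lit
  have hn := hb.verts
  generalize hN : half L (2 ^ L) * 2 + 1 = N at h5 h9 ⊢
  -- The second clause says that cells of later rows are still unmarked, so all marks found in row
  -- `i` afterwards come from its own treatment.
  refine Runs.forUp n (L * 2 ^ L * 1200 + 200) (fun i s' =>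
      (∀ i' < i, ∃ live, RowRouted L (fun e => keys (rowAddr n m H i' e)) live ∧
        ∀ v < N, s'.arr 5 (v + N * i') = 0 ↔ live v) ∧
      (∀ a, N * i ≤ a → a < n * N → s'.arr 5 a ≠ 0) ∧
      ∀ a < n * N, s'.arr 9 a = 0 ↔ ∃ i' < i, a = N * i' ∧ ∃ j < m,
        ¬ Attained m H (fun e => keys (rowAddr n m H i' e)) (keys (n * m * 2)) (s.arr 0) (H + j))
    rfl rfl hn (by simp [Expr.cost]; ring_nf; omega) (fun s' hf => ?_) ?_ ?_
    (fun s' _ _ h => ⟨h.1, h.2.2⟩)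
  · simp [hf.reg 0 rfl, h.r0]
  · refine ⟨by simp, fun a _ ha => ?_, fun a ha => ?_⟩
    · simp [h5 a ha]
    · simp [h9 a ha]
  rintro i s' hi hs' hf hx ⟨hI1, hI2, hI3⟩
  have hE := h.frame hf rfl
  refine Runs.weaken (runs_rowProg hb hE (hp.frame hf rfl) hi hx (hinj i hi)) le_rfl ?_
  rw [hN]
  rintro s₁ - - ⟨⟨live, hlive, h5₁⟩, h9₁⟩
  have hNn : ∀ i' < n, N * i' + N ≤ n * N := by
    intro i' hi'
    rw [← Nat.mul_succ, mul_comm n]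
    exact Nat.mul_le_mul_left _ hi'
  have hvN : ∀ v, live v → v < N := by
    intro v hv
    obtain ⟨rank, pos, hpos, -, -, hl⟩ := hlive
    obtain ⟨t, e, ht, he, hv⟩ := (hl v).1 hv
    have := node_lt_half ht (hpos.lt t e ht he) (direction_lt_two (L := L) (pos := pos) (t := t)
      (e := e))
    omega
  refine ⟨?_, ?_, ?_⟩
  · intro i' hi'
    simp only [Memory.setReg_arr]
    rcases Nat.lt_succ_iff_lt_or_eq.1 hi' with hlt | rfl
    · obtain ⟨live', hl', h5'⟩ := hI1 i' hlt
      refine ⟨live', hl', fun v hv => ?_⟩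
      rw [h5₁, h5' v hv, or_iff_left]
      rintro ⟨v', -, he⟩
      have : N * (i' + 1) ≤ N * i := Nat.mul_le_mul_left _ hlt
      rw [Nat.mul_succ] at this
      omega
    · refine ⟨live, hlive, fun v hv => ?_⟩
      rw [h5₁, or_iff_right (hI2 _ (by omega) (by have := hNn i' hi; omega))]
      constructor
      · rintro ⟨v', hv', he⟩
        rwa [show v = v' by omega]
      · exact fun hv' => ⟨v, hv', rfl⟩
  · intro a ha ha'
    rw [Nat.mul_succ] at ha
    simp only [Memory.setReg_arr, ne_eq, h5₁, not_or]
    refine ⟨hI2 a (by omega) ha', ?_⟩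
    rintro ⟨v, hv, rfl⟩
    have := hvN v hv
    omega
  · intro a ha
    simp only [Memory.setReg_arr]
    rw [h9₁, hI3 a ha, Nat.exists_lt_succ_right, hf.arr 0 rfl]

end Programs

end TwoTokens

namespace TwoTokens

/-! ## The instance of the game that verifies a product -/

/-- The game in which Alice can only wait. The claims are that Alice wins everywhere, except that
her surviving set is claimed not to contain the configurations in `bad`. -/
noncomputable def waitingClaim {V₀ V₁ : Type*} (live : V₀ → V₁ → Prop) (adj : V₁ → V₁ → Prop)
    (bad : V₀ → V₁ → Prop) : WinningSetClaim V₀ V₁ where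
  game :=
    { G₀ := ⟨Eq⟩
      G₁ := ⟨adj⟩
      final := fun σ => match σ with
        | .aliceTurn u v => open Classical in if live u v then .bob else .alice
        | .bobTurn _ _ => .alice }
  win P := match P with
    | .alice => Set.univ
    | .bob => ∅
  survive P := match P with
    | .alice => {σ | ∀ u v, bad u v → σ ≠ .aliceTurn u v}
    | .bob => ∅

section WaitingClaim

variable {V₀ V₁ : Type*} {live : V₀ → V₁ → Prop} {adj : V₁ → V₁ → Prop} {bad : V₀ → V₁ → Prop}

theorem isWaiting_waitingClaim : (waitingClaim live adj bad).game.IsWaiting live where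
  adj _ _ := Iff.rfl
  final_bob _ _ := rfl
  final_alice u v := by simp only [waitingClaim]; split_ifs <;> simp_all

/-- If Alice wins everywhere, then Bob's surviving set is empty by disjointness, and the inclusions
of winning in surviving sets settle the other claims. No determinacy theorem is needed. -/
theorem exists_notMem_winningSet_waitingClaim (h : ¬ (waitingClaim live adj bad).IsCorrect)
    (hbad : ∀ u v, ¬ bad u v) :
    ∃ σ, σ ∉ (waitingClaim live adj bad).game.toReachGame.winningSet .alice := by
  set G := (waitingClaim live adj bad).game.toReachGame with hG
  by_contra! hall
  have hw : G.winningSet .alice = Set.univ := Set.eq_univ_of_forall hall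
  have hs : G.survivingSet .bob = ∅ := by
    have := G.disjoint_winningSet_survivingSet (P := .alice) (Q := .bob) (by simp)
    rwa [hw, Set.univ_disjoint] at this
  refine h fun P => ?_
  cases P
  · refine ⟨hw.symm, (Set.eq_univ_of_forall fun σ u v huv => absurd huv (hbad u v)).trans ?_⟩
    exact (Set.univ_subset_iff.1 (hw ▸ G.winningSet_subset_survivingSet .alice)).symm
  · exact ⟨(Set.subset_empty_iff.1 (hs ▸ G.winningSet_subset_survivingSet .bob)).symm, hs.symm⟩

end WaitingClaim

/-! ### Invalid triangles and the waiting game on the network -/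

section Verification

variable {n N : ℕ} {L H m : ℕ} {B : ℕ → ℕ → Prop}

theorem NetEdge.lt {u v : ℕ} (hHm : H + m ≤ 2 ^ L) (h : NetEdge L (2 ^ L) H m B u v) :
    u < half L (2 ^ L) * 2 + 1 ∧ v < half L (2 ^ L) * 2 + 1 := by
  have hset : ∀ {t p b}, t < L * 2 → p < 2 ^ L → b < 2 →
      setBit (2 ^ layerBit L t) p b < 2 ^ L := fun ht hp hb =>
    setBit_lt (by positivity) (two_pow_layerBit_dvd ht) hb hp
  cases h with
  | forward t p b b' ht hp hb hb' =>
    have h1 := node_lt_half ht.le hp hb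
    have h2 := node_lt_half (L := L) (M := 2 ^ L) (t := t + 1) ht (hset ht hp hb) hb'
    omega
  | backward t p b b' ht hp hb hb' =>
    have h1 := node_lt_half ht.le hp hb
    have h2 := node_lt_half (L := L) (M := 2 ^ L) (t := t + 1) ht (hset ht hp hb) hb'
    omega
  | cross q hq =>
    have h1 := node_lt_half (L := L) le_rfl hq (b := 0) (by norm_num)
    omega
  | line q hq =>
    have h1 := node_lt_half (L := L) le_rfl hq (b := 1) (by norm_num)
    unfold node at *
    omega
  | matrix k j b b' hk hj hb hb' h =>
    have h1 := node_lt_half (L := L) (M := 2 ^ L) (Nat.zero_le _) (show k < 2 ^ L by omega) hb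
    have h2 := node_lt_half (L := L) (M := 2 ^ L) (Nat.zero_le _) (show H + j < 2 ^ L by omega) hb'
    omega

variable {K : Type*} [LinearOrder K] {κ : ℕ → ℕ → K} {live : ℕ → ℕ → Prop}

/-- The keys violate no inequality that the matrix prescribes if and only if Alice wins the
waiting game on the network everywhere. -/
theorem waitingClaim_isCorrect_and_survivingSet (hL : 0 < L) (hHm : H + m ≤ 2 ^ L) (hmH : m ≤ H)
    (hlive : ∀ i < n, RowRouted L (κ i) (live i)) {bad : Fin n → Fin N → Prop}
    (hN : half L (2 ^ L) * 2 + 1 = N) :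
    let I := waitingClaim (fun (u : Fin n) (v : Fin N) => live u v)
      (fun u v => NetEdge L (2 ^ L) H m B u v) bad
    (I.IsCorrect ↔ (∀ i < n, ∀ k < m, ∀ j < m, B k j → κ i k ≤ κ i (H + j)) ∧
      ∀ u v, ¬ bad u v) ∧
    ((∃ σ, σ ∈ I.game.toReachGame.survivingSet .bob) ↔
      ∃ i < n, ∃ k < m, ∃ j < m, B k j ∧ κ i (H + j) < κ i k) := by
  intro I
  have hwait : I.game.IsWaiting _ := isWaiting_waitingClaim
  have hpos : (∀ i < n, ∀ k < m, ∀ j < m, B k j → κ i k ≤ κ i (H + j)) →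
      ∀ σ, σ ∈ I.game.toReachGame.winningSet .alice := by
    intro hle
    refine hwait.mem_winningSet fun u => ?_
    obtain ⟨rank, pos, hR, hrank, -, hl⟩ := hlive u u.2
    -- Equal keys count as valid: the tie is broken by the index, and `k` is smaller than `H + j`.
    obtain ⟨Φ, hΦ⟩ := hR.exists_potential (B := B) hHm fun k j hk hj hB =>
      hrank _ (by omega) _ (by omega) (before_of_le (hle u u.2 k hk j hj hB) (by omega))
    refine ⟨fun v => Φ v, Finset.univ.sup fun v : Fin N => Φ v,
      fun v => Finset.le_sup (f := fun v : Fin N => Φ v) (Finset.mem_univ v), ?_⟩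
    intro v v' hv hv' hadj
    exact hΦ _ _ ((hl _).1 hv) ((hl _).1 hv') hadj
  have hneg : (∃ i < n, ∃ k < m, ∃ j < m, B k j ∧ κ i (H + j) < κ i k) →
      ∃ σ, σ ∈ I.game.toReachGame.survivingSet .bob := by
    rintro ⟨i, hi, k, hk, j, hj, hB, hlt⟩
    obtain ⟨rank, pos, hR, hrank, hsurj, hl⟩ := hlive i hi
    obtain ⟨X, ⟨v, hv⟩, hX⟩ := hR.exists_trap hL hHm hk hj hB hsurj
      (hrank _ (by omega) _ (by omega) (Or.inl hlt)).le
    have hXN : ∀ v ∈ X, v < N := by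
      intro v hv
      obtain ⟨-, v', -, he⟩ := hX v hv
      exact hN ▸ (he.lt hHm).1
    refine ⟨_, hwait.mem_survivingSet (u := ⟨i, hi⟩) (X := {v : Fin N | (v : ℕ) ∈ X}) ?_
      (v := ⟨v, hXN v hv⟩) hv⟩
    intro v hv
    obtain ⟨hvl, v', hv', he⟩ := hX v hv
    exact ⟨(hl _).2 hvl, ⟨v', hXN v' hv'⟩, hv', he⟩
  have hdisj := I.game.toReachGame.disjoint_winningSet_survivingSet (P := .alice) (Q := .bob)
    (by simp)
  refine ⟨⟨fun hI => ⟨?_, ?_⟩, ?_⟩, ?_, hneg⟩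
  · by_contra! hcon
    obtain ⟨i, hi, k, hk, j, hj, hB, hlt⟩ := hcon
    obtain ⟨σ, hσ⟩ := hneg ⟨i, hi, k, hk, j, hj, hB, hlt⟩
    rw [← (hI .bob).2] at hσ
    exact hσ
  · intro u v huv
    -- Everything is claimed to be winning for Alice, hence must be surviving; a removed
    -- configuration contradicts this whatever the game is.
    have h1 : Config.aliceTurn u v ∈ I.survive .alice := by
      rw [(hI .alice).2]
      exact I.game.toReachGame.winningSet_subset_survivingSet _
        ((hI .alice).1 ▸ Set.mem_univ (Config.aliceTurn u v))
    exact h1 u v huv rfl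
  · rintro ⟨hle, hbad⟩
    by_contra hI
    obtain ⟨σ, hσ⟩ := exists_notMem_winningSet_waitingClaim hI hbad
    exact hσ (hpos hle σ)
  · rintro ⟨σ, hσ⟩
    by_contra! hcon
    exact Set.disjoint_left.1 hdisj (hpos hcon σ) hσ

end Verification

/-! ## Input -/

section Input

variable {n m : ℕ} {α : Type*} {A : Matrix (Fin n) (Fin m) α} {C : Matrix (Fin n) (Fin m) (WithBot α)}
  {B : Matrix (Fin m) (Fin m) Bool}

theorem val_lt_mul (i : Fin n) (k : Fin m) : (i : ℕ) * m + k < n * m := by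
  have := Nat.mul_le_mul_right m i.2
  rw [Nat.succ_mul] at this
  omega

theorem finProdFinEquiv_symm_mk (i : Fin n) (k : Fin m) {h : (i : ℕ) * m + k < n * m} :
    finProdFinEquiv.symm ⟨i * m + k, h⟩ = (i, k) := by
  rw [Equiv.symm_apply_eq]
  ext
  simp [mul_comm, add_comm]

theorem keyStore_left (i : Fin n) (k : Fin m) : keyStore A C (i * m + k) = A i k := by
  rw [keyStore, dif_pos (val_lt_mul i k), finProdFinEquiv_symm_mk]

theorem keyStore_right (i : Fin n) (j : Fin m) : keyStore A C (n * m + i * m + j) = C i j := by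
  have h : n * m + i * m + j - n * m = i * m + j := by omega
  have h' := val_lt_mul i j
  simp only [keyStore, dif_neg (show ¬ n * m + i * m + j < n * m by omega), h, dif_pos h',
    finProdFinEquiv_symm_mk]

theorem keyStore_bot : keyStore A C (n * m * 2) = ⊥ := by
  rw [keyStore, dif_neg (by omega), dif_neg (by omega)]

theorem inputMemory_arr_zero (k j : Fin m) :
    (inputMemory n B).arr 0 (j + m * k) = (B k j).toNat := by
  have h' := val_lt_mul k j
  have h : (j : ℕ) + m * k = k * m + j := by ring
  simp only [inputMemory, if_true, h, dif_pos h', finProdFinEquiv_symm_mk]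

theorem inputMemory_arr_of_ne {a : ℕ} (ha : a ≠ 0) (x : ℕ) : (inputMemory n B).arr a x = 0 := by
  simp [inputMemory, ha]

theorem inputMemory_bdd {Z : ℕ} (hZ : 100 < Z) (hn : n < Z) (hm : m < Z) :
    (inputMemory n B).Bdd Z := by
  refine ⟨hZ, fun x => ?_, fun a x => ?_⟩
  · simp only [inputMemory]
    split_ifs <;> omega
  · simp only [inputMemory]
    split_ifs
    · exact lt_of_le_of_lt (Bool.toNat_le _) (by omega)
    all_goals omega

/-- A matrix is the product if and only if it bounds all selected entries and all its entries
are attained. -/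
theorem eq_maxSemiBool_iff [LinearOrder α] : C = maxSemiBool A B ↔
    (∀ i k j, B k j = true → (A i k : WithBot α) ≤ C i j) ∧
      ∀ i j, C i j = ⊥ ∨ ∃ k, A i k = C i j ∧ B k j = true := by
  constructor
  · rintro rfl
    refine ⟨fun i k j h => Finset.le_sup (f := fun k => (A i k : WithBot α)) (by simpa using h),
      fun i j => ?_⟩
    rcases (Finset.univ.filter fun k => B k j = true).eq_empty_or_nonempty with h | h
    · exact Or.inl (by rw [maxSemiBool, h, Finset.sup_empty])
    · obtain ⟨k, hk, he⟩ := Finset.exists_mem_eq_sup _ h fun k => (A i k : WithBot α)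
      exact Or.inr ⟨k, he.symm, by simpa using hk⟩
  · rintro ⟨h1, h2⟩
    refine Matrix.ext fun i j => ?_
    refine le_antisymm ?_ (Finset.sup_le fun k hk => h1 i k j (by simpa using hk))
    rcases h2 i j with h | ⟨k, h, hk⟩
    · simp [h]
    · rw [← h]
      exact Finset.le_sup (f := fun k => (A i k : WithBot α)) (by simpa using hk)

end Input

end TwoTokens

namespace TwoTokens

/-! ## The reduction -/

/-- The program of the reduction for nonempty matrices. -/
def constructProg : Prog :=
  sizeProg ;; powProg ;; waitProg ;; netProg ;; lineProg ;; matrixProg ;; fillProg ;; rowsProg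

section Construct

variable {K : Type*} [LinearOrder K] {Z : ℕ} {keys : ℕ → K} {n m : ℕ} {s : Memory}

/-- The memory holds the game for the keys, with a network for `2 ^ L` elements. -/
structure Constructed (keys : ℕ → K) (n m L H : ℕ) (b : ℕ → ℕ) (s : Memory) : Prop where
  env : Env n m L H s
  r3 : s.reg 3 = n
  wait : ∀ x < n, s.arr 1 x = x ∧ s.arr 2 x = x
  r4 : s.reg 4 ≤ L * 2 * 2 ^ L * 8 + 2 ^ L * 2 + m * m * 4
  edge : ∀ u v, EdgeIn s u v ↔ NetEdge L (2 ^ L) H m (fun k j => b (j + m * k) ≠ 0) u v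
  ones : ∀ a, a = 6 ∨ a = 7 ∨ a = 8 ∨ a = 10 → ∀ x < n * (half L (2 ^ L) * 2 + 1), s.arr a x = 1
  live : ∀ i < n, ∃ live, RowRouted L (fun e => keys (rowAddr n m H i e)) live ∧
    ∀ v < half L (2 ^ L) * 2 + 1, s.arr 5 (v + (half L (2 ^ L) * 2 + 1) * i) = 0 ↔ live v
  bad : ∀ a < n * (half L (2 ^ L) * 2 + 1), s.arr 9 a = 0 ↔
    ∃ i < n, a = (half L (2 ^ L) * 2 + 1) * i ∧ ∃ j < m,
      ¬ Attained m H (fun e => keys (rowAddr n m H i e)) (keys (n * m * 2)) b (H + j)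

/-- The edges of the network and of `B` are written once for all rows. Only the tables and the
treatment of the rows contribute to the term with factor `n`. -/
theorem runs_constructProg {L H : ℕ} (hL : L = Nat.log 2 m + 2) (hH : H = 2 ^ (Nat.log 2 m + 1))
    (hm : m ≠ 0) (hb : Bounds n m L H Z) (h0 : s.reg 0 = n) (h1 : s.reg 1 = m)
    (h4 : s.reg 4 = 0)
    (hinj : ∀ i < n, ∀ k < m, ∀ k' < m, keys (i * m + k) = keys (i * m + k') → k = k') :
    Runs Z keys constructProg s (n * (half L (2 ^ L) * 50 * 2 + L * 2 ^ L * 1200 + 290) +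
      L * 2 ^ L * 960 + 2 ^ L * 80 + m * m * 360 + L * 60 + 200)
      (Constructed keys n m L H (s.arr 0)) := by
  have hsize : Runs Z keys sizeProg s (L * 20 + 40) (Env n m L H) := by
    subst hL hH
    exact runs_sizeProg hm hb h0 h1
  have hl := layers_eq (L := L)
  unfold constructProg
  refine Runs.seq _ (n * (half L (2 ^ L) * 50 * 2 + L * 2 ^ L * 1200 + 290) +
      L * 2 ^ L * 960 + 2 ^ L * 80 + m * m * 360 + L * 40 + 160) hsize
    (fun s₁ _ f₁ e₁ => ?_) (by omega)
  refine Runs.seq _ (n * (half L (2 ^ L) * 50 * 2 + L * 2 ^ L * 1200 + 290) +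
      L * 2 ^ L * 960 + 2 ^ L * 80 + m * m * 360 + 140) (runs_powProg hb e₁)
    (fun s₂ _ f₂ p₂ => ?_) (by omega)
  have e₂ := e₁.frame f₂ rfl
  refine Runs.seq _ (n * (half L (2 ^ L) * 50 * 2 + L * 2 ^ L * 1200 + 270) +
      L * 2 ^ L * 960 + 2 ^ L * 80 + m * m * 360 + 120) (runs_waitProg hb e₂)
    (fun s₃ _ f₃ w₃ => ?_) (by rw [Nat.mul_add n _ 290, Nat.mul_add n _ 270]; omega)
  have e₃ := e₂.frame f₃ rfl
  have p₃ := p₂.frame f₃ rfl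
  have r₃ : s₃.reg 4 = 0 := by rw [f₃.reg 4 rfl, f₂.reg 4 rfl, f₁.reg 4 rfl, h4]
  refine Runs.seq _ (n * (half L (2 ^ L) * 50 * 2 + L * 2 ^ L * 1200 + 270) +
      2 ^ L * 80 + m * m * 360 + 100) (runs_netProg hb e₃ p₃ r₃)
    (fun s₄ _ f₄ q₄ => ?_) (by rw [Nat.mul_right_comm L 2]; omega)
  have e₄ := e₃.frame f₄ rfl
  have p₄ := p₃.frame f₄ rfl
  refine Runs.seq _ (n * (half L (2 ^ L) * 50 * 2 + L * 2 ^ L * 1200 + 270) +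
      m * m * 360 + 80) (runs_lineProg hb e₄ q₄.1) (fun s₅ _ f₅ q₅ => ?_) (by omega)
  have e₅ := e₄.frame f₅ rfl
  have p₅ := p₄.frame f₅ rfl
  refine Runs.seq _ (n * (half L (2 ^ L) * 50 * 2 + L * 2 ^ L * 1200 + 270) + 60)
    (runs_matrixProg hb e₅ q₅.1 (by omega)) (fun s₆ _ f₆ q₆ => ?_) (by omega)
  have e₆ := e₅.frame f₆ rfl
  have p₆ := p₅.frame f₆ rfl
  refine Runs.seq _ (n * (L * 2 ^ L * 1200 + 220) + 40) (runs_fillProg hb e₆)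
    (fun s₇ _ f₇ q₇ => ?_) (by
      have : n * (half L (2 ^ L) * 50 * 2 + L * 2 ^ L * 1200 + 270) =
        n * (half L (2 ^ L) * 2 + 1) * 50 + n * (L * 2 ^ L * 1200 + 220) := by ring
      omega)
  have e₇ := e₆.frame f₇ rfl
  have p₇ := p₆.frame f₇ rfl
  refine Runs.weaken (runs_rowsProg hb e₇ p₇ hinj (q₇ 5 (by norm_num) (by norm_num))
    (q₇ 9 (by norm_num) (by norm_num))) (by omega) (fun s₈ _ f₈ q₈ => ?_)
  have b₅ : s₅.arr 0 = s.arr 0 := by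
    rw [f₅.arr 0 rfl, f₄.arr 0 rfl, f₃.arr 0 rfl, f₂.arr 0 rfl, f₁.arr 0 rfl]
  have b₇ : s₇.arr 0 = s.arr 0 := by rw [f₇.arr 0 rfl, f₆.arr 0 rfl, b₅]
  rw [b₇] at q₈
  rw [b₅] at q₆
  refine ⟨e₇.frame f₈ rfl, ?_, ?_, ?_, ?_, ?_, q₈.1, q₈.2⟩
  · rw [f₈.reg 3 rfl, f₇.reg 3 rfl, f₆.reg 3 rfl, f₅.reg 3 rfl, f₄.reg 3 rfl, w₃.1]
  · rw [f₈.arr 1 rfl, f₇.arr 1 rfl, f₆.arr 1 rfl, f₅.arr 1 rfl, f₄.arr 1 rfl,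
      f₈.arr 2 rfl, f₇.arr 2 rfl, f₆.arr 2 rfl, f₅.arr 2 rfl, f₄.arr 2 rfl]
    exact w₃.2
  · rw [f₈.reg 4 rfl, f₇.reg 4 rfl]
    exact q₆.1
  · intro u v
    have h : EdgeIn s₈ u v ↔ EdgeIn s₆ u v := by
      simp only [EdgeIn, f₈.reg 4 rfl, f₇.reg 4 rfl, f₈.arr 3 rfl, f₇.arr 3 rfl, f₈.arr 4 rfl,
        f₇.arr 4 rfl]
    rw [h, q₆.2, q₅.2, q₄.2]
    constructor
    · rintro ((⟨t, p, b, b', ht, hp, hb, hb', ⟨rfl, rfl⟩ | ⟨rfl, rfl⟩⟩ |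
        ⟨q, hq, ⟨rfl, rfl⟩ | ⟨rfl, rfl⟩⟩) | ⟨k, j, b, b', hk, hj, hb, hb', hB, rfl, rfl⟩)
      exacts [.forward t p b b' ht hp hb hb', .backward t p b b' ht hp hb hb', .cross q hq,
        .line q hq, .matrix k j b b' hk hj hb hb' hB]
    · rintro (⟨t, p, b, b', ht, hp, hb, hb'⟩ | ⟨t, p, b, b', ht, hp, hb, hb'⟩ | ⟨q, hq⟩ |
        ⟨q, hq⟩ | ⟨k, j, b, b', hk, hj, hb, hb', hB⟩)
      · exact Or.inl (Or.inl ⟨t, p, b, b', ht, hp, hb, hb', Or.inl ⟨rfl, rfl⟩⟩)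
      · exact Or.inl (Or.inl ⟨t, p, b, b', ht, hp, hb, hb', Or.inr ⟨rfl, rfl⟩⟩)
      · exact Or.inl (Or.inr ⟨q, hq, Or.inl ⟨rfl, rfl⟩⟩)
      · exact Or.inl (Or.inr ⟨q, hq, Or.inr ⟨rfl, rfl⟩⟩)
      · exact Or.inr ⟨k, j, b, b', hk, hj, hb, hb', hB, rfl, rfl⟩
  · rintro a (rfl | rfl | rfl | rfl)
    · rw [f₈.arr 6 rfl]; exact q₇ 6 (by norm_num) (by norm_num)
    · rw [f₈.arr 7 rfl]; exact q₇ 7 (by norm_num) (by norm_num)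
    · rw [f₈.arr 8 rfl]; exact q₇ 8 (by norm_num) (by norm_num)
    · rw [f₈.arr 10 rfl]; exact q₇ 10 (by norm_num) (by norm_num)

end Construct

/-! ### Size and time -/

section Size

variable {n m L : ℕ}

theorem network_size_le (hm : m ≠ 0) (hL : L = Nat.log 2 m + 2) :
    L * 2 ^ L ≤ 8 * (m * (Nat.log 2 m + 1)) := by
  subst hL
  have h := Nat.pow_log_le_self 2 hm
  calc (Nat.log 2 m + 2) * 2 ^ (Nat.log 2 m + 2)
      ≤ (2 * (Nat.log 2 m + 1)) * (4 * m) := by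
        refine Nat.mul_le_mul (by omega) ?_
        rw [pow_add]
        omega
    _ = 8 * (m * (Nat.log 2 m + 1)) := by ring

theorem half_le (hL : 0 < L) : half L (2 ^ L) ≤ 6 * (L * 2 ^ L) := by
  have : 1 * 2 ^ L ≤ L * 2 ^ L := Nat.mul_le_mul_right _ hL
  have h := layers_eq (L := L)
  rw [Nat.mul_right_comm L 2] at h
  omega

theorem mul_log_le (hm : m ≠ 0) : m * (Nat.log 2 m + 1) ≤ m * m :=
  Nat.mul_le_mul_left _ (Nat.log_lt_self 2 hm)

theorem two_thousand_mul_pow_le {z : ℕ} (hz : 2 ≤ z) : 2000 * z ^ 3 ≤ z ^ 14 := by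
  -- The constant is absorbed by `2 ^ 11 = 2048`.
  rw [show 14 = 11 + 3 from rfl, pow_add]
  exact Nat.mul_le_mul_right _ (le_trans (by norm_num) (Nat.pow_le_pow_left hz 11))

theorem bounds_of_ne_zero {Z : ℕ} (hm : m ≠ 0) (hz : 2000 * (n + m + 2) ^ 3 ≤ Z) :
    Bounds n m (Nat.log 2 m + 2) (2 ^ (Nat.log 2 m + 1)) Z := by
  obtain ⟨L, hL⟩ : ∃ L, L = Nat.log 2 m + 2 := ⟨_, rfl⟩
  have hs := network_size_le hm hL
  have hlog := mul_log_le hm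
  have hh := half_le (L := L) (by omega)
  have hM : 1 * 2 ^ L ≤ L * 2 ^ L := Nat.mul_le_mul_right _ (by omega)
  have htwo : 2 ^ (Nat.log 2 m + 1) * 2 = 2 ^ L := by rw [hL, pow_succ 2 (Nat.log 2 m + 1)]
  have hlt : m < 2 ^ (Nat.log 2 m + 1) := Nat.lt_pow_succ_log_self (by norm_num) m
  rw [← hL]
  set z := n + m + 2 with hz'
  have h1 : m * m ≤ z * z := Nat.mul_le_mul (by omega) (by omega)
  have h2 : n * m ≤ z * z := Nat.mul_le_mul (by omega) (by omega)
  have h3 : z * z * 1 ≤ z * z * z := Nat.mul_le_mul_left _ (by omega)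
  have h4 : z * 1 ≤ z * z := Nat.mul_le_mul_left _ (by omega)
  have h5 : z ^ 3 = z * z * z := by ring
  -- Here `half` is at most `6 * 8` times `m * (log m + 1)`, hence at most `48 * z ^ 2`; doubling
  -- and the additional vertex give `97`.
  have h6 : (n + 1) * (half L (2 ^ L) * 2 + 1) ≤ z * (97 * (z * z)) :=
    Nat.mul_le_mul (by omega) (by omega)
  have h7 : z * (97 * (z * z)) = 97 * (z * z * z) := by ring
  rw [h5] at hz
  exact ⟨by omega, htwo, hlt, by omega, by omega, by omega, by omega, by omega⟩

/-- Per row the cost is at most `4800 + 9600 + 290` times `m * (log m + 1)`. The terms without `n`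
are bounded by a multiple of `m ^ 2`, as `log m + 1 ≤ m`. The final `+ 2` pays for the test of `m`.
-/
theorem time_le (hm : m ≠ 0) (hL : L = Nat.log 2 m + 2) :
    n * (half L (2 ^ L) * 50 * 2 + L * 2 ^ L * 1200 + 290) +
      L * 2 ^ L * 960 + 2 ^ L * 80 + m * m * 360 + L * 60 + 200 + 2 ≤
    20000 * (n * m * (Nat.log 2 m + 1) + m ^ 2 + 1) := by
  have hs := network_size_le hm hL
  have hlog := mul_log_le hm
  have hh := half_le (L := L) (by omega)
  have hM : 1 * 2 ^ L ≤ L * 2 ^ L := Nat.mul_le_mul_right _ (by omega)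
  have hL' : L * 1 ≤ L * 2 ^ L := Nat.mul_le_mul_left _ Nat.one_le_two_pow
  have hp : 0 < m * (Nat.log 2 m + 1) := by positivity
  have h1 : n * (half L (2 ^ L) * 50 * 2 + L * 2 ^ L * 1200 + 290) ≤
      n * (20000 * (m * (Nat.log 2 m + 1))) := Nat.mul_le_mul_left _ (by omega)
  have h2 : n * (20000 * (m * (Nat.log 2 m + 1))) = 20000 * (n * m * (Nat.log 2 m + 1)) := by ring
  have h3 : ∀ T, T ≤ 20000 * (n * m * (Nat.log 2 m + 1)) →
      T + L * 2 ^ L * 960 + 2 ^ L * 80 + m * m * 360 + L * 60 + 200 + 2 ≤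
        20000 * (n * m * (Nat.log 2 m + 1) + m * m + 1) := by
    intro T hT
    omega
  rw [sq m]
  exact h3 _ (h1.trans_eq h2)

theorem edges_le (hm : m ≠ 0) (hL : L = Nat.log 2 m + 2) :
    n + (L * 2 * 2 ^ L * 8 + 2 ^ L * 2 + m * m * 4) ≤
    20000 * (n * m * (Nat.log 2 m + 1) + m ^ 2 + 1) := by
  have hs := network_size_le hm hL
  have hlog := mul_log_le hm
  have hM : 1 * 2 ^ L ≤ L * 2 ^ L := Nat.mul_le_mul_right _ (by omega)
  have hp : 0 < m * (Nat.log 2 m + 1) := by positivity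
  have h1 : n * 1 ≤ n * (m * (Nat.log 2 m + 1)) := Nat.mul_le_mul_left _ hp
  rw [sq m, mul_assoc n, Nat.mul_right_comm L 2]
  omega

theorem order_le (hm : m ≠ 0) (hL : L = Nat.log 2 m + 2) :
    half L (2 ^ L) * 2 + 1 ≤ 20000 * (m * (Nat.log 2 m + 1)) := by
  have hs := network_size_le hm hL
  have hh := half_le (L := L) (by omega)
  have hp : 0 < m * (Nat.log 2 m + 1) := by positivity
  omega

end Size

/-! ### Correctness -/

section Correctness

variable {n m : ℕ} {α : Type*} {A : Matrix (Fin n) (Fin m) α}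
  {C : Matrix (Fin n) (Fin m) (WithBot α)} {B : Matrix (Fin m) (Fin m) Bool}

theorem rowAddr_left {H k : ℕ} (i : ℕ) (hk : k < H) : rowAddr n m H i k = i * m + k := if_pos hk

theorem rowAddr_right {H j : ℕ} (i : ℕ) : rowAddr n m H i (H + j) = n * m + i * m + j := by
  rw [rowAddr, if_neg (by omega), Nat.add_sub_cancel_left]

theorem keyStore_inj (hA : RowDistinct A) : ∀ i < n, ∀ k < m, ∀ k' < m,
    keyStore A C (i * m + k) = keyStore A C (i * m + k') → k = k' := by
  intro i hi k hk k' hk' h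
  have h1 := keyStore_left (A := A) (C := C) ⟨i, hi⟩ ⟨k, hk⟩
  have h2 := keyStore_left (A := A) (C := C) ⟨i, hi⟩ ⟨k', hk'⟩
  simp only at h1 h2
  rw [h1, h2, WithBot.coe_inj] at h
  by_contra hne
  exact hA ⟨i, hi⟩ ⟨k, hk⟩ ⟨k', hk'⟩ (by simpa using hne) h

variable [LinearOrder α]

theorem attained_iff {H : ℕ} (hlt : m < H) (i : Fin n) (j : Fin m) :
    Attained m H (fun e => keyStore A C (rowAddr n m H i e)) (keyStore A C (n * m * 2))
      ((inputMemory n B).arr 0) (H + j) ↔ C i j = ⊥ ∨ ∃ k, A i k = C i j ∧ B k j = true := by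
  simp only [Attained, rowAddr_right, keyStore_right, keyStore_bot, le_bot_iff,
    Nat.add_sub_cancel_left]
  refine or_congr_right ⟨?_, ?_⟩
  · rintro ⟨k, hk, h, hB⟩
    rw [rowAddr_left _ (by omega)] at h
    have h' := keyStore_left (A := A) (C := C) i ⟨k, hk⟩
    simp only at h'
    rw [h'] at h
    have hB' := inputMemory_arr_zero (n := n) (B := B) ⟨k, hk⟩ j
    simp only at hB'
    rw [hB'] at hB
    exact ⟨⟨k, hk⟩, h, by simpa using hB⟩
  · rintro ⟨k, h, hB⟩
    refine ⟨k, k.2, ?_, ?_⟩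
    · rw [rowAddr_left _ (by omega), keyStore_left, h]
    · rw [inputMemory_arr_zero, hB]
      simp

theorem Constructed.output {L H : ℕ} {s : Memory}
    (h : Constructed (keyStore A C) n m L H ((inputMemory n B).arr 0) s)
    (hL : 0 < L) (hlt : m < H) (hHm : H + m ≤ 2 ^ L)
    (hzero : ∀ a, 11 ≤ a → a ≤ 14 → ∀ x, s.arr a x = 0) :
    ∃ I : WinningSetClaim (Fin n) (Fin (half L (2 ^ L) * 2 + 1)), EncodesClaim s I ∧
      (I.IsCorrect ↔ C = maxSemiBool A B) ∧
      ((∃ σ, σ ∈ I.game.toReachGame.survivingSet .bob) ↔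
        ∃ i j k, B k j = true ∧ C i j < (A i k : WithBot α)) := by
  obtain ⟨N, hN⟩ : ∃ N, half L (2 ^ L) * 2 + 1 = N := ⟨_, rfl⟩
  have hlive := h.live
  have hbad := h.bad
  have hones := h.ones
  choose! live hlive using hlive
  have htri := waitingClaim_isCorrect_and_survivingSet (n := n) (N := N) (m := m) (H := H)
    (B := fun k j => (inputMemory n B).arr 0 (j + m * k) ≠ 0) hL hHm hlt.le
    (fun i hi => (hlive i hi).1)
    (bad := fun u v => s.arr 9 (v + N * u) = 0) hN
  have hr2 := h.env.r2
  have hedge : ∀ u v, NetEdge L (2 ^ L) H m (fun k j => (inputMemory n B).arr 0 (j + m * k) ≠ 0)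
      u v → u < N ∧ v < N := fun u v he => hN ▸ he.lt hHm
  rw [hN] at hlive hbad hones hr2 ⊢
  have hcell : ∀ (u : Fin n) (v : Fin N), (v : ℕ) + N * u < n * N := by
    intro u v
    have := val_lt_mul u v
    rw [mul_comm N, add_comm]
    exact this
  have hB : ∀ k j : Fin m, (inputMemory n B).arr 0 (j + m * k) ≠ 0 ↔ B k j = true := by
    intro k j
    rw [inputMemory_arr_zero]
    simp
  have hkeyA : ∀ (i : Fin n) (k : Fin m),
      keyStore A C (rowAddr n m H i k) = A i k := by
    intro i k
    rw [rowAddr_left _ (by omega), keyStore_left]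
  have hkeyC : ∀ (i : Fin n) (j : Fin m),
      keyStore A C (rowAddr n m H i (H + j)) = C i j := by
    intro i j
    rw [rowAddr_right, keyStore_right]
  refine ⟨_, ⟨h.env.r0, hr2, ?_, ?_, ?_, ?_, ?_, ?_, ?_⟩, htri.1.trans ?_, htri.2.trans ?_⟩
  · intro u v
    rw [h.r3]
    constructor
    · rintro ⟨e, he, rfl, rfl⟩
      rw [(h.wait e he).1, (h.wait e he).2]
      exact ⟨he, he, rfl⟩
    · rintro ⟨hu, hv, huv⟩
      exact ⟨u, hu, (h.wait u hu).1, (h.wait u hu).2.trans (Fin.mk.inj huv)⟩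
  · intro u v
    refine (h.edge u v).trans ⟨fun he => ⟨(hedge u v he).1, (hedge u v he).2, he⟩, ?_⟩
    exact fun ⟨_, _, he⟩ => he
  · intro u v
    refine ⟨?_, ?_⟩
    · rw [ne_eq, (hlive u u.2).2 v v.2]
      simp only [waitingClaim, Set.mem_ofPred_eq]
      split_ifs with h <;> simp [h]
    · rw [hones 6 (by norm_num) _ (hcell u v)]
      simp [waitingClaim]
  · intro u v
    rw [hones 7 (by norm_num) _ (hcell u v), hones 8 (by norm_num) _ (hcell u v)]
    simp [waitingClaim]
  · intro u v
    rw [hones 10 (by norm_num) _ (hcell u v)]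
    simp only [waitingClaim, Set.mem_ofPred_eq]
    constructor
    · constructor
      · rintro hne u' v' h0 he
        cases he
        exact hne h0
      · exact fun hall h0 => hall u v h0 rfl
    · simp
  · intro u v
    simp [waitingClaim, hzero 11, hzero 12]
  · intro u v
    simp [waitingClaim, hzero 13, hzero 14]
  · rw [eq_maxSemiBool_iff]
    refine and_congr ⟨?_, ?_⟩ ⟨?_, ?_⟩
    · intro hle i k j hkj
      have := hle i i.2 k k.2 j j.2 ((hB k j).2 hkj)
      rwa [hkeyA, hkeyC] at this
    · intro hle i hi k hk j hj hkj
      have := hle ⟨i, hi⟩ ⟨k, hk⟩ ⟨j, hj⟩ ((hB ⟨k, hk⟩ ⟨j, hj⟩).1 hkj)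
      rwa [← hkeyA, ← hkeyC] at this
    · intro hall i j
      rw [← attained_iff hlt]
      by_contra hcon
      -- A row with an entry of `C` that is not attained is flagged at vertex `0`, which exists
      -- because of the additional vertex.
      have hN0 : 0 < N := by omega
      refine hall i ⟨0, hN0⟩ ((hbad _ (hcell _ _)).2 ⟨i, i.2, ?_, j, j.2, hcon⟩)
      simp
    · intro hall u v h0
      obtain ⟨i, hi, -, j, hj, hna⟩ := (hbad _ (hcell u v)).1 h0
      exact hna ((attained_iff hlt ⟨i, hi⟩ ⟨j, hj⟩).2 (hall _ _))
  · constructor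
    · rintro ⟨i, hi, k, hk, j, hj, hkj, hlt'⟩
      refine ⟨⟨i, hi⟩, ⟨j, hj⟩, ⟨k, hk⟩, (hB ⟨k, hk⟩ ⟨j, hj⟩).1 hkj, ?_⟩
      rwa [← hkeyA, ← hkeyC]
    · rintro ⟨i, j, k, hkj, hlt'⟩
      refine ⟨i, i.2, k, k.2, j, j.2, (hB k j).2 hkj, ?_⟩
      rwa [hkeyA, hkeyC]

end Correctness

end TwoTokens

/-! ### The main theorem -/

open TwoTokens in
theorem mainTheorem1 :
    ∃ (p : Prog) (c d : ℕ),
      ∀ (α : Type*) [LinearOrder α] (n m : ℕ)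
        (A : Matrix (Fin n) (Fin m) α) (B : Matrix (Fin m) (Fin m) Bool)
        (C : Matrix (Fin n) (Fin m) (WithBot α)),
        RowDistinct A →
        ∃ (t : ℕ) (s : Memory) (N : ℕ) (I : WinningSetClaim (Fin n) (Fin N)),
          Exec ((n + m + 2) ^ d) (keyStore A C) p (inputMemory n B) t s ∧
          t ≤ c * (n * m * (Nat.log 2 m + 1) + m ^ 2 + 1) ∧
          EncodesClaim s I ∧
          s.reg 3 + s.reg 4 ≤ c * (n * m * (Nat.log 2 m + 1) + m ^ 2 + 1) ∧
          N ≤ c * (m * (Nat.log 2 m + 1)) ∧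
          (I.IsCorrect ↔ C = maxSemiBool A B) ∧
          ((∃ σ, σ ∈ I.game.toReachGame.survivingSet .bob) ↔
            ∃ i j k, B k j = true ∧ C i j < (A i k : WithBot α)) := by
  -- The memory stays below `Z = (n + m + 2) ^ 14`, and expressions with at most `40` leaves stay
  -- below `Z ^ 40`.
  refine ⟨.ite (.reg 1) constructProg .skip, 20000, 14 * 40, ?_⟩
  intro α _ n m A B C hA
  have h0 : (inputMemory n B).reg 0 = n := rfl
  have h1 : (inputMemory n B).reg 1 = m := rfl
  -- For `m = 0` the bound on the order forces `N = 0`, which excludes the network. There are no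
  -- configurations then, and the untouched input memory already encodes the empty game.
  rcases eq_or_ne m 0 with rfl | hm
  · have hcfg : ∀ σ : Config (Fin n) (Fin 0), False := by
      rintro (⟨u, v⟩ | ⟨v, u⟩) <;> exact v.elim0
    have hset : ∀ X Y : Set (Config (Fin n) (Fin 0)), X = Y := fun X Y =>
      Set.ext fun σ => (hcfg σ).elim
    refine ⟨3, inputMemory n B, 0, ⟨⟨⟨fun _ _ => False⟩, ⟨fun _ _ => False⟩, fun _ => .alice⟩,
      fun _ => ∅, fun _ => ∅⟩, ?_, by omega, ?_, ?_, by omega, ?_, ?_⟩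
    · refine Exec.iteFalse _ (e := .reg 1) (t := 1) ?_ h1 (.skip _)
      change 0 < _
      positivity
    · refine ⟨h0, rfl, ?_, ?_, ?_, ?_, ?_, ?_, ?_⟩
      · rintro u v
        simp [inputMemory]
      · rintro u v
        simp [inputMemory]
      all_goals exact fun u v => v.elim0
    · simp [inputMemory]
    · exact ⟨fun _ => Matrix.ext fun i j => j.elim0, fun _ P => ⟨hset _ _, hset _ _⟩⟩
    · exact ⟨fun ⟨σ, _⟩ => (hcfg σ).elim, fun ⟨_, j, _⟩ => j.elim0⟩
  · have hb := bounds_of_ne_zero (n := n) hm (two_thousand_mul_pow_le (by omega))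
    obtain ⟨L, hL⟩ : ∃ L, L = Nat.log 2 m + 2 := ⟨_, rfl⟩
    obtain ⟨H, hH⟩ : ∃ H, H = 2 ^ (Nat.log 2 m + 1) := ⟨_, rfl⟩
    rw [← hL, ← hH] at hb
    have hmZ : m < (n + m + 2) ^ 14 :=
      lt_of_lt_of_le (show m < n + m + 2 by omega) (Nat.le_self_pow (by norm_num) _)
    have hrun : Runs ((n + m + 2) ^ 14) (keyStore A C) (.ite (.reg 1) constructProg .skip)
        (inputMemory n B) _ (Constructed (keyStore A C) n m L H ((inputMemory n B).arr 0)) :=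
      Runs.ite rfl (Nat.le_add_left 2 _) (fun _ =>
        runs_constructProg hL hH hm hb h0 h1 rfl (keyStore_inj hA)) (fun h => absurd h hm)
    obtain ⟨t, s, he, ht, -, hs⟩ := hrun (inputMemory_bdd hb.lit hb.verts hmZ)
    have hf := he.frame
    -- Bob's claimed sets are empty, and their tables are simply never written.
    have hzero : ∀ a, 11 ≤ a → a ≤ 14 → ∀ x, s.arr a x = 0 := by
      intro a ha ha' x
      have : s.arr a = (inputMemory n B).arr a := by
        interval_cases a <;> exact hf.arr _ rfl
      rw [this, inputMemory_arr_of_ne (by omega)]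
    obtain ⟨I, hI, hcor, hsurv⟩ := hs.output hb.pos hb.lt
      (by have := hb.two; have := hb.lt; omega) hzero
    rw [← pow_mul] at he
    refine ⟨t, s, _, I, he, ht.trans (time_le hm hL), hI, ?_, order_le hm hL, hcor, hsurv⟩
    rw [hs.r3]
    exact (Nat.add_le_add_left hs.r4 n).trans (edges_le hm hL)
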